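/- **Problem and assumptions.** Consider $$\min_{x\in\mathbb R^n} f_0(x)=g(x)+h(x)\quad\text{s.t. } Ax=b,\ f_i(x)\le 0\ (i=1,\dots,m),\qquad A\in\mathbb R^{l\times n}. \tag{P}$$ Write $f=(f_1,\dots,f_m)$, $p=(y,z)\in\mathbb R^l\times\mathbb R^m$, $\|p\|^2=\|y\|^2+\|z\|^2$, $[v]_+$ for the componentwise positive part, $\partial f_0=\nabla g+\partial h$. Assume: 1. $h$ is proper, closed and convex with bounded domain, $D=\operatorname{diam}(\operatorname{dom} h)$; $g$ and the convex functions $f_i$ are differentiable on $\mathbb R^n$ with gradients that are Lipschitz continuous on bounded sets; $\max\{|f_i(x)|,\|\nabla f_i(x)\|\}\le B_i$ on $\operatorname{dom}h$. 2. There is $x_{\rm feas}\in\operatorname{int}(\operatorname{dom}h)$ with $Ax_{\rm feas}=b$ and $f_i(x_{\rm feas})<0$ for all $i$. 3. $g+\frac\rho2\|\cdot\|^2$ is convex, $\rho>0$. 4. $\partial h(x)\subseteq\mathcal N_{\operatorname{dom}h}(x)+\mathcal B_M$ on $\operatorname{dom}h$ (normal cone plus ball of radius $M\ge0$); $A$ has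 full row rank; $|f_0|\le B_0$ and $\|\nabla g\|\le G_0$ on $\operatorname{dom}h$. A point $x\in\operatorname{dom}h$ is an $\varepsilon$-KKT point of (P) with multiplier $p=(y,z)$, $z\ge0$, if $\sqrt{\|Ax-b\|^2+\|[f(x)]_+\|^2}\le\varepsilon$, $\operatorname{dist}\big(0,\partial f_0(x)+A^\top y+\sum_i z_i\nabla f_i(x)\big)\le\varepsilon$ and $\sum_i|z_if_i(x)|\le\varepsilon$. **Algorithms.** For a center $c$, the subproblem (P$_c$) is (P) with $f_0$ replaced by $f_0+\rho\|\cdot-c\|^2$. Its augmented Lagrangian is $\bar{\mathcal L}_\beta(x,p)=f_0(x)+\rho\|x-c\|^2+y^\top(Ax-b)+\frac\beta2\|Ax-b\|^2+\frac1{2\beta}\big(\|[z+\beta f(x)]_+\|^2-\|z\|^2\big)$. *AdapAPG*$(G,h,x,\mu,\epsilon)$, with parameters $L_{\min}\ge\mu$, $\gamma_1>1$, $\gamma_2\ge1$. Write $T_L(y)=\arg\min_u\langle\nabla G(y),u\rangle+\frac L2\|u-y\|^2+h(u)$, and say that $L$ is accepted at $y$ if $u=T_L(y)$ satisfies $G(u)\le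 G(y)+\langle\nabla G(y),u-y\rangle+\frac L2\|u-y\|^2$. First, $L_0$ is the first accepted value at $x$ among $\gamma_1L_{\min},\gamma_1^2L_{\min},\dots$; set $x^{-1}=x^0=T_{L_0}(x)$ and $\alpha_{-1}=1$. For $k=0,1,\dots$: let $M_k$ be the first $L\in\{L_k,\gamma_1L_k,\gamma_1^2L_k,\dots\}$ accepted at $y^k=x^k+\frac{\alpha(1-\alpha_{k-1})}{\alpha_{k-1}(1+\alpha)}(x^k-x^{k-1})$ with $\alpha=\sqrt{\mu/L}$; put $x^{k+1}=T_{M_k}(y^k)$, $\alpha_k=\sqrt{\mu/M_k}$, $L_{k+1}=\max\{L_{\min},M_k/\gamma_2\}$; return $x^{k+1}$ once $\operatorname{dist}(0,\nabla G(x^{k+1})+\partial h(x^{k+1}))\le\epsilon$. *iALM* (tolerance $\epsilon$, center $c$): start from any $x^0\in\operatorname{dom}h$, $p^0=0$ and the given $\beta_0>0$. For $k=0,1,\dots$: $x^{k+1}$ is the output of AdapAPG with $\mu=\rho$, started at $x^k$, for $\bar{\mathcal L}_{\beta_k}(\cdot,p^k)$ with tolerance $\sqrt{\frac{\sigma-1}{\sigma+1}}\frac\epsilon2\min\{1,\sqrt\rho\}$;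 $y^{k+1}=y^k+\beta_k(Ax^{k+1}-b)$, $z^{k+1}=[z^k+\beta_kf(x^{k+1})]_+$; return $(\beta_k,x^{k+1},p^{k+1})$ if $\max\{(\|p^k\|+\|p^{k+1}\|)/\beta_k,\ \sum_i|z_i^{k+1}f_i(x^{k+1})|\}\le\epsilon$, else $\beta_{k+1}=\sigma\beta_k$. *PenMM* (tolerance $\epsilon$, center $c$, initial penalty $\bar\beta$, multiplier $\bar p$): start with $x^0=c$, $p^0=\bar p$, $\beta_0=\bar\beta$. While $x^k$ is not an $\epsilon$-KKT point of (P$_c$) with multiplier $p^k$: $x^{k+1}$ is the output of AdapAPG with $\mu=\rho$, started at $x^k$, for $\bar{\mathcal L}_{\beta_k}(\cdot,\bar p)$ with tolerance $\epsilon\min\{1,\sqrt\rho\}$; $y^{k+1}=\bar y+\beta_k(Ax^{k+1}-b)$, $z^{k+1}=[\bar z+\beta_kf(x^{k+1})]_+$, $\beta_{k+1}=\sigma\beta_k$. Return the final $(x^k,p^k)$ and the last penalty used ($\bar\beta$ if none). *HiAPeM*: start from $x^0\in\operatorname{dom}h$, with $\sigma,\gamma>1$ and integers $N_0$, $N_1\ge1$.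 Iteration $k$ (a proximal-point iteration) is one call of iALM or PenMM with center $x^k$, producing $(\beta_k,x^{k+1},p^{k+1})$; iALM is always called with tolerance $\hat\varepsilon_1/2$ and initial penalty $\beta_0$, PenMM with tolerance $\hat\varepsilon_2/2$. After each call, the method outputs $(x^{k+1},p^{k+1})$ and stops if $\|x^{k+1}-x^k\|\le\frac\varepsilon{4\rho}$. Iterations $0,\dots,N_0-1$ are by iALM; the last one provides $\bar\beta$ and $\bar p$. Put $s=1$, $k=N_0$, $K_1=N_0+N_1$. While $x^k$ is not an $\varepsilon$-KKT point of (P) with multiplier $p^k$ (otherwise the method outputs $(x^k,p^k)$ and stops): perform one PenMM iteration with $\bar\beta$ and $\bar p$, replace $\bar\beta$ by the returned penalty and $k$ by $k+1$; if now $k=K_s-1$, perform one iALM iteration, replace $\bar\beta$ and $\bar p$ by the returned values, set $k=K_s$, $K_{s+1}=K_s+\lceil\gamma^sN_1\rceil$ and increase $s$ by one. **Theorem.** Under these assumptions, assume $N_0\ge\frac{N_1}{\gamma-1}$. For $\varepsilon\in(0,\frac12]$ let $\hat\varepsilon_1=\varepsilon$ and $\hat\varepsilon_2=\frac{\varepsilon}{2\sqrt2}\min\{1,\frac1{\sqrt\rho}\}$.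 Put $$M_y=\frac{\sqrt{\lambda_{\max}(AA^\top)}}{\lambda_{\min}(AA^\top)}(G_0+2\rho D+M)\Big(1+\frac{D}{\operatorname{dist}(x_{\rm feas},\partial\operatorname{dom}h)}+\frac{D\max_iB_i}{\min_i|f_i(x_{\rm feas})|}\Big),\quad M_z=\frac{D(G_0+\rho D+M)}{\min_i|f_i(x_{\rm feas})|},\quad M_p=\sqrt{M_y^2+M_z^2}$$ ($M_y=0$ if $l=0$; if $m=0$, the quotients by $\min_i|f_i(x_{\rm feas})|$ are $0$; if $n=0$, so $D=0$, the quotient $D/\operatorname{dist}(x_{\rm feas},\partial\operatorname{dom}h)$ is $0$), $$\hat M=2M_p+\sqrt\sigma\max\Big\{\tfrac{\sqrt5}2M_p,\sqrt{M_p},\tfrac1{2\sqrt2}\Big\},\qquad \hat C=\max\Big\{\tfrac{16\sqrt2(3M_p^2+2\hat M^2)}{\min\{1,1/\sqrt\rho\}},\tfrac{16\sqrt2(M_p+\hat M)}{\min\{1,1/\sqrt\rho\}},4\Big\},$$ $$\tilde C=\max\Big\{\tfrac{96\rho(\gamma-1)}{N_1\log\gamma}\Big(\tfrac12+\tfrac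 D2+\tfrac{9\hat M}4+\tfrac{\hat C\sigma}4\Big),\varepsilon e\Big\},\qquad K_S=N_0+\sum_{s=1}^{S}\lceil\gamma^{s-1}N_1\rceil .$$ Then there is a smallest integer $S\ge0$ such that $$K_S\ge N_0+N_1\frac{\gamma^S-1}{\gamma-1}\ge\frac{96\rho B_0}{\varepsilon^2}+\frac{48\rho N_0(\frac D2+\hat M)}{\varepsilon}\quad\text{and}\quad\gamma^S\ge2\frac{\tilde C}\varepsilon\log\frac{\tilde C}\varepsilon .$$ For every $\beta_0>0$, $\gamma_1>1$, $\gamma_2\ge1$, $L_{\min}\ge\rho$, every $x^0\in\operatorname{dom}h$ and all choices of the starting points of iALM in $\operatorname{dom}h$, HiAPeM terminates after at most $K_S$ proximal-point iterations, and its output $(x,p)$ is such that $x$ is an $\varepsilon$-KKT point of (P) with multiplier $p$. Moreover $K_S=O(\varepsilon^{-2})$: with the problem data and $\sigma,\gamma,N_0,N_1$ fixed, there is a constant $C$ with $K_S\le C\varepsilon^{-2}$ for all $\varepsilon\in(0,\frac12]$. -/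

import Mathlib

open Real Set
open scoped Gradient

noncomputable section

namespace HiAPeM

/-- `ℝⁿ` with the Euclidean norm. -/
abbrev E (n : ℕ) : Type := EuclideanSpace ℝ (Fin n)

/-- Multipliers `p = (y, z)` with `y ∈ ℝˡ` (equalities) and `z ∈ ℝᵐ` (inequalities). -/
abbrev Dual (l m : ℕ) : Type := E l × E m

/-- The Euclidean norm of `p = (y, z)` (the default norm of a product is the maximum). -/
def dnorm {l m : ℕ} (p : Dual l m) : ℝ := √(‖p.1‖ ^ 2 + ‖p.2‖ ^ 2)

/-- The componentwise positive part `[v]₊`. -/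
def posVec {m : ℕ} (v : E m) : E m := WithLp.toLp 2 fun i => max (v i) 0

/-- Data of the problem `min f₀(x) = g(x) + h(x)` subject to `A x = b`, `fᵢ(x) ≤ 0`.
The proper extended-valued function `h` is given by its effective domain `dom` and its (finite)
values on `dom`; it is `+∞` outside `dom`, and the values of `h : E n → ℝ` there play no role. -/
structure Problem (n l m : ℕ) where
  A : Matrix (Fin l) (Fin n) ℝ
  b : E l
  f : Fin m → E n → ℝ
  g : E n → ℝ
  dom : Set (E n)
  h : E n → ℝ

variable {n l m : ℕ}

/-- The convex subdifferential at `x` of the function equal to `h` on `X` and `+∞` elsewhere. -/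
def subdiff (X : Set (E n)) (h : E n → ℝ) (x : E n) : Set (E n) :=
  {v | x ∈ X ∧ ∀ u ∈ X, h x + inner ℝ v (u - x) ≤ h u}

/-- The normal cone of `X` at `x`. -/
def normalCone (X : Set (E n)) (x : E n) : Set (E n) :=
  {v | ∀ u ∈ X, inner ℝ v (u - x) ≤ 0}

/-- `dist (0, ∂F(x)) ≤ ε` for `F = G + h`, `G` differentiable, `∂F = ∇G + ∂h`. The set `∂F(x)` is
closed, so the distance is attained when the set is nonempty, and it is `+∞` otherwise. -/
def IsStationary (X : Set (E n)) (h G : E n → ℝ) (ε : ℝ) (x : E n) : Prop :=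
  ∃ v ∈ subdiff X h x, ‖∇ G x + v‖ ≤ ε

namespace Problem

/-- The residual `A x - b`. -/
def res (P : Problem n l m) (x : E n) : E l := WithLp.toLp 2 (P.A.mulVec x.ofLp - P.b.ofLp)

/-- The constraint vector `f(x) = (f₁(x), …, f_m(x))`. -/
def fvec (P : Problem n l m) (x : E n) : E m := WithLp.toLp 2 fun i => P.f i x

/-- `Aᵀ y`. -/
def adj (P : Problem n l m) (y : E l) : E n := WithLp.toLp 2 (P.A.transpose.mulVec y.ofLp)

/-- `x` is an `ε`-KKT point with multiplier `p = (y, z)`: `x ∈ dom f₀`, `z ≥ 0`, and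
primal feasibility, dual feasibility (with `∂f₀ = ∇g + ∂h`) and complementarity up to `ε`.
A point is `ε`-KKT if this holds for some `p`. -/
def IsKKT (P : Problem n l m) (ε : ℝ) (x : E n) (p : Dual l m) : Prop :=
  x ∈ P.dom ∧ (∀ i, 0 ≤ p.2 i) ∧
  √(‖P.res x‖ ^ 2 + ‖posVec (P.fvec x)‖ ^ 2) ≤ ε ∧
  (∃ v ∈ subdiff P.dom P.h x,
    ‖∇ P.g x + v + P.adj p.1 + ∑ i, p.2 i • ∇ (P.f i) x‖ ≤ ε) ∧
  ∑ i, |p.2 i * P.f i x| ≤ ε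

/-- The proximal-point subproblem with center `c`: `f₀` is replaced by `f₀ + ρ‖· - c‖²`. -/
def prox (P : Problem n l m) (ρ : ℝ) (c : E n) : Problem n l m :=
  { P with g := fun x => P.g x + ρ * ‖x - c‖ ^ 2 }

/-- The smooth part (that is, without `h`) of the augmented Lagrangian `L_β(·, p)`. -/
def augLag (P : Problem n l m) (β : ℝ) (p : Dual l m) (x : E n) : ℝ :=
  P.g x + inner ℝ p.1 (P.res x) + β / 2 * ‖P.res x‖ ^ 2
    + 1 / (2 * β) * (‖posVec (p.2 + β • P.fvec x)‖ ^ 2 - ‖p.2‖ ^ 2)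

/-- `y + β (A x - b)` and `[z + β f(x)]₊`. -/
def multUpdate (P : Problem n l m) (β : ℝ) (p : Dual l m) (x : E n) : Dual l m :=
  (p.1 + β • P.res x, posVec (p.2 + β • P.fvec x))

/-! ### Assumptions -/

/-- Composite structure and smooth constraints. `h` is closed, convex and has a bounded domain;
`g` and the convex functions `fᵢ` are differentiable, with gradients that are Lipschitz
continuous on bounded sets (in particular on `dom h`). -/
structure CompositeSmooth (P : Problem n l m) : Prop where
  h_convex : ConvexOn ℝ P.dom P.h
  h_closed : IsClosed {q : E n × ℝ | q.1 ∈ P.dom ∧ P.h q.1 ≤ q.2}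
  dom_bounded : Bornology.IsBounded P.dom
  g_diff : Differentiable ℝ P.g
  g_smooth : ∀ s : Set (E n), Bornology.IsBounded s → ∃ L, LipschitzOnWith L (∇ P.g) s
  f_convex : ∀ i, ConvexOn ℝ univ (P.f i)
  f_diff : ∀ i, Differentiable ℝ (P.f i)
  f_smooth : ∀ i, ∀ s : Set (E n), Bornology.IsBounded s → ∃ L, LipschitzOnWith L (∇ (P.f i)) s

/-- `xfeas` is a Slater point. -/
structure IsSlater (P : Problem n l m) (xfeas : E n) : Prop where
  mem_interior : xfeas ∈ interior P.dom
  eq_feas : P.res xfeas = 0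
  ineq_feas : ∀ i, P.f i xfeas < 0

/-- `g` is weakly convex with constant `ρ > 0`. -/
structure WeaklyConvex (P : Problem n l m) (ρ : ℝ) : Prop where
  pos : 0 < ρ
  convex : ConvexOn ℝ univ fun x => P.g x + ρ / 2 * ‖x‖ ^ 2

/-- `∂h ⊆ N_{dom h} + B_M` on `dom h`, `A` has full row rank, and `|f₀| ≤ B₀` on `dom h`. -/
structure UniformBound (P : Problem n l m) (M B₀ : ℝ) : Prop where
  subdiff_bound : ∀ x ∈ P.dom, ∀ v ∈ subdiff P.dom P.h x,
    ∃ u ∈ normalCone P.dom x, ∃ w : E n, ‖w‖ ≤ M ∧ v = u + w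
  full_rank : P.A.rank = l
  obj_bound : ∀ x ∈ P.dom, |P.g x + P.h x| ≤ B₀

/-! ### Constants -/

/-- The diameter `D` of `dom h`. -/
def diam (P : Problem n l m) : ℝ := Metric.diam P.dom

/-- Largest eigenvalue of `A Aᵀ` (`0` if there are no equality constraints). -/
def lamMax (P : Problem n l m) : ℝ :=
  ⨆ i, (Matrix.isHermitian_mul_conjTranspose_self P.A).eigenvalues i

/-- Smallest eigenvalue of `A Aᵀ` (`0` if there are no equality constraints). -/
def lamMin (P : Problem n l m) : ℝ :=
  ⨅ i, (Matrix.isHermitian_mul_conjTranspose_self P.A).eigenvalues i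

/-- `M_y`. If `l = 0` its value is `0`; if `m = 0` the last summand is `0`. -/
def My (P : Problem n l m) (ρ M G₀ : ℝ) (B : Fin m → ℝ) (xfeas : E n) : ℝ :=
  √P.lamMax / P.lamMin * (G₀ + 2 * ρ * P.diam + M) *
    (1 + P.diam / Metric.infDist xfeas (frontier P.dom)
      + P.diam * (⨆ i, B i) / (⨅ i, |P.f i xfeas|))

/-- `M_z`. If `m = 0` its value is `0`. -/
def Mz (P : Problem n l m) (ρ M G₀ : ℝ) (xfeas : E n) : ℝ :=
  P.diam * (G₀ + ρ * P.diam + M) / (⨅ i, |P.f i xfeas|)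

/-- `M_p`. -/
def Mp (P : Problem n l m) (ρ M G₀ : ℝ) (B : Fin m → ℝ) (xfeas : E n) : ℝ :=
  √(P.My ρ M G₀ B xfeas ^ 2 + P.Mz ρ M G₀ xfeas ^ 2)

end Problem

/-- `M̂`. -/
def Mhat (σ Mp : ℝ) : ℝ :=
  2 * Mp + √σ * max (√5 / 2 * Mp) (max (√Mp) (1 / (2 * √2)))

/-- `Ĉ`. -/
def Chat (ρ σ Mp : ℝ) : ℝ :=
  max (16 * √2 * (3 * Mp ^ 2 + 2 * Mhat σ Mp ^ 2) / min 1 (1 / √ρ))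
    (max (16 * √2 * (Mp + Mhat σ Mp) / min 1 (1 / √ρ)) 4)

/-- `C̃`. -/
def Ctilde (ρ σ γ D Mp : ℝ) (N₁ : ℕ) (ε : ℝ) : ℝ :=
  max (96 * ρ * (γ - 1) / (N₁ * log γ) *
      (1 / 2 + D / 2 + 9 * Mhat σ Mp / 4 + Chat ρ σ Mp * σ / 4))
    (ε * exp 1)

/-- `K_S = N₀ + N₁ + ⌈γ N₁⌉ + ⋯ + ⌈γ^(S-1) N₁⌉`, the last iteration index of stage `S`. -/
def stageEnd (γ : ℝ) (N₀ N₁ S : ℕ) : ℕ :=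
  N₀ + ∑ s ∈ Finset.range S, ⌈γ ^ s * (N₁ : ℝ)⌉₊

/-- The conditions on `K_S` and `γ^S` that determine the stage number. -/
def StageCond (ρ σ γ D B₀ Mp : ℝ) (N₀ N₁ : ℕ) (ε : ℝ) (S : ℕ) : Prop :=
  (N₀ + N₁ * ((γ ^ S - 1) / (γ - 1)) ≤ (stageEnd γ N₀ N₁ S : ℝ)) ∧
  96 * ρ * B₀ / ε ^ 2 + 48 * ρ * N₀ * (D / 2 + Mhat σ Mp) / ε
    ≤ N₀ + N₁ * ((γ ^ S - 1) / (γ - 1)) ∧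
  2 * (Ctilde ρ σ γ D Mp N₁ ε / ε) * log (Ctilde ρ σ γ D Mp N₁ ε / ε) ≤ γ ^ S

/-! ### Algorithms

Algorithms are partial computations in exact real arithmetic: an element of `Part α` is defined
exactly when the computation terminates, and loops are `PFun.fix` (the body returns `Sum.inl` to
leave the loop with a result and `Sum.inr` to go on with a new state). -/

/-- A minimizer of `φ` over `X`; undefined if there is none. -/
def argminOn (X : Set (E n)) (φ : E n → ℝ) : Part (E n) :=
  ⟨∃ x ∈ X, IsMinOn φ X x, fun hx => hx.choose⟩

/-- `argmin_x ⟨∇G(y), x⟩ + L/2 ‖x - y‖² + h(x)`. -/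
def proxGrad (X : Set (E n)) (h G : E n → ℝ) (L : ℝ) (y : E n) : Part (E n) :=
  argminOn X fun x => inner ℝ (∇ G y) x + L / 2 * ‖x - y‖ ^ 2 + h x

/-- The line-search test `G(x) ≤ G(y) + ⟨∇G(y), x - y⟩ + L/2 ‖x - y‖²`. -/
def Descent (G : E n → ℝ) (L : ℝ) (y x : E n) : Prop :=
  G x ≤ G y + inner ℝ (∇ G y) (x - y) + L / 2 * ‖x - y‖ ^ 2

open Classical in
/-- The initial repeat loop of AdapAPG, entered with the value `L`; it returns `(L₀, x⁻¹)`. -/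
def apgInit (X : Set (E n)) (h G : E n → ℝ) (γ₁ : ℝ) (x : E n) : ℝ →. ℝ × E n :=
  PFun.fix fun L => do
    let x' ← proxGrad X h G (γ₁ * L) x
    if Descent G (γ₁ * L) x x' then pure (Sum.inl (γ₁ * L, x')) else pure (Sum.inr (γ₁ * L))

/-- The step size `α = √(μ/L)` and the extrapolated point `y` of the line search. -/
def extrap (μ : ℝ) (x xprev : E n) (αprev L : ℝ) : E n :=
  x + (√(μ / L) * (1 - αprev) / (αprev * (1 + √(μ / L)))) • (x - xprev)

open Classical in
/-- AccelLineSearch: the repeat loop, whose state is the value of `L` tried next (initially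
`L_k`); it returns `(x^{k+1}, M_k, α_k)`. -/
def accelLineSearch (X : Set (E n)) (h G : E n → ℝ) (μ γ₁ : ℝ) (x xprev : E n) (αprev : ℝ) :
    ℝ →. E n × ℝ × ℝ :=
  PFun.fix fun L => do
    let y := extrap μ x xprev αprev L
    let x' ← proxGrad X h G L y
    if Descent G L y x' then pure (Sum.inl (x', L, √(μ / L))) else pure (Sum.inr (L * γ₁))

/-- State of the main loop of AdapAPG: `x^{k-1}`, `x^k`, `L_k`, `α_{k-1}`. -/
structure APGState (n : ℕ) where
  xprev : E n
  x : E n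
  L : ℝ
  αprev : ℝ

open Classical in
/-- AdapAPG for `min G + h` with strong convexity constant `μ`, started at `x` with tolerance
`ε`: it returns a point with `dist (0, ∂(G + h)) ≤ ε`. -/
def adapAPG (X : Set (E n)) (h G : E n → ℝ) (x : E n) (μ ε Lmin γ₁ γ₂ : ℝ) : Part (E n) := do
  let (L₀, x₀) ← apgInit X h G γ₁ x Lmin
  PFun.fix (fun s : APGState n => do
    let (x', Mk, α) ← accelLineSearch X h G μ γ₁ s.x s.xprev s.αprev s.L
    if IsStationary X h G ε x' then pure (Sum.inl x')
    else pure (Sum.inr ⟨s.x, x', max Lmin (Mk / γ₂), α⟩)) ⟨x₀, x₀, L₀, 1⟩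

/-- Parameters of the methods. -/
structure Params where
  β₀ : ℝ
  σ : ℝ
  ρ : ℝ
  γ : ℝ
  γ₁ : ℝ
  γ₂ : ℝ
  Lmin : ℝ
  N₀ : ℕ
  N₁ : ℕ

/-- `(β, x, p)`: a state, or the output, of iALM and PenMM. -/
structure ALState (n l m : ℕ) where
  β : ℝ
  x : E n
  p : Dual l m

open Classical in
/-- iALM with tolerance `ε` on the subproblem with center `c`, started at `x₀`. -/
def iALM (P : Problem n l m) (r : Params) (ε : ℝ) (c x₀ : E n) : Part (ALState n l m) :=
  PFun.fix (fun s : ALState n l m => do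
    let x' ← adapAPG P.dom P.h ((P.prox r.ρ c).augLag s.β s.p) s.x r.ρ
      (√((r.σ - 1) / (r.σ + 1)) * (ε / 2) * min 1 √r.ρ) r.Lmin r.γ₁ r.γ₂
    let p' := P.multUpdate s.β s.p x'
    if max ((dnorm s.p + dnorm p') / s.β) (∑ i, |p'.2 i * P.f i x'|) ≤ ε then
      pure (Sum.inl ⟨s.β, x', p'⟩)
    else pure (Sum.inr ⟨r.σ * s.β, x', p'⟩)) ⟨r.β₀, x₀, 0⟩

open Classical in
/-- PenMM with tolerance `ε`, initial penalty parameter `β₀` and estimated multiplier `pbar`, on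
the subproblem with center `c`. The loop state is `(β_k, x^k, p^k)` together with the value
`β_out` to be returned if the loop is left now. -/
def penMM (P : Problem n l m) (r : Params) (ε β₀ : ℝ) (c : E n) (pbar : Dual l m) :
    Part (ALState n l m) :=
  PFun.fix (fun s : ALState n l m × ℝ =>
    if (P.prox r.ρ c).IsKKT ε s.1.x s.1.p then pure (Sum.inl ⟨s.2, s.1.x, s.1.p⟩)
    else do
      let x' ← adapAPG P.dom P.h ((P.prox r.ρ c).augLag s.1.β pbar) s.1.x r.ρ
        (ε * min 1 √r.ρ) r.Lmin r.γ₁ r.γ₂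
      pure (Sum.inr (⟨r.σ * s.1.β, x', P.multUpdate s.1.β pbar x'⟩, s.1.β)))
    (⟨β₀, c, pbar⟩, β₀)

/-- Output of HiAPeM: the number of proximal-point iterations (calls of iALM and PenMM) made,
the final point and its multiplier. -/
structure Output (n l m : ℕ) where
  iters : ℕ
  x : E n
  p : Dual l m

open Classical in
/-- The initial stage: iterations `k = 0, …, N₀ - 1` (`N₀ ≥ 1`), all by iALM. The loop state is
`(k, x^k)`. It either stops the method, or returns the last output of iALM. The free choice of the
starting point of the `k`-th proximal-point iteration inside iALM is `start k`. -/
def initialStage (P : Problem n l m) (r : Params) (ε ε₁ : ℝ) (start : ℕ → E n) (x₀ : E n) :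
    Part (Output n l m ⊕ ALState n l m) :=
  PFun.fix (fun s : ℕ × E n => do
    let o ← iALM P r (ε₁ / 2) s.2 (start s.1)
    if ‖o.x - s.2‖ ≤ ε / (4 * r.ρ) then pure (Sum.inl (Sum.inl ⟨s.1 + 1, o.x, o.p⟩))
    else if s.1 + 1 = r.N₀ then pure (Sum.inl (Sum.inr o))
    else pure (Sum.inr (s.1 + 1, o.x))) (0, x₀)

/-- State of the main loop of HiAPeM: the stage `s`, the iteration `k`, the end `K_s` of the stage,
the current penalty parameter `β̄_{s,t}`, the estimated multiplier `p̄^s`, and `(x^k, p^k)`. -/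
structure MainState (n l m : ℕ) where
  s : ℕ
  k : ℕ
  Ks : ℕ
  βbar : ℝ
  pbar : Dual l m
  x : E n
  p : Dual l m

open Classical in
/-- The body of the main while loop of HiAPeM. -/
def mainStep (P : Problem n l m) (r : Params) (ε ε₁ ε₂ : ℝ) (start : ℕ → E n)
    (q : MainState n l m) : Part (Output n l m ⊕ MainState n l m) :=
  if P.IsKKT ε q.x q.p then pure (Sum.inl ⟨q.k, q.x, q.p⟩)
  else do
    let o ← penMM P r (ε₂ / 2) q.βbar q.x q.pbar
    if ‖o.x - q.x‖ ≤ ε / (4 * r.ρ) then pure (Sum.inl ⟨q.k + 1, o.x, o.p⟩)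
    else if (q.k + 1) + 1 = q.Ks then
      (do
        let o' ← iALM P r (ε₁ / 2) o.x (start (q.k + 1))
        if ‖o'.x - o.x‖ ≤ ε / (4 * r.ρ) then pure (Sum.inl ⟨(q.k + 1) + 1, o'.x, o'.p⟩)
        else pure (Sum.inr
          ⟨q.s + 1, q.Ks, q.Ks + ⌈r.γ ^ q.s * (r.N₁ : ℝ)⌉₊, o'.β, o'.p, o'.x, o'.p⟩))
    else pure (Sum.inr ⟨q.s, q.k + 1, q.Ks, o.β, q.pbar, o.x, o.p⟩)

/-- HiAPeM, the hybrid of iALM and PenMM, with target accuracy `ε` and inner accuracies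
`ε₁` and `ε₂`. -/
def hiAPeM (P : Problem n l m) (r : Params) (ε ε₁ ε₂ : ℝ) (x₀ : E n) (start : ℕ → E n) :
    Part (Output n l m) := do
  match ← initialStage P r ε ε₁ start x₀ with
  | Sum.inl out => pure out
  | Sum.inr o =>
    PFun.fix (mainStep P r ε ε₁ ε₂ start) ⟨1, r.N₀, r.N₀ + r.N₁, o.β, o.p, o.x, o.p⟩

end HiAPeM

end

/-!
Every proximal-point iteration that does not stop HiAPeM moves the point by more than `ε/(4ρ)`, and
since the subproblem is strongly convex, this decreases the objective by at least `ε²/(24ρ)`, up to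
the errors made by the inner methods. The objective stays in `[-B₀, B₀]`, so it remains to see that
all inner methods terminate and that the errors add up to less than the decrease.

*Inner termination.* AdapAPG is an accelerated proximal gradient method; the potential
`F(x) - F(x*) + μ/2 ‖v - x*‖²` of its estimate sequence decreases linearly, which also confines the
extrapolated points to a ball and hence bounds the line search (`exists_mem_adapAPG`). The
subproblem has a saddle point `(x*, p*)` with `‖p*‖ ≤ M_p`, obtained as a limit of solutions of
quadratic penalty problems, whose multipliers are bounded through the Slater point
(`exists_isSaddle`). One step of either augmented Lagrangian method satisfies
`‖p⁺ - p*‖² + ‖p⁺ - p‖² ≤ ‖p - p*‖² + β δ²/(2ρ)` (`multUpdate_dist_le`). Therefore the multipliers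
remain controlled, and iALM and PenMM stop once the penalty parameter exceeds a threshold
(`exists_mem_iALM`, `exists_mem_penMM`).

*Errors.* Two regimes of the initial penalty parameter are distinguished. If `β₀ ≤ Ĉ/ε`, then the
multipliers are bounded by `M̂` and the penalty parameters by `σ Ĉ/ε` (`oracleSpec_of_le`). If
`β₀ > Ĉ/ε`, then all inner methods leave their loops at the first opportunity, and products of
multipliers and infeasibilities are still of order `ε` (`oracleSpec_of_lt`). Consecutive PenMM
iterations with a fixed estimated multiplier decrease the merit function `merit`, which differs
from the objective by `O(ε)` terms and is monotone in the penalty parameter, so that only `O(ε)` is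
lost per stage, and also per iteration of the initial stage (`exists_mem_fix_mainStep`,
`exists_mem_initialStage`).

*Counting.* The conditions on `K_S` and `γ^S` say that one half of the total decrease pays for
`2 B₀` and the initial stage and the other half for the `S` stages, whose number is only logarithmic
in `K_S` (`StageCond.budget_le`). Since `γ^S` is of the order `ε⁻²` when they first hold, so is `K_S`
(`exists_isLeast_stageCond`).
-/

noncomputable section

namespace HiAPeM

section

variable {n l m : ℕ}

/-! ### Termination of loops -/

/-- A loop terminates with a result satisfying `Q` if every state carries fuel (`J k s` reads
"`k` units suffice for the state `s`") of which each further pass consumes some. -/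
theorem exists_mem_fix {α β : Type*} (f : α →. β ⊕ α) (J : ℕ → α → Prop) (Q : β → Prop)
    (h : ∀ k s, J k s → (∃ b, Sum.inl b ∈ f s ∧ Q b) ∨
      ∃ s', Sum.inr s' ∈ f s ∧ ∃ k' < k, J k' s') :
    ∀ k s, J k s → ∃ b ∈ PFun.fix f s, Q b := by
  intro k
  induction k using Nat.strong_induction_on with
  | _ k ih =>
    intro s hs
    rcases h k s hs with ⟨b, hb, hQ⟩ | ⟨s', hs', k', hk', hJ⟩
    · exact ⟨b, PFun.fix_stop hb, hQ⟩
    · obtain ⟨b, hb, hQ⟩ := ih k' hk' s' hJ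
      exact ⟨b, by rw [PFun.fix_fwd_eq hs']; exact hb, hQ⟩

/-! ### Functions that are Lipschitz on bounded sets -/

section LipBdd

variable {V W : Type*} [NormedAddCommGroup V] [NormedAddCommGroup W]

/-- `F` is Lipschitz continuous on every ball around the origin. -/
def LipBdd (F : V → W) : Prop :=
  ∀ R : ℝ, ∃ L : ℝ, 0 ≤ L ∧ ∀ x y, ‖x‖ ≤ R → ‖y‖ ≤ R → ‖F x - F y‖ ≤ L * ‖x - y‖

theorem LipBdd.bounded {F : V → W} (hF : LipBdd F) (R : ℝ) :
    ∃ C : ℝ, 0 ≤ C ∧ ∀ x, ‖x‖ ≤ R → ‖F x‖ ≤ C := by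
  rcases lt_or_ge R 0 with hR | hR
  · exact ⟨0, le_rfl, fun x hx => absurd hx (not_le.2 (hR.trans_le (norm_nonneg x)))⟩
  obtain ⟨L, hL, h⟩ := hF R
  refine ⟨‖F 0‖ + L * R, by positivity, fun x hx => ?_⟩
  have h1 := h x 0 hx (by simpa using hR)
  rw [sub_zero] at h1
  have h2 : ‖F x‖ ≤ ‖F x - F 0‖ + ‖F 0‖ := by
    simpa using norm_add_le (F x - F 0) (F 0)
  nlinarith [mul_le_mul_of_nonneg_left hx hL]

theorem LipBdd.of_lipschitz {F : V → W} (K : ℝ) (hK : 0 ≤ K)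
    (h : ∀ x y, ‖F x - F y‖ ≤ K * ‖x - y‖) : LipBdd F :=
  fun _ => ⟨K, hK, fun x y _ _ => h x y⟩

theorem LipBdd.const (c : W) : LipBdd (fun _ : V => c) :=
  LipBdd.of_lipschitz 0 le_rfl (by simp)

theorem LipBdd.add {F G : V → W} (hF : LipBdd F) (hG : LipBdd G) :
    LipBdd (fun x => F x + G x) := by
  intro R
  obtain ⟨L, hL, h⟩ := hF R
  obtain ⟨L', hL', h'⟩ := hG R
  refine ⟨L + L', by positivity, fun x y hx hy => ?_⟩
  calc ‖F x + G x - (F y + G y)‖ = ‖(F x - F y) + (G x - G y)‖ := by congr 1; abel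
    _ ≤ ‖F x - F y‖ + ‖G x - G y‖ := norm_add_le _ _
    _ ≤ L * ‖x - y‖ + L' * ‖x - y‖ := add_le_add (h x y hx hy) (h' x y hx hy)
    _ = _ := by ring

theorem LipBdd.sum {ι : Type*} (s : Finset ι) {F : ι → V → W} (hF : ∀ i, LipBdd (F i)) :
    LipBdd (fun x => ∑ i ∈ s, F i x) := by
  classical
  induction s using Finset.induction_on with
  | empty => simpa using LipBdd.const (V := V) (0 : W)
  | insert a s ha ih => simpa [Finset.sum_insert ha] using (hF a).add ih

theorem LipBdd.smul [NormedSpace ℝ W] {a : V → ℝ} {F : V → W} (ha : LipBdd a) (hF : LipBdd F) :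
    LipBdd (fun x => a x • F x) := by
  intro R
  obtain ⟨L, hL, h⟩ := ha R
  obtain ⟨L', hL', h'⟩ := hF R
  obtain ⟨C, hC, hb⟩ := ha.bounded R
  obtain ⟨C', hC', hb'⟩ := hF.bounded R
  refine ⟨C * L' + L * C', by positivity, fun x y hx hy => ?_⟩
  calc ‖a x • F x - a y • F y‖ = ‖a x • (F x - F y) + (a x - a y) • F y‖ := by
        congr 1; rw [smul_sub, sub_smul]; abel
    _ ≤ ‖a x‖ * ‖F x - F y‖ + ‖a x - a y‖ * ‖F y‖ := by
        refine (norm_add_le _ _).trans (by rw [norm_smul, norm_smul])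
    _ ≤ C * (L' * ‖x - y‖) + (L * ‖x - y‖) * C' := by
        gcongr
        exacts [hb x hx, h' x y hx hy, h x y hx hy, hb' y hy]
    _ = _ := by ring

theorem LipBdd.max_zero {a : V → ℝ} (ha : LipBdd a) : LipBdd (fun x => max (a x) 0) := by
  intro R
  obtain ⟨L, hL, h⟩ := ha R
  refine ⟨L, hL, fun x y hx hy => le_trans ?_ (h x y hx hy)⟩
  simpa [Real.norm_eq_abs] using abs_max_sub_max_le_max (a x) 0 (a y) 0

end LipBdd

theorem lipBdd_of_lipschitzOnWith {F : E n → E n}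
    (h : ∀ s : Set (E n), Bornology.IsBounded s → ∃ L, LipschitzOnWith L F s) : LipBdd F := by
  intro R
  obtain ⟨L, hL⟩ := h (Metric.closedBall 0 R) Metric.isBounded_closedBall
  refine ⟨L, L.2, fun x y hx hy => ?_⟩
  simpa [dist_eq_norm] using hL.dist_le_mul x (by simpa using hx) y (by simpa using hy)

/-! ### First-order inequalities -/

theorem exists_segment_inner_gradient {G : E n → ℝ} (hG : Differentiable ℝ G) (x y : E n) :
    ∃ z ∈ segment ℝ x y, G y - G x = inner ℝ (∇ G z) (y - x) := by
  obtain ⟨z, hz, h⟩ := domain_mvt (f := G) (s := univ) (x := x) (y := y)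
    (f' := fun z => fderiv ℝ G z) (fun z _ => (hG z).hasFDerivAt.hasFDerivWithinAt) convex_univ
    (mem_univ _) (mem_univ _)
  exact ⟨z, hz, by rw [h, inner_gradient_left]⟩

theorem norm_le_of_mem_segment {x y z : E n} {R : ℝ} (hx : ‖x‖ ≤ R) (hy : ‖y‖ ≤ R)
    (hz : z ∈ segment ℝ x y) : ‖z‖ ≤ R := by
  have := (convex_closedBall (0 : E n) R).segment_subset (by simpa using hx) (by simpa using hy) hz
  simpa using this

theorem norm_sub_le_of_mem_segment {x y z : E n} (hz : z ∈ segment ℝ x y) :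
    ‖z - x‖ ≤ ‖y - x‖ := by
  obtain ⟨a, b, ha, hb, hab, rfl⟩ := hz
  have : a • x + b • y - x = b • (y - x) := by
    have : a = 1 - b := by linarith
    subst this; module
  rw [this, norm_smul, Real.norm_of_nonneg hb]
  nlinarith [norm_nonneg (y - x)]

/-- A differentiable function with a gradient that is Lipschitz on balls is itself so. -/
theorem LipBdd.of_gradient {G : E n → ℝ} (hG : Differentiable ℝ G) (h : LipBdd (∇ G)) :
    LipBdd G := by
  intro R
  obtain ⟨C, hC, hb⟩ := h.bounded R
  refine ⟨C, hC, fun x y hx hy => ?_⟩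
  obtain ⟨z, hz, h⟩ := exists_segment_inner_gradient hG y x
  rw [h]
  exact (norm_inner_le_norm _ _).trans
    (mul_le_mul_of_nonneg_right (hb z (norm_le_of_mem_segment hy hx hz)) (norm_nonneg _))

/-- The descent inequality on balls, with a constant that need not be sharp. -/
theorem exists_descent_const {G : E n → ℝ} (hG : Differentiable ℝ G) (h : LipBdd (∇ G)) (R : ℝ) :
    ∃ Λ : ℝ, 0 ≤ Λ ∧
      (∀ x y, ‖x‖ ≤ R → ‖y‖ ≤ R → ‖∇ G x - ∇ G y‖ ≤ Λ * ‖x - y‖) ∧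
      ∀ x y, ‖x‖ ≤ R → ‖y‖ ≤ R → G x ≤ G y + inner ℝ (∇ G y) (x - y) + Λ / 2 * ‖x - y‖ ^ 2 := by
  obtain ⟨L, hL, hl⟩ := h R
  refine ⟨2 * L, by positivity, fun x y hx hy => (hl x y hx hy).trans ?_, fun x y hx hy => ?_⟩
  · nlinarith [mul_nonneg hL (norm_nonneg (x - y))]
  obtain ⟨z, hz, h⟩ := exists_segment_inner_gradient hG y x
  have h1 : inner ℝ (∇ G z - ∇ G y) (x - y) ≤ L * ‖x - y‖ * ‖x - y‖ :=
    (real_inner_le_norm _ _).trans (mul_le_mul_of_nonneg_right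
      ((hl z y (norm_le_of_mem_segment hy hx hz) hy).trans
        (mul_le_mul_of_nonneg_left (norm_sub_le_of_mem_segment hz) hL)) (norm_nonneg _))
  rw [inner_sub_left] at h1
  nlinarith

theorem inner_gradient_le_of_convexOn {G : E n → ℝ} (hc : ConvexOn ℝ univ G)
    (hG : Differentiable ℝ G) (x y : E n) : G y + inner ℝ (∇ G y) (x - y) ≤ G x := by
  have h1 : ConvexOn ℝ univ (G ∘ AffineMap.lineMap (k := ℝ) y x) := by
    simpa using hc.comp_affineMap (AffineMap.lineMap (k := ℝ) y x)
  have h2 : HasDerivAt (G ∘ AffineMap.lineMap (k := ℝ) y x) (inner ℝ (∇ G y) (x - y)) 0 := by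
    rw [inner_gradient_left]
    have h3 : HasFDerivAt G (fderiv ℝ G y) (AffineMap.lineMap (k := ℝ) y x (0 : ℝ)) := by
      simpa using (hG y).hasFDerivAt
    exact h3.comp_hasDerivAt 0 AffineMap.hasDerivAt_lineMap
  have h4 := h1.le_slope_of_hasDerivAt (mem_univ 0) (mem_univ 1) one_pos h2
  simp [slope_def_field, -inner_gradient_left] at h4
  linarith

/-- `G` is differentiable, its gradient is Lipschitz on bounded sets, and `G` is strongly convex
with constant `μ`, in first-order form. -/
structure SmoothStronglyConvex (G : E n → ℝ) (μ : ℝ) : Prop where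
  diff : Differentiable ℝ G
  lip : LipBdd (∇ G)
  strong : ∀ x y, G y + inner ℝ (∇ G y) (x - y) + μ / 2 * ‖x - y‖ ^ 2 ≤ G x

/-! ### Minimization over the domain -/

/-- A closed convex function `h` with bounded nonempty domain `X` on which it is bounded. -/
structure ClosedConvexBounded (X : Set (E n)) (h : E n → ℝ) : Prop where
  nonempty : X.Nonempty
  convex : ConvexOn ℝ X h
  closed : IsClosed {q : E n × ℝ | q.1 ∈ X ∧ h q.1 ≤ q.2}
  bounded : Bornology.IsBounded X
  range_bounded : ∃ H, ∀ x ∈ X, |h x| ≤ H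

variable {X : Set (E n)} {h : E n → ℝ}

/-- The part of the epigraph of `h` below its upper bound is compact. -/
theorem ClosedConvexBounded.exists_compact_epi (hX : ClosedConvexBounded X h) :
    ∃ H, (∀ x ∈ X, |h x| ≤ H) ∧
      IsCompact {q : E n × ℝ | q.1 ∈ X ∧ h q.1 ≤ q.2 ∧ q.2 ≤ H} := by
  obtain ⟨H, hH⟩ := hX.range_bounded
  refine ⟨H, hH, ?_⟩
  have hb : Bornology.IsBounded {q : E n × ℝ | q.1 ∈ X ∧ h q.1 ≤ q.2 ∧ q.2 ≤ H} := by
    refine (hX.bounded.prod (Metric.isBounded_Icc (-H) H)).subset ?_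
    rintro ⟨x, t⟩ ⟨hx, h1, h2⟩
    exact ⟨hx, by linarith [(abs_le.1 (hH x hx)).1], h2⟩
  refine Metric.isCompact_of_isClosed_isBounded ?_ hb
  have : {q : E n × ℝ | q.1 ∈ X ∧ h q.1 ≤ q.2 ∧ q.2 ≤ H}
      = {q : E n × ℝ | q.1 ∈ X ∧ h q.1 ≤ q.2} ∩ {q | q.2 ≤ H} := by
    ext q; simp [and_assoc]
  rw [this]
  exact hX.closed.inter (isClosed_le continuous_snd continuous_const)

theorem ClosedConvexBounded.exists_isMinOn (hX : ClosedConvexBounded X h) {φ : E n → ℝ}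
    (hφ : Continuous φ) : ∃ x ∈ X, IsMinOn (fun x => φ x + h x) X x := by
  obtain ⟨H, hH, hc⟩ := hX.exists_compact_epi
  obtain ⟨x₀, hx₀⟩ := hX.nonempty
  obtain ⟨q, hq, hmin⟩ := hc.exists_isMinOn (f := fun q => φ q.1 + q.2)
    ⟨(x₀, h x₀), hx₀, le_rfl, (abs_le.1 (hH x₀ hx₀)).2⟩ (by fun_prop)
  refine ⟨q.1, hq.1, fun w hw => ?_⟩
  have h1 := hmin (a := (w, h w)) ⟨hw, le_rfl, (abs_le.1 (hH w hw)).2⟩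
  simp only [mem_ofPred_eq] at h1 ⊢
  linarith [hq.2.1]

/-- Fermat's rule, for a smooth part that is known up to second order along segments. -/
theorem ClosedConvexBounded.neg_mem_subdiff (hX : ClosedConvexBounded X h) {u a : E n} (hu : u ∈ X)
    (H : ∀ w ∈ X, ∃ C : ℝ, ∀ t : ℝ, 0 < t → t ≤ 1 →
      h u ≤ h (u + t • (w - u)) + t * inner ℝ a (w - u) + C * t ^ 2) :
    -a ∈ subdiff X h u := by
  refine ⟨hu, fun w hw => ?_⟩
  obtain ⟨C, hC⟩ := H w hw
  rw [inner_neg_left]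
  by_contra! hlt
  have key : ∀ t : ℝ, 0 < t → t ≤ 1 → h u ≤ h w + inner ℝ a (w - u) + C * t := by
    intro t ht ht1
    have h1 := hX.convex.2 hu hw (by linarith : 0 ≤ 1 - t) ht.le (by ring)
    have h2 : (1 - t) • u + t • w = u + t • (w - u) := by module
    rw [h2, smul_eq_mul, smul_eq_mul] at h1
    have h3 := hC t ht ht1
    have h4 : t * h u ≤ t * (h w + inner ℝ a (w - u) + C * t) := by nlinarith
    exact le_of_mul_le_mul_left h4 ht
  set gap := h u - (h w + inner ℝ a (w - u)) with hgap
  have hg : 0 < gap := by linarith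
  have hCp : 0 < |C| + 1 := by positivity
  have h5 := key (min 1 (gap / (2 * (|C| + 1)))) (by positivity) (min_le_left _ _)
  have h6 : C * min 1 (gap / (2 * (|C| + 1))) ≤ (|C| + 1) * (gap / (2 * (|C| + 1))) :=
    (mul_le_mul_of_nonneg_right (by linarith [le_abs_self C]) (by positivity)).trans
      (mul_le_mul_of_nonneg_left (min_le_right _ _) hCp.le)
  have h7 : (|C| + 1) * (gap / (2 * (|C| + 1))) = gap / 2 := by field_simp
  linarith

theorem ClosedConvexBounded.segment_mem (hX : ClosedConvexBounded X h) {u w : E n} (hu : u ∈ X)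
    (hw : w ∈ X) {t : ℝ} (ht : 0 < t) (ht1 : t ≤ 1) : u + t • (w - u) ∈ X := by
  have h1 := hX.convex.1 hu hw (by linarith : 0 ≤ 1 - t) ht.le (by ring)
  have h2 : (1 - t) • u + t • w = u + t • (w - u) := by module
  rwa [h2] at h1

/-- At a minimizer of `G + h` over `X`, the negative gradient of `G` is a subgradient of `h`. -/
theorem ClosedConvexBounded.neg_gradient_mem_subdiff (hX : ClosedConvexBounded X h)
    {G : E n → ℝ} (hG : Differentiable ℝ G) (hl : LipBdd (∇ G)) {u : E n} (hu : u ∈ X)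
    (hmin : IsMinOn (fun x => G x + h x) X u) : -∇ G u ∈ subdiff X h u := by
  obtain ⟨R, hR⟩ := hX.bounded.exists_norm_le
  obtain ⟨Λ, hΛ, -, hd⟩ := exists_descent_const hG hl R
  refine hX.neg_mem_subdiff hu fun w hw => ⟨Λ / 2 * ‖w - u‖ ^ 2, fun t ht ht1 => ?_⟩
  have hm := hX.segment_mem hu hw ht ht1
  have h1 : G u + h u ≤ G (u + t • (w - u)) + h (u + t • (w - u)) := hmin hm
  have h2 := hd _ u (hR _ hm) (hR _ hu)
  rw [add_sub_cancel_left, inner_smul_right, norm_smul, Real.norm_of_nonneg ht.le] at h2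
  nlinarith

/-- The proximal gradient step is defined and satisfies its optimality condition. -/
theorem ClosedConvexBounded.exists_mem_proxGrad (hX : ClosedConvexBounded X h) (G : E n → ℝ)
    (L : ℝ) (y : E n) :
    ∃ u ∈ proxGrad X h G L y, u ∈ X ∧ -(∇ G y + L • (u - y)) ∈ subdiff X h u := by
  have hex : ∃ x ∈ X, IsMinOn
      (fun x => inner ℝ (∇ G y) x + L / 2 * ‖x - y‖ ^ 2 + h x) X x :=
    hX.exists_isMinOn (φ := fun x => inner ℝ (∇ G y) x + L / 2 * ‖x - y‖ ^ 2) (by fun_prop)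
  refine ⟨hex.choose, ⟨hex, rfl⟩, hex.choose_spec.1, ?_⟩
  obtain ⟨hu, hmin⟩ := hex.choose_spec
  set u := hex.choose
  refine hX.neg_mem_subdiff hu fun w hw => ⟨L / 2 * ‖w - u‖ ^ 2, fun t ht ht1 => ?_⟩
  have h1 := hmin (hX.segment_mem hu hw ht ht1)
  simp only [mem_ofPred_eq] at h1
  have h2 : u + t • (w - u) - y = (u - y) + t • (w - u) := by abel
  rw [h2, norm_add_sq_real, inner_add_right, inner_smul_right, inner_smul_right, norm_smul,
    Real.norm_of_nonneg ht.le] at h1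
  rw [inner_add_left, inner_smul_left]
  simp only [conj_trivial]
  nlinarith

end

section

variable {n l m : ℕ}

/-! ### Termination of AdapAPG -/

variable {X : Set (E n)} {h G : E n → ℝ} {μ : ℝ}

/-- The basic inequality of an accepted proximal gradient step. -/
theorem SmoothStronglyConvex.prox_step_le (hG : SmoothStronglyConvex G μ) {L : ℝ} {y u : E n}
    (hu : -(∇ G y + L • (u - y)) ∈ subdiff X h u) (hd : Descent G L y u) {x : E n} (hx : x ∈ X) :
    G u + h u + L * inner ℝ (y - u) (x - y) + L / 2 * ‖u - y‖ ^ 2 + μ / 2 * ‖x - y‖ ^ 2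
      ≤ G x + h x := by
  have h1 := hu.2 x hx
  have h2 := hG.strong x y
  unfold Descent at hd
  have h3 : x - u = (x - y) - (u - y) := by abel
  have h4 : y - u = -(u - y) := by abel
  rw [h4, inner_neg_left]
  rw [h3, inner_neg_left, inner_add_left, inner_smul_left,
    inner_sub_right (∇ G y) (x - y), inner_sub_right (u - y) (x - y),
    real_inner_self_eq_norm_sq] at h1
  simp only [conj_trivial] at h1
  linarith

/-- One step of the estimate sequence: the potential `F x - F xs + μ/2 ‖v - xs‖²` decreases by the
factor `1 - α`. All points are written relative to the extrapolated point `y`, as `x = y - α b`,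
`v = y + b`, `u = y + α e`, `xs = y + s`, which leaves only a polynomial identity in inner
products. -/
theorem potential_step {α L Fu Fx Fs : ℝ} (hα : 0 < α) (hα1 : α ≤ 1) (hμ0 : 0 < μ)
    (hμ : μ = L * α ^ 2) {b s e : E n}
    (h1 : Fu + L * inner ℝ (-(α • e)) (-(α • b)) + L / 2 * ‖α • e‖ ^ 2
      + μ / 2 * ‖-(α • b)‖ ^ 2 ≤ Fx)
    (h2 : Fu + L * inner ℝ (-(α • e)) s + L / 2 * ‖α • e‖ ^ 2 + μ / 2 * ‖s‖ ^ 2 ≤ Fs) :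
    Fu - Fs + μ / 2 * ‖-s + (1 - α) • b + e‖ ^ 2
      ≤ (1 - α) * (Fx - Fs + μ / 2 * ‖b - s‖ ^ 2) := by
  have e1 : ‖-s + (1 - α) • b + e‖ ^ 2 = ‖s‖ ^ 2 + (1 - α) ^ 2 * ‖b‖ ^ 2 + ‖e‖ ^ 2
      - 2 * (1 - α) * inner ℝ s b - 2 * inner ℝ s e + 2 * (1 - α) * inner ℝ b e := by
    rw [norm_add_sq_real, norm_add_sq_real, inner_add_left, inner_neg_left, inner_neg_left,
      inner_smul_right, inner_smul_left, norm_neg, norm_smul, mul_pow, Real.norm_eq_abs, sq_abs]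
    simp only [conj_trivial]
    ring
  have e2 : ‖b - s‖ ^ 2 = ‖b‖ ^ 2 - 2 * inner ℝ s b + ‖s‖ ^ 2 := by
    rw [norm_sub_sq_real, real_inner_comm]
  rw [inner_neg_neg, inner_smul_left, inner_smul_right, norm_neg, norm_smul, norm_smul,
    real_inner_comm, Real.norm_of_nonneg hα.le] at h1
  rw [inner_neg_left, inner_smul_left, norm_smul, Real.norm_of_nonneg hα.le, real_inner_comm] at h2
  simp only [conj_trivial] at h1 h2
  rw [e1, e2]
  have h1' : Fu + μ * inner ℝ b e + μ / 2 * ‖e‖ ^ 2 ≤ Fx := by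
    have : 0 ≤ μ / 2 * (α * ‖b‖) ^ 2 := by positivity
    rw [hμ] at this ⊢
    rw [hμ] at h1
    nlinarith
  have h2' : α * Fu - μ * inner ℝ s e + α * μ / 2 * ‖e‖ ^ 2 + α * μ / 2 * ‖s‖ ^ 2 ≤ α * Fs := by
    have := mul_le_mul_of_nonneg_left h2 hα.le
    rw [hμ] at this ⊢
    linarith
  have h3 := mul_le_mul_of_nonneg_left h1' (by linarith : 0 ≤ 1 - α)
  have h4 : 0 ≤ μ / 2 * ((1 - α) * α * ‖b‖ ^ 2) := by
    have : 0 ≤ 1 - α := by linarith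
    positivity
  nlinarith

theorem exists_mem_apgInit (hX : ClosedConvexBounded X h) (hG : SmoothStronglyConvex G μ)
    {γ₁ Lmin : ℝ} (hL : 0 < Lmin) (hγ : 1 < γ₁) {x : E n} (hx : x ∈ X) :
    ∃ r ∈ apgInit X h G γ₁ x Lmin, r.2 ∈ X ∧ Lmin ≤ r.1 := by
  obtain ⟨R, hR⟩ := hX.bounded.exists_norm_le
  obtain ⟨Λ, hΛ, -, hd⟩ := exists_descent_const hG.diff hG.lip R
  have hγ0 : 0 < γ₁ := by linarith
  obtain ⟨N, hN⟩ := pow_unbounded_of_one_lt (Λ / Lmin) hγ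
  refine exists_mem_fix _ (fun k L => Lmin ≤ L ∧ Λ ≤ γ₁ ^ (k + 1) * L) _ ?_ N Lmin
    ⟨le_rfl, ?_⟩
  · rintro k L ⟨hk, hk'⟩
    obtain ⟨u, hu, huX, -⟩ := hX.exists_mem_proxGrad G (γ₁ * L) x
    have hge : Lmin ≤ γ₁ * L := by nlinarith
    by_cases hD : Descent G (γ₁ * L) x u
    · refine Or.inl ⟨(γ₁ * L, u), ?_, huX, hge⟩
      simp only [Part.bind_eq_bind, Part.mem_bind_iff]
      exact ⟨u, hu, by rw [if_pos hD]; simp⟩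
    · refine Or.inr ⟨γ₁ * L, ?_, ?_⟩
      · simp only [Part.bind_eq_bind, Part.mem_bind_iff]
        exact ⟨u, hu, by rw [if_neg hD]; simp⟩
      · rcases k with _ | k
        · exfalso
          apply hD
          have h1 := hd u x (hR _ huX) (hR _ hx)
          unfold Descent
          have : Λ ≤ γ₁ * L := by simpa using hk'
          nlinarith [sq_nonneg ‖u - x‖]
        · exact ⟨k, Nat.lt_succ_self k, hge, by rw [← mul_assoc, ← pow_succ]; exact hk'⟩
  · rw [div_lt_iff₀ hL] at hN
    rw [pow_succ]
    nlinarith [mul_nonneg (pow_nonneg hγ0.le N) hL.le]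

/-- The line search terminates, and its constants stay bounded, as long as all extrapolated points
lie in a ball of radius `R` with descent constant `Λ`. -/
theorem exists_mem_accelLineSearch (hX : ClosedConvexBounded X h) {γ₁ R Λ Lk αprev : ℝ}
    (hLk : 0 < Lk) (hγ : 1 < γ₁) {x xprev : E n} (hR : ∀ u ∈ X, ‖u‖ ≤ R)
    (hd : ∀ x y, ‖x‖ ≤ R → ‖y‖ ≤ R → G x ≤ G y + inner ℝ (∇ G y) (x - y) + Λ / 2 * ‖x - y‖ ^ 2)
    (hy : ∀ L, Lk ≤ L → ‖extrap μ x xprev αprev L‖ ≤ R) :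
    ∃ r ∈ accelLineSearch X h G μ γ₁ x xprev αprev Lk, r.1 ∈ X ∧ Lk ≤ r.2.1 ∧
      r.2.1 ≤ max Lk (γ₁ * Λ) ∧ r.2.2 = √(μ / r.2.1) ∧
      -(∇ G (extrap μ x xprev αprev r.2.1) + r.2.1 • (r.1 - extrap μ x xprev αprev r.2.1))
        ∈ subdiff X h r.1 ∧
      Descent G r.2.1 (extrap μ x xprev αprev r.2.1) r.1 := by
  have hγ0 : 0 < γ₁ := by linarith
  obtain ⟨N, hN⟩ := pow_unbounded_of_one_lt (Λ / Lk) hγ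
  refine exists_mem_fix _ (fun k L => Lk ≤ L ∧ L ≤ max Lk (γ₁ * Λ) ∧ Λ ≤ γ₁ ^ k * L) _ ?_ N Lk
    ⟨le_rfl, le_max_left _ _, ?_⟩
  · rintro k L ⟨hk, hk', hk''⟩
    obtain ⟨u, hu, huX, hus⟩ := hX.exists_mem_proxGrad G L (extrap μ x xprev αprev L)
    have hacc : Λ ≤ L → Descent G L (extrap μ x xprev αprev L) u := by
      intro hΛ
      have h1 := hd u _ (hR _ huX) (hy L hk)
      unfold Descent
      nlinarith [sq_nonneg ‖u - extrap μ x xprev αprev L‖]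
    by_cases hD : Descent G L (extrap μ x xprev αprev L) u
    · refine Or.inl ⟨(u, L, √(μ / L)), ?_, huX, hk, hk', rfl, hus, hD⟩
      simp only [Part.bind_eq_bind, Part.mem_bind_iff]
      exact ⟨u, hu, by rw [if_pos hD]; simp⟩
    · refine Or.inr ⟨L * γ₁, ?_, ?_⟩
      · simp only [Part.bind_eq_bind, Part.mem_bind_iff]
        exact ⟨u, hu, by rw [if_neg hD]; simp⟩
      · have hlt : L < Λ := not_le.1 fun hle => hD (hacc hle)
        rcases k with _ | k
        · exact absurd hk'' (by simpa using hlt)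
        · refine ⟨k, Nat.lt_succ_self k, by nlinarith, le_max_of_le_right (by nlinarith), ?_⟩
          calc Λ ≤ γ₁ ^ (k + 1) * L := hk''
            _ = γ₁ ^ k * (L * γ₁) := by ring
  · rw [div_lt_iff₀ hLk] at hN
    exact hN.le

/-- The auxiliary sequence `v` of the estimate sequence, as a function of the loop state. -/
def APGState.v (s : APGState n) : E n := s.x + (1 / s.αprev - 1) • (s.x - s.xprev)

theorem extrap_eq {α αp : ℝ} (hα : 0 < α) (hαp : 0 < αp) (x xp : E n) :
    (1 + α) • (x + (α * (1 - αp) / (αp * (1 + α))) • (x - xp))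
      = x + α • (x + (1 / αp - 1) • (x - xp)) := by
  have h1 : (1 + α) * (α * (1 - αp) / (αp * (1 + α))) = α * (1 / αp - 1) := by
    field_simp
  rw [smul_add, smul_smul, h1]
  module

theorem SmoothStronglyConvex.potential_step (hG : SmoothStronglyConvex G μ) (hμ : 0 < μ)
    {s : APGState n} {xs u y : E n} {M α L' : ℝ} (hsx : s.x ∈ X) (hxs : xs ∈ X) (hαpos : 0 < α)
    (hα1 : α ≤ 1) (hαsq : μ = M * α ^ 2) (hyE : (1 + α) • y = s.x + α • s.v)
    (hus : -(∇ G y + M • (u - y)) ∈ subdiff X h u) (hD : Descent G M y u) :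
    G u + h u - (G xs + h xs) + μ / 2 * ‖APGState.v ⟨s.x, u, L', α⟩ - xs‖ ^ 2
      ≤ (1 - α) * (G s.x + h s.x - (G xs + h xs) + μ / 2 * ‖s.v - xs‖ ^ 2) := by
  have h1 := hG.prox_step_le hus hD hsx
  have h2 := hG.prox_step_le hus hD hxs
  obtain ⟨b, hb⟩ : ∃ b, b = s.v - y := ⟨_, rfl⟩
  obtain ⟨e, he⟩ : ∃ e, e = (1 / α) • (u - y) := ⟨_, rfl⟩
  have e1 : s.x - y = -(α • b) := by
    have : s.x = (1 + α) • y - α • s.v := by rw [hyE]; abel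
    rw [this, hb]; module
  have e2 : u - y = α • e := by
    rw [he, smul_smul, mul_one_div_cancel hαpos.ne', one_smul]
  have e3 : y - u = -(α • e) := by rw [← e2]; abel
  rw [e1, e2, e3] at h1
  rw [e2, e3] at h2
  have h3 := HiAPeM.potential_step hαpos hα1 hμ hαsq h1 h2
  have e4 : b - (xs - y) = s.v - xs := by rw [hb]; abel
  have e5 : -(xs - y) + (1 - α) • b + e = APGState.v ⟨s.x, u, L', α⟩ - xs := by
    have hx' : s.x = y - α • b := by rw [sub_eq_add_neg, ← e1]; abel
    have hu' : u = y + α • e := by rw [← e2]; abel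
    have : APGState.v ⟨s.x, u, L', α⟩ = u + (1 / α - 1) • (u - s.x) := rfl
    rw [this, hx', hu']
    have h6 : (y + α • e - (y - α • b)) = α • (e + b) := by module
    rw [h6, smul_smul, show (1 / α - 1) * α = 1 - α by field_simp]
    module
  rw [e4, e5] at h3
  exact h3

open Classical in
/-- AdapAPG terminates on strongly convex composite problems: the potential of the estimate
sequence decreases linearly as long as the line search constants stay bounded, and they do because
all extrapolated points lie in the ball around the minimizer given by the initial potential. -/
theorem exists_mem_adapAPG (hX : ClosedConvexBounded X h) (hG : SmoothStronglyConvex G μ)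
    (hμ : 0 < μ) {ε Lmin γ₁ γ₂ : ℝ} (hε : 0 < ε) (hL : μ ≤ Lmin) (hγ₁ : 1 < γ₁) (hγ₂ : 1 ≤ γ₂)
    {x : E n} (hx : x ∈ X) :
    ∃ u ∈ adapAPG X h G x μ ε Lmin γ₁ γ₂, u ∈ X ∧ IsStationary X h G ε u := by
  have hLpos : 0 < Lmin := hμ.trans_le hL
  obtain ⟨⟨L₀, x₀⟩, hr, hx₀, hL₀⟩ := exists_mem_apgInit hX hG hLpos hγ₁ hx
  simp only at hx₀ hL₀
  obtain ⟨xs, hxs, hmin⟩ := hX.exists_isMinOn (φ := G) hG.diff.continuous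
  have hsub := hX.neg_gradient_mem_subdiff hG.diff hG.lip hxs hmin
  set F : E n → ℝ := fun x => G x + h x with hF
  have hgrow : ∀ w ∈ X, μ / 2 * ‖w - xs‖ ^ 2 ≤ F w - F xs := by
    intro w hw
    have h1 := hsub.2 w hw
    have h2 := hG.strong w xs
    rw [inner_neg_left] at h1
    simp only [hF]
    linarith
  set pot : APGState n → ℝ := fun s => F s.x - F xs + μ / 2 * ‖s.v - xs‖ ^ 2 with hpot
  set s₀ : APGState n := ⟨x₀, x₀, L₀, 1⟩ with hs₀
  set E₀ := pot s₀ with hE₀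
  have hE₀nn : 0 ≤ E₀ := by
    have := hgrow x₀ hx₀
    have h1 : 0 ≤ μ / 2 * ‖x₀ - xs‖ ^ 2 := by positivity
    have h2 : 0 ≤ μ / 2 * ‖s₀.v - xs‖ ^ 2 := by positivity
    simp only [hE₀, hpot]
    change 0 ≤ F x₀ - F xs + _
    linarith
  obtain ⟨R₁, hR₁⟩ := hX.bounded.exists_norm_le
  set R := max R₁ (‖xs‖ + √(2 * E₀ / μ)) with hRdef
  have hR : ∀ u ∈ X, ‖u‖ ≤ R := fun u hu => (hR₁ u hu).trans (le_max_left _ _)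
  obtain ⟨Λ, hΛ, hlip, hd⟩ := exists_descent_const hG.diff hG.lip R
  set Mb := max L₀ (γ₁ * Λ) with hMb
  have hMbL : Lmin ≤ Mb := hL₀.trans (le_max_left _ _)
  have hMbpos : 0 < Mb := hLpos.trans_le hMbL
  set a := √(μ / Mb) with ha
  have ha0 : 0 < a := Real.sqrt_pos.2 (by positivity)
  have ha1 : a ≤ 1 := by
    rw [ha, Real.sqrt_le_iff]
    refine ⟨zero_le_one, ?_⟩
    rw [one_pow]
    exact (div_le_one hMbpos).2 (hL.trans hMbL)
  -- the potential below which the next iterate passes the stationarity test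
  set η := (ε / (2 * (Λ + Mb))) ^ 2 * μ / 2 with hη
  have hηpos : 0 < η := by positivity
  obtain ⟨K, hK⟩ : ∃ K : ℕ, (1 - a) ^ K * E₀ ≤ η := by
    obtain ⟨K, hK⟩ := exists_pow_lt_of_lt_one (show 0 < η / (E₀ + 1) by positivity)
      (by linarith : 1 - a < 1)
    refine ⟨K, ?_⟩
    rw [lt_div_iff₀ (by positivity)] at hK
    nlinarith [pow_nonneg (by linarith : 0 ≤ 1 - a) K]
  obtain ⟨u, hu, hQ⟩ : ∃ u ∈ PFun.fix (fun s : APGState n => do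
      let (x', Mk, α) ← accelLineSearch X h G μ γ₁ s.x s.xprev s.αprev s.L
      if IsStationary X h G ε x' then pure (Sum.inl x')
      else pure (Sum.inr (⟨s.x, x', max Lmin (Mk / γ₂), α⟩ : APGState n))) s₀,
      u ∈ X ∧ IsStationary X h G ε u := by
    refine exists_mem_fix _ (fun k s => s.x ∈ X ∧ 0 < s.αprev ∧ s.αprev ≤ 1 ∧ Lmin ≤ s.L ∧
      s.L ≤ Mb ∧ ∃ j, j + k = K ∧ pot s ≤ (1 - a) ^ j * E₀) _ ?_ K s₀
      ⟨hx₀, one_pos, le_rfl, hL₀, le_max_left _ _, 0, by simp, by simp [hE₀]⟩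
    rintro k s ⟨hsx, hαp, hαp1, hsL, hsL', j, hjk, hp⟩
    have hsLpos : 0 < s.L := hLpos.trans_le hsL
    have hq1 : (1 - a) ^ j ≤ 1 := pow_le_one₀ (by linarith) (by linarith)
    have hp0 : pot s ≤ E₀ := hp.trans (mul_le_of_le_one_left hE₀nn hq1)
    have hgs := hgrow s.x hsx
    have hpnn : 0 ≤ pot s := by
      have h1 : 0 ≤ μ / 2 * ‖s.x - xs‖ ^ 2 := by positivity
      have h2 : 0 ≤ μ / 2 * ‖s.v - xs‖ ^ 2 := by positivity
      simp only [hpot]; linarith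
    set r := √(2 * pot s / μ) with hr'
    have hr2 : r ^ 2 = 2 * pot s / μ := Real.sq_sqrt (by positivity)
    have hr2' : μ / 2 * r ^ 2 = pot s := by rw [hr2]; field_simp
    have hrnn : 0 ≤ r := Real.sqrt_nonneg _
    have hxr : ‖s.x - xs‖ ≤ r := by
      refine Real.le_sqrt_of_sq_le ?_
      rw [le_div_iff₀ hμ]
      have h2 : 0 ≤ μ / 2 * ‖s.v - xs‖ ^ 2 := by positivity
      simp only [hpot]; linarith
    have hvr : ‖s.v - xs‖ ≤ r := by
      refine Real.le_sqrt_of_sq_le ?_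
      rw [le_div_iff₀ hμ]
      have h2 : 0 ≤ μ / 2 * ‖s.x - xs‖ ^ 2 := by positivity
      simp only [hpot]; linarith
    have hyeq : ∀ L, 0 < L → (1 + √(μ / L)) • extrap μ s.x s.xprev s.αprev L
        = s.x + √(μ / L) • s.v := fun L hLp =>
      extrap_eq (Real.sqrt_pos.2 (by positivity)) hαp _ _
    have hyr : ∀ L, 0 < L → ‖extrap μ s.x s.xprev s.αprev L - xs‖ ≤ r := by
      intro L hLp
      set α := √(μ / L)
      have hα : 0 < α := Real.sqrt_pos.2 (by positivity)
      have h1 : (1 + α) • (extrap μ s.x s.xprev s.αprev L - xs)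
          = (s.x - xs) + α • (s.v - xs) := by
        rw [smul_sub, hyeq L hLp]; module
      have h2 : (1 + α) * ‖extrap μ s.x s.xprev s.αprev L - xs‖ ≤ (1 + α) * r := by
        calc (1 + α) * ‖extrap μ s.x s.xprev s.αprev L - xs‖
            = ‖(1 + α) • (extrap μ s.x s.xprev s.αprev L - xs)‖ := by
              rw [norm_smul, Real.norm_of_nonneg (by positivity)]
          _ ≤ ‖s.x - xs‖ + ‖α • (s.v - xs)‖ := by rw [h1]; exact norm_add_le _ _
          _ ≤ r + α * r := by
              rw [norm_smul, Real.norm_of_nonneg hα.le]; gcongr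
          _ = (1 + α) * r := by ring
      exact le_of_mul_le_mul_left h2 (by positivity)
    have hyR : ∀ L, s.L ≤ L → ‖extrap μ s.x s.xprev s.αprev L‖ ≤ R := by
      intro L hLL
      have h1 := hyr L (hsLpos.trans_le hLL)
      have h2 : r ≤ √(2 * E₀ / μ) := Real.sqrt_le_sqrt (by gcongr)
      calc _ = ‖(extrap μ s.x s.xprev s.αprev L - xs) + xs‖ := by rw [sub_add_cancel]
        _ ≤ r + ‖xs‖ := (norm_add_le _ _).trans (by gcongr)
        _ ≤ R := le_max_of_le_right (by linarith)
    obtain ⟨⟨u, M, α⟩, hmem, huX, hML, hMM, hαeq, hus, hD⟩ :=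
      exists_mem_accelLineSearch hX (x := s.x) (xprev := s.xprev) (αprev := s.αprev) (γ₁ := γ₁)
        (μ := μ) hsLpos hγ₁ hR hd hyR
    simp only at huX hML hMM hαeq hus hD
    have hMpos : 0 < M := hsLpos.trans_le hML
    have hMMb : M ≤ Mb := hMM.trans (max_le hsL' (le_max_right _ _))
    have hαpos : 0 < α := by rw [hαeq]; exact Real.sqrt_pos.2 (by positivity)
    have hα1 : α ≤ 1 := by
      rw [hαeq, Real.sqrt_le_iff]
      refine ⟨zero_le_one, ?_⟩
      rw [one_pow]
      exact (div_le_one hMpos).2 (hL.trans (hsL.trans hML))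
    have haα : a ≤ α := by
      rw [hαeq]; exact Real.sqrt_le_sqrt (by gcongr)
    have hαsq : μ = M * α ^ 2 := by
      rw [hαeq, Real.sq_sqrt (by positivity)]; field_simp
    set y := extrap μ s.x s.xprev s.αprev M with hy
    have hyE : (1 + α) • y = s.x + α • s.v := by
      rw [hαeq]; exact hyeq M hMpos
    set s' : APGState n := ⟨s.x, u, max Lmin (M / γ₂), α⟩ with hs'
    have hpot' : pot s' ≤ (1 - α) * pot s :=
      hG.potential_step hμ hsx hxs hαpos hα1 hαsq hyE hus hD
    have hgu := hgrow u huX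
    have hur : ‖u - xs‖ ≤ r := by
      have h2 : 0 ≤ μ / 2 * ‖s'.v - xs‖ ^ 2 := by positivity
      have h3 : pot s' ≤ pot s := hpot'.trans (mul_le_of_le_one_left hpnn (by linarith))
      refine Real.le_sqrt_of_sq_le ?_
      rw [le_div_iff₀ hμ]
      have h4 : pot s' = F u - F xs + μ / 2 * ‖s'.v - xs‖ ^ 2 := rfl
      linarith
    have hstat : k = 0 → IsStationary X h G ε u := by
      intro hk
      have hjK : j = K := by omega
      rw [hjK] at hp
      refine ⟨_, hus, ?_⟩
      have hrη : r ≤ ε / (2 * (Λ + Mb)) := by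
        refine le_of_sq_le_sq ?_ (by positivity)
        rw [hr2, div_le_iff₀ hμ]
        have : pot s ≤ η := hp.trans hK
        rw [hη] at this
        linarith
      have h1 : ‖u - y‖ ≤ 2 * r := by
        calc ‖u - y‖ = ‖(u - xs) - (y - xs)‖ := by congr 1; abel
          _ ≤ ‖u - xs‖ + ‖y - xs‖ := norm_sub_le _ _
          _ ≤ 2 * r := by linarith [hyr M hMpos]
      calc ‖∇ G u + -(∇ G y + M • (u - y))‖ = ‖(∇ G u - ∇ G y) - M • (u - y)‖ := by
            congr 1; abel
        _ ≤ Λ * ‖u - y‖ + M * ‖u - y‖ := by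
            refine (norm_sub_le _ _).trans (add_le_add (hlip _ _ (hR _ huX) (hyR M hML)) ?_)
            rw [norm_smul, Real.norm_of_nonneg hMpos.le]
        _ ≤ (Λ + Mb) * (2 * (ε / (2 * (Λ + Mb)))) := by
            rw [← add_mul]; gcongr; linarith
        _ = ε := by field_simp
    by_cases hS : IsStationary X h G ε u
    · refine Or.inl ⟨u, ?_, huX, hS⟩
      simp only [Part.bind_eq_bind, Part.mem_bind_iff]
      exact ⟨(u, M, α), hmem, by simp [hS]⟩
    · refine Or.inr ⟨s', ?_, ?_⟩
      · simp only [Part.bind_eq_bind, Part.mem_bind_iff]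
        exact ⟨(u, M, α), hmem, by simp [hS, hs']⟩
      · rcases k with _ | k
        · exact absurd (hstat rfl) hS
        have hx' : s'.x = u := rfl
        have hα' : s'.αprev = α := rfl
        have hL' : s'.L = max Lmin (M / γ₂) := rfl
        rw [hx', hα', hL']
        refine ⟨k, Nat.lt_succ_self k, huX, hαpos, hα1, le_max_left _ _, ?_, j + 1, by omega, ?_⟩
        · exact max_le hMbL ((div_le_self hMpos.le hγ₂).trans hMMb)
        · calc pot s' ≤ (1 - α) * pot s := hpot'
            _ ≤ (1 - a) * pot s := by gcongr
            _ ≤ (1 - a) * ((1 - a) ^ j * E₀) := by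
                exact mul_le_mul_of_nonneg_left hp (by linarith)
            _ = (1 - a) ^ (j + 1) * E₀ := by ring
  refine ⟨u, ?_, hQ⟩
  unfold adapAPG
  simp only [Part.bind_eq_bind, Part.mem_bind_iff]
  exact ⟨(L₀, x₀), hr, hu⟩

end

section

variable {n l m : ℕ}

/-! ### Euclidean coordinates and multipliers -/

theorem inner_eq_sum {k : ℕ} (x y : E k) : inner ℝ x y = ∑ i, x i * y i := by
  simp [PiLp.inner_apply, mul_comm]

theorem norm_sq_eq_sum {k : ℕ} (x : E k) : ‖x‖ ^ 2 = ∑ i, x i ^ 2 := by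
  rw [← real_inner_self_eq_norm_sq, inner_eq_sum]
  simp [sq]

/-- A multiplier as a vector of the Hilbert space with norm `dnorm`. -/
def toL (p : Dual l m) : WithLp 2 (E l × E m) := WithLp.toLp 2 p

theorem norm_toL (p : Dual l m) : ‖toL p‖ = dnorm p := by
  rw [dnorm, toL, WithLp.prod_norm_eq_of_L2]; rfl

theorem inner_toL_sub (a b c d : Dual l m) : inner ℝ (toL a - toL b) (toL c - toL d)
    = inner ℝ (a.1 - b.1) (c.1 - d.1) + inner ℝ (a.2 - b.2) (c.2 - d.2) := by
  simp [toL, WithLp.prod_inner_apply]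

theorem dnorm_nonneg (p : Dual l m) : 0 ≤ dnorm p := Real.sqrt_nonneg _

theorem dnorm_sq (p : Dual l m) : dnorm p ^ 2 = ‖p.1‖ ^ 2 + ‖p.2‖ ^ 2 :=
  Real.sq_sqrt (by positivity)

theorem dnorm_sub (p q : Dual l m) :
    dnorm (p - q) = ‖toL p - toL q‖ := by
  rw [← norm_toL]; rfl

theorem mul_add_mul_le_sqrt (a b c d : ℝ) :
    a * b + c * d ≤ √(a ^ 2 + c ^ 2) * √(b ^ 2 + d ^ 2) := by
  rw [← Real.sqrt_mul (by positivity)]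
  refine Real.le_sqrt_of_sq_le ?_
  nlinarith [sq_nonneg (a * d - c * b)]

namespace Problem

/-- The bilinear term `⟨y, A x - b⟩ + ⟨z, f(x)⟩` of the Lagrangian. -/
def pair (P : Problem n l m) (p : Dual l m) (x : E n) : ℝ :=
  inner ℝ p.1 (P.res x) + inner ℝ p.2 (P.fvec x)

/-- The primal residual `√(‖A x - b‖² + ‖[f(x)]₊‖²)`. -/
def feas (P : Problem n l m) (x : E n) : ℝ :=
  √(‖P.res x‖ ^ 2 + ‖posVec (P.fvec x)‖ ^ 2)

/-- The penalty terms of the augmented Lagrangian. -/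
def augPen (P : Problem n l m) (β : ℝ) (p : Dual l m) (x : E n) : ℝ :=
  inner ℝ p.1 (P.res x) + β / 2 * ‖P.res x‖ ^ 2
    + 1 / (2 * β) * (‖posVec (p.2 + β • P.fvec x)‖ ^ 2 - ‖p.2‖ ^ 2)

/-- The gradient `Aᵀ y + ∑ zᵢ ∇fᵢ(x)` of `pair p` at `x`. -/
def dualGrad (P : Problem n l m) (p : Dual l m) (x : E n) : E n :=
  P.adj p.1 + ∑ i, p.2 i • ∇ (P.f i) x

/-- The `j`-th row of `A`. -/
def row (P : Problem n l m) (j : Fin l) : E n := WithLp.toLp 2 (P.A j)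

/-- The objective function `g + h` on the domain. -/
def obj (P : Problem n l m) (x : E n) : ℝ := P.g x + P.h x

variable (P : Problem n l m)

theorem augLag_eq (β : ℝ) (p : Dual l m) (x : E n) :
    P.augLag β p x = P.g x + P.augPen β p x := by
  unfold augLag augPen; ring

theorem feas_nonneg (x : E n) : 0 ≤ P.feas x := Real.sqrt_nonneg _

theorem feas_sq (x : E n) : P.feas x ^ 2 = ‖P.res x‖ ^ 2 + ‖posVec (P.fvec x)‖ ^ 2 :=
  Real.sq_sqrt (by positivity)

theorem res_apply (x : E n) (j : Fin l) : P.res x j = inner ℝ (P.row j) x - P.b j := by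
  rw [inner_eq_sum]; rfl

theorem adj_eq_sum (y : E l) : P.adj y = ∑ j, y j • P.row j := by
  ext i
  simp [adj, row, Matrix.mulVec, dotProduct, mul_comm]

theorem pair_eq_sum (p : Dual l m) (x : E n) :
    P.pair p x = ∑ j, p.1 j * P.res x j + ∑ i, p.2 i * P.f i x := by
  rw [pair, inner_eq_sum, inner_eq_sum]; rfl

theorem augPen_eq_sum {β : ℝ} (p : Dual l m) (x : E n) :
    P.augPen β p x = ∑ j, (p.1 j * P.res x j + β / 2 * P.res x j ^ 2)
      + ∑ i, 1 / (2 * β) * (max (p.2 i + β * P.f i x) 0 ^ 2 - p.2 i ^ 2) := by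
  rw [augPen, inner_eq_sum, norm_sq_eq_sum, norm_sq_eq_sum, norm_sq_eq_sum,
    Finset.sum_add_distrib, Finset.mul_sum, ← Finset.sum_sub_distrib, Finset.mul_sum]
  rfl

theorem multUpdate_snd_nonneg (β : ℝ) (p : Dual l m) (x : E n) (i : Fin m) :
    0 ≤ (P.multUpdate β p x).2 i := le_max_right _ _

theorem multUpdate_fst_apply (β : ℝ) (p : Dual l m) (x : E n) (j : Fin l) :
    (P.multUpdate β p x).1 j = p.1 j + β * P.res x j := rfl

theorem multUpdate_snd_apply (β : ℝ) (p : Dual l m) (x : E n) (i : Fin m) :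
    (P.multUpdate β p x).2 i = max (p.2 i + β * P.f i x) 0 := rfl

/-! ### Inequalities for multipliers and penalty terms -/

variable {P}

theorem pair_le_dnorm_mul_feas {p : Dual l m} (hp : ∀ i, 0 ≤ p.2 i) (x : E n) :
    P.pair p x ≤ dnorm p * P.feas x := by
  have h1 : inner ℝ p.2 (P.fvec x) ≤ inner ℝ p.2 (posVec (P.fvec x)) := by
    rw [inner_eq_sum, inner_eq_sum]
    exact Finset.sum_le_sum fun i _ => mul_le_mul_of_nonneg_left (le_max_left _ _) (hp i)
  have h2 := real_inner_le_norm p.1 (P.res x)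
  have h3 := real_inner_le_norm p.2 (posVec (P.fvec x))
  exact (by unfold pair; linarith : P.pair p x ≤ _).trans (mul_add_mul_le_sqrt _ _ _ _)

theorem pair_nonpos {p : Dual l m} (hp : ∀ i, 0 ≤ p.2 i) {x : E n} (hx : P.res x = 0)
    (hf : ∀ i, P.f i x ≤ 0) : P.pair p x ≤ 0 := by
  rw [pair, hx, inner_zero_right, zero_add, inner_eq_sum]
  exact Finset.sum_nonpos fun i _ => mul_nonpos_of_nonneg_of_nonpos (hp i) (hf i)

theorem neg_dnorm_sq_le_augPen {β : ℝ} (hβ : 0 < β) (p : Dual l m) (x : E n) :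
    -(dnorm p ^ 2 / (2 * β)) ≤ P.augPen β p x := by
  have h1 : -(‖p.1‖ ^ 2 / (2 * β)) ≤ inner ℝ p.1 (P.res x) + β / 2 * ‖P.res x‖ ^ 2 := by
    have h2 := neg_le_of_abs_le (abs_real_inner_le_norm p.1 (P.res x))
    have h3 : ‖p.1‖ ^ 2 / (2 * β) - ‖p.1‖ * ‖P.res x‖ + β / 2 * ‖P.res x‖ ^ 2
        = (‖p.1‖ - β * ‖P.res x‖) ^ 2 / (2 * β) := by field_simp; ring
    have h4 : 0 ≤ (‖p.1‖ - β * ‖P.res x‖) ^ 2 / (2 * β) := by positivity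
    linarith
  have h5 : 0 ≤ 1 / (2 * β) * ‖posVec (p.2 + β • P.fvec x)‖ ^ 2 := by positivity
  rw [dnorm_sq, augPen]
  have h6 : (‖p.1‖ ^ 2 + ‖p.2‖ ^ 2) / (2 * β)
      = ‖p.1‖ ^ 2 / (2 * β) + 1 / (2 * β) * ‖p.2‖ ^ 2 := by ring
  rw [h6]
  linarith

theorem augPen_le {β : ℝ} (hβ : 0 < β) {p : Dual l m} (hp : ∀ i, 0 ≤ p.2 i) (x : E n) :
    P.augPen β p x ≤ dnorm p * P.feas x + β / 2 * P.feas x ^ 2 := by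
  have h3 := real_inner_le_norm p.1 (P.res x)
  have h4 := real_inner_le_norm p.2 (posVec (P.fvec x))
  have h5 := mul_add_mul_le_sqrt ‖p.1‖ ‖P.res x‖ ‖p.2‖ ‖posVec (P.fvec x)‖
  have h6 : 1 / (2 * β) * (‖posVec (p.2 + β • P.fvec x)‖ ^ 2 - ‖p.2‖ ^ 2)
      ≤ inner ℝ p.2 (posVec (P.fvec x)) + β / 2 * ‖posVec (P.fvec x)‖ ^ 2 := by
    rw [norm_sq_eq_sum, norm_sq_eq_sum, norm_sq_eq_sum, inner_eq_sum, ← Finset.sum_sub_distrib,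
      Finset.mul_sum, Finset.mul_sum, ← Finset.sum_add_distrib]
    refine Finset.sum_le_sum fun i _ => ?_
    change 1 / (2 * β) * (max (p.2 i + β * P.f i x) 0 ^ 2 - p.2 i ^ 2)
      ≤ p.2 i * max (P.f i x) 0 + β / 2 * max (P.f i x) 0 ^ 2
    have hz := hp i
    have h7 : max (p.2 i + β * P.f i x) 0 ≤ p.2 i + β * max (P.f i x) 0 := by
      refine max_le ?_ (by positivity)
      gcongr
      exact le_max_left _ _
    have h8 : max (p.2 i + β * P.f i x) 0 ^ 2 ≤ (p.2 i + β * max (P.f i x) 0) ^ 2 := by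
      gcongr
    calc _ ≤ 1 / (2 * β) * ((p.2 i + β * max (P.f i x) 0) ^ 2 - p.2 i ^ 2) := by gcongr
      _ = _ := by field_simp; ring
  rw [feas_sq]
  have h7 : ‖p.1‖ * ‖P.res x‖ + ‖p.2‖ * ‖posVec (P.fvec x)‖ ≤ dnorm p * P.feas x := h5
  unfold augPen
  linarith

/-- The penalty terms, corrected by `‖p‖² / (2β)` and by the growth that an infeasibility of `φ`
can cause, do not increase with the penalty parameter. -/
theorem augPen_anti {β β' φ : ℝ} (hβ : 0 < β) (hββ : β ≤ β') {p : Dual l m}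
    (hp : ∀ i, 0 ≤ p.2 i) {x : E n} (hx : P.feas x ≤ φ) :
    P.augPen β' p x + dnorm p ^ 2 / (2 * β') - β' / 2 * φ ^ 2
      ≤ P.augPen β p x + dnorm p ^ 2 / (2 * β) - β / 2 * φ ^ 2 := by
  have hβ' : 0 < β' := hβ.trans_le hββ
  have key : ∀ b : ℝ, 0 < b → P.augPen b p x + dnorm p ^ 2 / (2 * b)
      = inner ℝ p.1 (P.res x) + b / 2 * ‖P.res x‖ ^ 2 + ‖p.1‖ ^ 2 / (2 * b)
        + 1 / (2 * b) * ‖posVec (p.2 + b • P.fvec x)‖ ^ 2 := by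
    intro b hb
    rw [augPen, dnorm_sq]
    field_simp
    ring
  rw [key _ hβ, key _ hβ']
  have h1 : ‖p.1‖ ^ 2 / (2 * β') ≤ ‖p.1‖ ^ 2 / (2 * β) := by gcongr
  have h2 : 1 / (2 * β') * ‖posVec (p.2 + β' • P.fvec x)‖ ^ 2
      ≤ 1 / (2 * β) * ‖posVec (p.2 + β • P.fvec x)‖ ^ 2
        + (β' - β) / 2 * ‖posVec (P.fvec x)‖ ^ 2 := by
    rw [norm_sq_eq_sum, norm_sq_eq_sum, norm_sq_eq_sum,
      Finset.mul_sum, Finset.mul_sum, Finset.mul_sum, ← Finset.sum_add_distrib]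
    refine Finset.sum_le_sum fun i _ => ?_
    change 1 / (2 * β') * max (p.2 i + β' * P.f i x) 0 ^ 2
      ≤ 1 / (2 * β) * max (p.2 i + β * P.f i x) 0 ^ 2 + (β' - β) / 2 * max (P.f i x) 0 ^ 2
    have hz := hp i
    rcases le_total (P.f i x) 0 with hf | hf
    · rw [max_eq_right hf]
      have h3 : max (p.2 i + β' * P.f i x) 0 ≤ max (p.2 i + β * P.f i x) 0 :=
        max_le_max (by nlinarith) le_rfl
      have h4 : 0 ≤ max (p.2 i + β' * P.f i x) 0 := le_max_right _ _
      have : 1 / (2 * β') * max (p.2 i + β' * P.f i x) 0 ^ 2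
          ≤ 1 / (2 * β) * max (p.2 i + β * P.f i x) 0 ^ 2 := by gcongr
      simpa using this
    · rw [max_eq_left hf, max_eq_left (by positivity), max_eq_left (by positivity)]
      have h3 : p.2 i ^ 2 / (2 * β') ≤ p.2 i ^ 2 / (2 * β) := by gcongr
      have e1 : 1 / (2 * β') * (p.2 i + β' * P.f i x) ^ 2
          = p.2 i ^ 2 / (2 * β') + p.2 i * P.f i x + β' / 2 * P.f i x ^ 2 := by
        field_simp; ring
      have e2 : 1 / (2 * β) * (p.2 i + β * P.f i x) ^ 2
          = p.2 i ^ 2 / (2 * β) + p.2 i * P.f i x + β / 2 * P.f i x ^ 2 := by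
        field_simp; ring
      rw [e1, e2]
      linarith
  have h3 : (β' - β) / 2 * P.feas x ^ 2 ≤ (β' - β) / 2 * φ ^ 2 := by
    have := P.feas_nonneg x
    have : 0 ≤ β' - β := by linarith
    gcongr
  rw [feas_sq] at h3
  linarith

variable {β : ℝ} {p : Dual l m} {x : E n}

theorem pair_multUpdate (hβ : 0 < β) :
    P.pair (P.multUpdate β p x) x
      = inner ℝ (toL (P.multUpdate β p x)) (toL (P.multUpdate β p x) - toL p) / β := by
  have h0 := inner_toL_sub (P.multUpdate β p x) 0 (P.multUpdate β p x) p
  have h00 : toL (0 : Dual l m) = 0 := rfl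
  rw [h00, sub_zero] at h0
  rw [h0, pair_eq_sum, inner_eq_sum, inner_eq_sum, add_div, Finset.sum_div, Finset.sum_div]
  congr 1
  · refine Finset.sum_congr rfl fun j _ => ?_
    simp only [Prod.fst_zero, sub_zero, PiLp.sub_apply, multUpdate_fst_apply]
    field_simp
    ring
  · refine Finset.sum_congr rfl fun i _ => ?_
    simp only [Prod.snd_zero, sub_zero, PiLp.sub_apply, multUpdate_snd_apply]
    rcases le_total (p.2 i + β * P.f i x) 0 with h | h
    · rw [max_eq_right h]; simp
    · rw [max_eq_left h]; field_simp; ring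

/-- The terms of the Lagrangian at a point and the multiplier computed from it are bounded below
through the previous multiplier. -/
theorem neg_pair_multUpdate_le (hβ : 0 < β) :
    -P.pair (P.multUpdate β p x) x ≤ dnorm p ^ 2 / (4 * β) := by
  rw [pair_multUpdate hβ, ← norm_toL]
  set a := toL (P.multUpdate β p x)
  set b := toL p
  rw [inner_sub_right, real_inner_self_eq_norm_sq, ← neg_div, div_le_div_iff₀ hβ (by positivity)]
  nlinarith [real_inner_le_norm a b, sq_nonneg (2 * ‖a‖ - ‖b‖)]

theorem compl_le (hβ : 0 < β) :
    ∑ i, |(P.multUpdate β p x).2 i * P.f i x|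
      ≤ dnorm (P.multUpdate β p x) * dnorm (P.multUpdate β p x - p) / β := by
  set p' := P.multUpdate β p x with hp'
  have h1 : ∀ i, |p'.2 i * P.f i x| = |p'.2 i| * |p'.2 i - p.2 i| / β := by
    intro i
    have hz : p'.2 i = max (p.2 i + β * P.f i x) 0 := rfl
    have : p'.2 i * P.f i x = p'.2 i * (p'.2 i - p.2 i) / β := by
      rcases le_total (p.2 i + β * P.f i x) 0 with h | h
      · rw [hz, max_eq_right h]; simp
      · rw [hz, max_eq_left h]; field_simp; ring
    rw [this, abs_div, abs_mul, abs_of_pos hβ]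
  simp_rw [h1]
  rw [← Finset.sum_div]
  gcongr
  have h2 : ∑ i, |p'.2 i| * |p'.2 i - p.2 i| ≤ ‖p'.2‖ * ‖p'.2 - p.2‖ := by
    refine le_of_sq_le_sq ?_ (by positivity)
    rw [mul_pow, norm_sq_eq_sum, norm_sq_eq_sum]
    refine (Finset.sum_mul_sq_le_sq_mul_sq _ _ _).trans (le_of_eq ?_)
    simp [sq_abs]
  refine h2.trans (mul_le_mul ?_ ?_ (norm_nonneg _) (dnorm_nonneg _))
  · exact Real.le_sqrt_of_sq_le (by nlinarith [sq_nonneg ‖p'.1‖])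
  · exact Real.le_sqrt_of_sq_le
      (by rw [Prod.snd_sub]; nlinarith [sq_nonneg ‖(p' - p).1‖])

theorem feas_le (hβ : 0 < β) (hp : ∀ i, 0 ≤ p.2 i) :
    P.feas x ≤ dnorm (P.multUpdate β p x - p) / β := by
  rw [le_div_iff₀ hβ]
  refine Real.le_sqrt_of_sq_le ?_
  rw [mul_pow, feas_sq]
  have h1 : ‖(P.multUpdate β p x - p).1‖ ^ 2 = β ^ 2 * ‖P.res x‖ ^ 2 := by
    have : (P.multUpdate β p x - p).1 = β • P.res x := by simp [multUpdate]
    rw [this, norm_smul, mul_pow, Real.norm_eq_abs, sq_abs]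
  have h2 : β ^ 2 * ‖posVec (P.fvec x)‖ ^ 2 ≤ ‖(P.multUpdate β p x - p).2‖ ^ 2 := by
    rw [norm_sq_eq_sum, norm_sq_eq_sum, Finset.mul_sum]
    refine Finset.sum_le_sum fun i _ => ?_
    change β ^ 2 * max (P.f i x) 0 ^ 2 ≤ (max (p.2 i + β * P.f i x) 0 - p.2 i) ^ 2
    have hz := hp i
    rcases le_total (P.f i x) 0 with hf | hf
    · rw [max_eq_right hf]; simpa using sq_nonneg _
    · rw [max_eq_left hf, max_eq_left (by positivity)]
      exact le_of_eq (by ring)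
  rw [h1]
  linarith

/-- The multiplier update is a proximal ascent step for the dual terms of the Lagrangian. -/
theorem inner_multUpdate_sub_le {q : Dual l m} (hq : ∀ i, 0 ≤ q.2 i) :
    inner ℝ (toL (P.multUpdate β p x) - toL p) (toL (P.multUpdate β p x) - toL q)
      ≤ β * (P.pair (P.multUpdate β p x) x - P.pair q x) := by
  rw [inner_toL_sub, pair_eq_sum, pair_eq_sum, inner_eq_sum, inner_eq_sum,
    add_sub_add_comm, ← Finset.sum_sub_distrib, ← Finset.sum_sub_distrib, mul_add,
    Finset.mul_sum, Finset.mul_sum]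
  refine add_le_add (Finset.sum_le_sum fun j _ => ?_) (Finset.sum_le_sum fun i _ => ?_)
  · simp only [PiLp.sub_apply, multUpdate_fst_apply]
    exact le_of_eq (by ring)
  · simp only [PiLp.sub_apply, multUpdate_snd_apply]
    rcases le_total (p.2 i + β * P.f i x) 0 with h | h
    · rw [max_eq_right h]
      nlinarith [hq i]
    · rw [max_eq_left h]
      exact le_of_eq (by ring)

end Problem

end

section

variable {n l m : ℕ}

/-! ### Gradients of the augmented Lagrangian -/

theorem hasGradientAt_add {F G : E n → ℝ} {a b x : E n} (hF : HasGradientAt F a x)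
    (hG : HasGradientAt G b x) : HasGradientAt (fun x => F x + G x) (a + b) x := by
  rw [hasGradientAt_iff_hasFDerivAt] at *
  rw [map_add]
  exact hF.add hG

theorem hasGradientAt_sum {ι : Type*} (s : Finset ι) {F : ι → E n → ℝ} {a : ι → E n} {x : E n}
    (h : ∀ i, HasGradientAt (F i) (a i) x) :
    HasGradientAt (fun x => ∑ i ∈ s, F i x) (∑ i ∈ s, a i) x := by
  classical
  induction s using Finset.induction_on with
  | empty => simpa using hasGradientAt_const x (0 : ℝ)
  | insert i s hi ih => simpa [Finset.sum_insert hi] using hasGradientAt_add (h i) ih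

theorem hasGradientAt_comp {φ : ℝ → ℝ} {φ' : ℝ} {F : E n → ℝ} {a x : E n}
    (hφ : HasDerivAt φ φ' (F x)) (hF : HasGradientAt F a x) :
    HasGradientAt (fun x => φ (F x)) (φ' • a) x := by
  rw [hasGradientAt_iff_hasFDerivAt] at *
  rw [map_smul]
  exact hφ.comp_hasFDerivAt x hF

theorem hasGradientAt_inner (a x : E n) (c : ℝ) :
    HasGradientAt (fun x => inner ℝ a x - c) a x := by
  rw [hasGradientAt_iff_hasFDerivAt]
  exact ((InnerProductSpace.toDual ℝ (E n) a).hasFDerivAt (x := x)).sub_const c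

theorem hasGradientAt_norm_sub_sq (ρ : ℝ) (c x : E n) :
    HasGradientAt (fun x => ρ * ‖x - c‖ ^ 2) ((2 * ρ) • (x - c)) x := by
  rw [hasGradientAt_iff_hasFDerivAt]
  have h1 := ((hasFDerivAt_id (𝕜 := ℝ) x).sub_const c).norm_sq.const_mul ρ
  refine h1.congr_fderiv ?_
  ext v
  simp
  ring

theorem hasDerivAt_max_sq (t : ℝ) : HasDerivAt (fun t : ℝ => max t 0 ^ 2) (2 * max t 0) t := by
  rcases lt_trichotomy t 0 with h | rfl | h
  · rw [max_eq_right h.le]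
    have : (fun t : ℝ => max t 0 ^ 2) =ᶠ[nhds t] fun _ => 0 := by
      filter_upwards [gt_mem_nhds h] with s hs
      rw [max_eq_right hs.le]; simp
    simpa using (hasDerivAt_const t (0 : ℝ)).congr_of_eventuallyEq this
  · rw [hasDerivAt_iff_isLittleO_nhds_zero]
    have h1 : (fun h : ℝ => h ^ 2) =o[nhds 0] fun h : ℝ => h := by
      simpa using (Asymptotics.isLittleO_pow_id (𝕜 := ℝ) (n := 2) (by norm_num))
    refine Asymptotics.IsBigO.trans_isLittleO (Asymptotics.IsBigO.of_bound 1 ?_) h1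
    refine Filter.Eventually.of_forall fun s => ?_
    have h2 : max s 0 ^ 2 ≤ s ^ 2 := by
      rcases le_total s 0 with hs | hs
      · rw [max_eq_right hs]; simpa using sq_nonneg s
      · rw [max_eq_left hs]
    simpa using h2
  · rw [max_eq_left h.le]
    have : (fun t : ℝ => max t 0 ^ 2) =ᶠ[nhds t] fun t => t ^ 2 := by
      filter_upwards [lt_mem_nhds h] with s hs
      rw [max_eq_left hs.le]
    simpa using (hasDerivAt_pow 2 t).congr_of_eventuallyEq this

namespace Problem

/-- The standing properties of a strongly convex subproblem. -/
structure StronglyConvexProblem (P : Problem n l m) (ρ : ℝ) : Prop where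
  dom : ClosedConvexBounded P.dom P.h
  smooth : SmoothStronglyConvex P.g ρ
  f_convex : ∀ i, ConvexOn ℝ univ (P.f i)
  f_diff : ∀ i, Differentiable ℝ (P.f i)
  f_lip : ∀ i, LipBdd (∇ (P.f i))

variable {P : Problem n l m} {ρ : ℝ}

theorem hasGradientAt_augPen (hf : ∀ i, Differentiable ℝ (P.f i)) {β : ℝ} (hβ : 0 < β)
    (p : Dual l m) (x : E n) :
    HasGradientAt (P.augPen β p) (P.dualGrad (P.multUpdate β p x) x) x := by
  have h0 : P.augPen β p = fun x => ∑ j, (p.1 j * P.res x j + β / 2 * P.res x j ^ 2)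
      + ∑ i, 1 / (2 * β) * (max (p.2 i + β * P.f i x) 0 ^ 2 - p.2 i ^ 2) := by
    funext x; exact P.augPen_eq_sum p x
  rw [h0, dualGrad, adj_eq_sum]
  refine hasGradientAt_add (hasGradientAt_sum _ fun j => ?_) (hasGradientAt_sum _ fun i => ?_)
  · have h1 : HasGradientAt (fun x => P.res x j) (P.row j) x := by
      simp_rw [res_apply]; exact hasGradientAt_inner _ _ _
    refine hasGradientAt_comp (φ := fun t => p.1 j * t + β / 2 * t ^ 2) ?_ h1
    rw [multUpdate_fst_apply]
    have h2 := ((hasDerivAt_id (P.res x j)).const_mul (p.1 j)).add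
      (((hasDerivAt_id (P.res x j)).pow 2).const_mul (β / 2))
    refine h2.congr_deriv ?_
    simp
    ring
  · refine hasGradientAt_comp
      (φ := fun t => 1 / (2 * β) * (max (p.2 i + β * t) 0 ^ 2 - p.2 i ^ 2)) ?_
      (hf i x).hasGradientAt
    rw [multUpdate_snd_apply]
    have h2 : HasDerivAt (fun t => p.2 i + β * t) β (P.f i x) := by
      simpa using ((hasDerivAt_id (P.f i x)).const_mul β).const_add (p.2 i)
    have h3 := (hasDerivAt_max_sq (p.2 i + β * P.f i x)).comp (P.f i x) h2
    refine ((h3.sub_const (p.2 i ^ 2)).const_mul (1 / (2 * β))).congr_deriv ?_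
    field_simp

theorem inner_dualGrad (p : Dual l m) (x v : E n) :
    inner ℝ (P.dualGrad p x) v
      = ∑ j, p.1 j * inner ℝ (P.row j) v + ∑ i, p.2 i * inner ℝ (∇ (P.f i) x) v := by
  rw [dualGrad, adj_eq_sum, inner_add_left, sum_inner, sum_inner]
  simp_rw [inner_smul_left, conj_trivial]

theorem res_sub (x w : E n) (j : Fin l) : P.res w j - P.res x j = inner ℝ (P.row j) (w - x) := by
  rw [res_apply, res_apply, inner_sub_right]; ring

theorem inner_dualGrad_le_pair (hP : P.StronglyConvexProblem ρ) {p : Dual l m}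
    (hp : ∀ i, 0 ≤ p.2 i) (x w : E n) :
    P.pair p x + inner ℝ (P.dualGrad p x) (w - x) ≤ P.pair p w := by
  rw [inner_dualGrad, pair_eq_sum, pair_eq_sum, add_add_add_comm, ← Finset.sum_add_distrib,
    ← Finset.sum_add_distrib]
  refine add_le_add (Finset.sum_le_sum fun j _ => ?_) (Finset.sum_le_sum fun i _ => ?_)
  · rw [← res_sub]; exact le_of_eq (by ring)
  · have := inner_gradient_le_of_convexOn (hP.f_convex i) (hP.f_diff i) w x
    nlinarith [mul_le_mul_of_nonneg_left this (hp i)]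

theorem inner_dualGrad_le_augPen (hP : P.StronglyConvexProblem ρ) {β : ℝ} (hβ : 0 < β)
    (p : Dual l m) (x w : E n) :
    P.augPen β p x + inner ℝ (P.dualGrad (P.multUpdate β p x) x) (w - x) ≤ P.augPen β p w := by
  rw [inner_dualGrad, augPen_eq_sum, augPen_eq_sum, add_add_add_comm, ← Finset.sum_add_distrib,
    ← Finset.sum_add_distrib]
  refine add_le_add (Finset.sum_le_sum fun j _ => ?_) (Finset.sum_le_sum fun i _ => ?_)
  · rw [← res_sub, multUpdate_fst_apply]
    nlinarith [mul_nonneg hβ.le (sq_nonneg (P.res w j - P.res x j))]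
  · have h1 := inner_gradient_le_of_convexOn (hP.f_convex i) (hP.f_diff i) w x
    rw [multUpdate_snd_apply]
    set a := p.2 i + β * P.f i x with ha
    set b := p.2 i + β * P.f i w with hb
    have h2 : β * inner ℝ (∇ (P.f i) x) (w - x) ≤ b - a := by rw [ha, hb]; nlinarith
    have h3 : max a 0 * (b - a) ≤ (max b 0 ^ 2 - max a 0 ^ 2) / 2 := by
      rcases le_total a 0 with h | h
      · rw [max_eq_right h]; simp; positivity
      · rw [max_eq_left h]
        nlinarith [le_max_left b 0, sq_nonneg (max b 0 - a), mul_le_mul_of_nonneg_left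
          (le_max_left b 0) h]
    have h4 : max a 0 * (β * inner ℝ (∇ (P.f i) x) (w - x)) ≤ (max b 0 ^ 2 - max a 0 ^ 2) / 2 :=
      (mul_le_mul_of_nonneg_left h2 (le_max_right _ _)).trans h3
    have h5 : max a 0 * inner ℝ (∇ (P.f i) x) (w - x)
        ≤ 1 / (2 * β) * (max b 0 ^ 2 - max a 0 ^ 2) := by
      have : 1 / (2 * β) * (max b 0 ^ 2 - max a 0 ^ 2)
          = (max b 0 ^ 2 - max a 0 ^ 2) / 2 / β := by field_simp
      rw [this, le_div_iff₀ hβ]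
      linarith
    linarith

theorem lipBdd_res (j : Fin l) : LipBdd (fun x => P.res x j) := by
  refine LipBdd.of_lipschitz ‖P.row j‖ (norm_nonneg _) fun x y => ?_
  rw [res_sub]
  exact norm_inner_le_norm _ _

theorem gradient_augLag (hP : P.StronglyConvexProblem ρ) {β : ℝ} (hβ : 0 < β)
    (p : Dual l m) (x : E n) :
    ∇ (P.augLag β p) x = ∇ P.g x + P.dualGrad (P.multUpdate β p x) x := by
  have : P.augLag β p = fun x => P.g x + P.augPen β p x := by funext x; exact P.augLag_eq β p x
  rw [this]
  exact (hasGradientAt_add (hP.smooth.diff x).hasGradientAt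
    (hasGradientAt_augPen hP.f_diff hβ p x)).gradient

theorem smoothStronglyConvex_augLag (hP : P.StronglyConvexProblem ρ) {β : ℝ} (hβ : 0 < β)
    (p : Dual l m) : SmoothStronglyConvex (P.augLag β p) ρ := by
  have h0 : P.augLag β p = fun x => P.g x + P.augPen β p x := by
    funext x; exact P.augLag_eq β p x
  have hmul : ∀ (c d : ℝ) {a : E n → ℝ}, LipBdd a → LipBdd (fun x => c + d * a x) :=
    fun c d a ha => (LipBdd.const c).add ((LipBdd.const d).smul ha)
  refine ⟨?_, ?_, ?_⟩
  · rw [h0]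
    exact hP.smooth.diff.add fun x => (hasGradientAt_augPen hP.f_diff hβ p x).differentiableAt
  · have h1 : ∇ (P.augLag β p) = fun x => ∇ P.g x
        + (∑ j, (p.1 j + β * P.res x j) • P.row j
          + ∑ i, max (p.2 i + β * P.f i x) 0 • ∇ (P.f i) x) := by
      funext x
      rw [gradient_augLag hP hβ, dualGrad, adj_eq_sum]
      rfl
    rw [h1]
    refine hP.smooth.lip.add (LipBdd.add (LipBdd.sum _ fun j => ?_) (LipBdd.sum _ fun i => ?_))
    · exact (hmul _ _ (lipBdd_res j)).smul (LipBdd.const _)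
    · exact (hmul _ _ (LipBdd.of_gradient (hP.f_diff i) (hP.f_lip i))).max_zero.smul (hP.f_lip i)
  · intro x y
    rw [gradient_augLag hP hβ, inner_add_left, augLag_eq, augLag_eq]
    have h1 := hP.smooth.strong x y
    have h2 := inner_dualGrad_le_augPen hP hβ p y x
    linarith

/-! ### Approximate minimizers of the augmented Lagrangian -/

/-- Strong convexity of the objective at an approximate stationary point: the linear terms of the
augmented Lagrangian are those of the Lagrangian at the updated multiplier. -/
theorem obj_add_pair_le (hP : P.StronglyConvexProblem ρ) {β δ : ℝ} (hβ : 0 < β) {p : Dual l m}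
    {x w : E n} (hx : IsStationary P.dom P.h (P.augLag β p) δ x) (hw : w ∈ P.dom) :
    P.obj x + P.pair (P.multUpdate β p x) x + ρ / 2 * ‖w - x‖ ^ 2 - δ * ‖w - x‖
      ≤ P.obj w + P.pair (P.multUpdate β p x) w := by
  obtain ⟨v, hv, hδ⟩ := hx
  rw [gradient_augLag hP hβ] at hδ
  have h1 := hP.smooth.strong w x
  have h2 := hv.2 w hw
  have h3 := inner_dualGrad_le_pair hP (P.multUpdate_snd_nonneg β p x) x w
  set d := P.dualGrad (P.multUpdate β p x) x
  have h4 : -(δ * ‖w - x‖) ≤ inner ℝ (∇ P.g x + d + v) (w - x) :=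
    (neg_le_neg (mul_le_mul_of_nonneg_right hδ (norm_nonneg _))).trans
      (neg_le_of_abs_le (abs_real_inner_le_norm _ _))
  rw [inner_add_left, inner_add_left] at h4
  unfold obj
  linarith

/-- Approximate minimality for the augmented Lagrangian itself. -/
theorem obj_add_augPen_le (hP : P.StronglyConvexProblem ρ) {β δ : ℝ} (hβ : 0 < β) {p : Dual l m}
    {x w : E n} (hx : IsStationary P.dom P.h (P.augLag β p) δ x) (hw : w ∈ P.dom) :
    P.obj x + P.augPen β p x + ρ / 2 * ‖w - x‖ ^ 2 - δ * ‖w - x‖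
      ≤ P.obj w + P.augPen β p w := by
  obtain ⟨v, hv, hδ⟩ := hx
  have h1 := (smoothStronglyConvex_augLag hP hβ p).strong w x
  rw [augLag_eq, augLag_eq] at h1
  have h2 := hv.2 w hw
  have h4 : -(δ * ‖w - x‖) ≤ inner ℝ (∇ (P.augLag β p) x + v) (w - x) :=
    (neg_le_neg (mul_le_mul_of_nonneg_right hδ (norm_nonneg _))).trans
      (neg_le_of_abs_le (abs_real_inner_le_norm _ _))
  rw [inner_add_left] at h4
  unfold obj
  linarith

/-- `(xs, ps)` is a saddle point of the Lagrangian of the strongly convex problem `P`. -/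
structure IsSaddle (P : Problem n l m) (ρ : ℝ) (xs : E n) (ps : Dual l m) : Prop where
  mem : xs ∈ P.dom
  res_eq : P.res xs = 0
  f_le : ∀ i, P.f i xs ≤ 0
  nonneg : ∀ i, 0 ≤ ps.2 i
  le : ∀ w ∈ P.dom, P.obj xs + ρ / 2 * ‖w - xs‖ ^ 2 ≤ P.obj w + P.pair ps w

/-- The multiplier update approaches the dual solution, up to the inexactness of the primal step. -/
theorem multUpdate_dist_le (hP : P.StronglyConvexProblem ρ) (hρ : 0 < ρ) {β δ : ℝ} (hβ : 0 < β)
    {p ps : Dual l m} {x xs : E n} (hx : IsStationary P.dom P.h (P.augLag β p) δ x)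
    (hs : P.IsSaddle ρ xs ps) :
    ‖toL (P.multUpdate β p x) - toL ps‖ ^ 2 + ‖toL (P.multUpdate β p x) - toL p‖ ^ 2
      ≤ ‖toL p - toL ps‖ ^ 2 + β * (δ ^ 2 / (2 * ρ)) := by
  have hxX : x ∈ P.dom := hx.choose_spec.1.1
  have h1 := obj_add_pair_le hP hβ hx hs.mem
  have h2 := hs.le x hxX
  have h3 := pair_nonpos (P.multUpdate_snd_nonneg β p x) hs.res_eq hs.f_le
  have h4 := inner_multUpdate_sub_le (P := P) (β := β) (p := p) (x := x) hs.nonneg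
  rw [norm_sub_rev] at h2
  set d := ‖xs - x‖
  set a := toL (P.multUpdate β p x)
  have h5 : P.pair (P.multUpdate β p x) x - P.pair ps x ≤ δ ^ 2 / (4 * ρ) := by
    have : δ * d - ρ * d ^ 2 ≤ δ ^ 2 / (4 * ρ) := by
      rw [le_div_iff₀ (by positivity)]
      nlinarith [sq_nonneg (2 * ρ * d - δ)]
    linarith
  have h6 : inner ℝ (a - toL p) (a - toL ps) ≤ β * (δ ^ 2 / (4 * ρ)) :=
    h4.trans (mul_le_mul_of_nonneg_left h5 hβ.le)
  have h7 : ‖toL p - toL ps‖ ^ 2 = ‖a - toL ps‖ ^ 2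
      - 2 * inner ℝ (a - toL p) (a - toL ps) + ‖a - toL p‖ ^ 2 := by
    have : toL p - toL ps = (a - toL ps) - (a - toL p) := by abel
    rw [this, norm_sub_sq_real, real_inner_comm]
  have h8 : β * (δ ^ 2 / (2 * ρ)) = 2 * (β * (δ ^ 2 / (4 * ρ))) := by field_simp; ring
  rw [h7, h8]
  linarith

/-- An approximate minimizer of the augmented Lagrangian is a KKT point if the multiplier moves
little. -/
theorem isKKT_of_stationary (hP : P.StronglyConvexProblem ρ) {β δ ε : ℝ} (hβ : 0 < β)
    {p : Dual l m} (hp : ∀ i, 0 ≤ p.2 i) {x : E n}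
    (hx : IsStationary P.dom P.h (P.augLag β p) δ x) (hδ : δ ≤ ε)
    (h1 : dnorm (P.multUpdate β p x - p) / β ≤ ε)
    (h2 : ∑ i, |(P.multUpdate β p x).2 i * P.f i x| ≤ ε) :
    P.IsKKT ε x (P.multUpdate β p x) := by
  obtain ⟨v, hv, hvδ⟩ := hx
  refine ⟨hv.1, P.multUpdate_snd_nonneg β p x, (feas_le hβ hp).trans h1, ⟨v, hv, ?_⟩, h2⟩
  rw [gradient_augLag hP hβ, dualGrad] at hvδ
  have : ∇ P.g x + v + P.adj (P.multUpdate β p x).1 +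
      ∑ i, (P.multUpdate β p x).2 i • ∇ (P.f i) x
      = ∇ P.g x + (P.adj (P.multUpdate β p x).1
        + ∑ i, (P.multUpdate β p x).2 i • ∇ (P.f i) x) + v := by abel
  rw [this]
  exact hvδ.trans hδ

/-! ### Proximal-point subproblems -/

theorem obj_prox (c x : E n) : (P.prox ρ c).obj x = P.obj x + ρ * ‖x - c‖ ^ 2 := by
  unfold obj prox; ring

theorem gradient_prox (hg : Differentiable ℝ P.g) (c x : E n) :
    ∇ (P.prox ρ c).g x = ∇ P.g x + (2 * ρ) • (x - c) :=
  (hasGradientAt_add (hg x).hasGradientAt (hasGradientAt_norm_sub_sq ρ c x)).gradient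

theorem closedConvexBounded (hc : P.CompositeSmooth) {M B₀ : ℝ} (hb : P.UniformBound M B₀)
    (hne : P.dom.Nonempty) : ClosedConvexBounded P.dom P.h where
  nonempty := hne
  convex := hc.h_convex
  closed := hc.h_closed
  bounded := hc.dom_bounded
  range_bounded := by
    obtain ⟨R, hR⟩ := hc.dom_bounded.exists_norm_le
    obtain ⟨C, -, hC⟩ :=
      (LipBdd.of_gradient hc.g_diff (lipBdd_of_lipschitzOnWith hc.g_smooth)).bounded R
    refine ⟨B₀ + C, fun x hx => ?_⟩
    have h1 := hb.obj_bound x hx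
    have h2 : |P.g x| ≤ C := hC x (hR x hx)
    calc |P.h x| = |(P.g x + P.h x) - P.g x| := by ring_nf
      _ ≤ |P.g x + P.h x| + |P.g x| := abs_sub _ _
      _ ≤ B₀ + C := add_le_add h1 h2

theorem stronglyConvexProblem_prox (hc : P.CompositeSmooth) {M B₀ : ℝ} (hb : P.UniformBound M B₀)
    (hne : P.dom.Nonempty) (hw : P.WeaklyConvex ρ) (c : E n) :
    (P.prox ρ c).StronglyConvexProblem ρ where
  dom := closedConvexBounded (P := P) hc hb hne
  smooth := by
    refine ⟨?_, ?_, fun x y => ?_⟩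
    · exact fun x => (hasGradientAt_add (hc.g_diff x).hasGradientAt
        (hasGradientAt_norm_sub_sq ρ c x)).differentiableAt
    · have : ∇ (P.prox ρ c).g = fun x => ∇ P.g x + (2 * ρ) • (x - c) :=
        funext fun x => gradient_prox hc.g_diff c x
      rw [this]
      refine (lipBdd_of_lipschitzOnWith hc.g_smooth).add
        (LipBdd.of_lipschitz (2 * ρ) (by linarith [hw.pos]) fun x y => ?_)
      rw [← smul_sub, norm_smul, Real.norm_of_nonneg (by linarith [hw.pos]),
        sub_sub_sub_cancel_right]
    · rw [gradient_prox hc.g_diff]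
      have hq : ∀ z, HasGradientAt (fun x => P.g x + ρ / 2 * ‖x‖ ^ 2) (∇ P.g z + ρ • z) z := by
        intro z
        have := hasGradientAt_norm_sub_sq (ρ / 2) 0 z
        simp only [sub_zero, show 2 * (ρ / 2) = ρ by ring] at this
        exact hasGradientAt_add (hc.g_diff z).hasGradientAt this
      have h1 := inner_gradient_le_of_convexOn hw.convex (fun z => (hq z).differentiableAt) x y
      rw [(hq y).gradient, inner_add_left, inner_smul_left] at h1
      simp only [conj_trivial] at h1
      rw [inner_add_left, inner_smul_left]
      simp only [conj_trivial]
      change P.g y + ρ * ‖y - c‖ ^ 2 + _ + _ ≤ P.g x + ρ * ‖x - c‖ ^ 2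
      have e1 : ‖x‖ ^ 2 = ‖y‖ ^ 2 + 2 * inner ℝ y (x - y) + ‖x - y‖ ^ 2 := by
        rw [← norm_add_sq_real, add_sub_cancel]
      have e2 : ‖x - c‖ ^ 2 = ‖y - c‖ ^ 2 + 2 * inner ℝ (y - c) (x - y) + ‖x - y‖ ^ 2 := by
        rw [← norm_add_sq_real]; congr 2; abel
      rw [e1] at h1
      rw [e2]
      linarith
  f_convex := hc.f_convex
  f_diff := hc.f_diff
  f_lip := fun i => lipBdd_of_lipschitzOnWith (hc.f_smooth i)

/-- An approximate KKT point of a proximal subproblem close to the center is one of the original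
problem. -/
theorem IsKKT.of_prox (hg : Differentiable ℝ P.g) (hρ : 0 < ρ) {c x : E n} {p : Dual l m}
    {ε e : ℝ} (h : (P.prox ρ c).IsKKT e x p) (he : e ≤ ε / 2) (hε : 0 ≤ ε)
    (hx : ‖x - c‖ ≤ ε / (4 * ρ)) : P.IsKKT ε x p := by
  obtain ⟨h1, h2, h3, ⟨v, hv, h4⟩, h5⟩ := h
  have heε : e ≤ ε := by linarith
  refine ⟨h1, h2, h3.trans heε, ⟨v, hv, ?_⟩, h5.trans heε⟩
  rw [gradient_prox hg] at h4
  have e1 : ∇ P.g x + v + P.adj p.1 + ∑ i, p.2 i • ∇ (P.f i) x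
      = (∇ P.g x + (2 * ρ) • (x - c) + v + P.adj p.1 + ∑ i, p.2 i • ∇ (P.f i) x)
        - (2 * ρ) • (x - c) := by abel
  have e2 : ‖(2 * ρ) • (x - c)‖ ≤ ε / 2 := by
    rw [norm_smul, Real.norm_of_nonneg (by positivity)]
    calc 2 * ρ * ‖x - c‖ ≤ 2 * ρ * (ε / (4 * ρ)) := by gcongr
      _ = ε / 2 := by field_simp; ring
  rw [e1]
  have h4' : ‖∇ P.g x + (2 * ρ) • (x - c) + v + P.adj p.1 + ∑ i, p.2 i • ∇ (P.f i) x‖ ≤ e := h4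
  exact (norm_sub_le _ _).trans (by linarith)

end Problem

end

section

variable {n l m : ℕ}

/-! ### Bounds for exact multipliers -/

theorem ball_infDist_frontier_subset {X : Set (E n)} {x : E n} (hx : x ∈ interior X) :
    Metric.ball x (Metric.infDist x (frontier X)) ⊆ X := by
  rcases le_or_gt (Metric.infDist x (frontier X)) 0 with h | h
  · rw [Metric.ball_eq_empty.2 h]; exact empty_subset _
  refine subset_trans (IsPreconnected.subset_left_of_subset_union (u := interior X)
    (v := (closure X)ᶜ) isOpen_interior isClosed_closure.isOpen_compl ?_ ?_ ?_ ?_) interior_subset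
  · exact disjoint_compl_right.mono_left (interior_subset.trans subset_closure)
  · intro y hy
    by_contra hy'
    simp only [mem_union, mem_compl_iff, not_or, not_not] at hy'
    have h1 : Metric.infDist x (frontier X) ≤ dist x y :=
      Metric.infDist_le_dist_of_mem ⟨hy'.2, hy'.1⟩
    rw [Metric.mem_ball, dist_comm] at hy
    linarith
  · exact ⟨x, Metric.mem_ball_self h, hx⟩
  · exact (convex_ball _ _).isPreconnected

/-- A normal vector at any point of a bounded set is controlled by a ball inside the set; in
dimension zero the frontier is empty, and the vector vanishes. -/
theorem norm_normalCone_le {X : Set (E n)} (hb : Bornology.IsBounded X) {xf x u : E n} {T : ℝ}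
    (hxf : xf ∈ interior X) (hu : u ∈ normalCone X x) (hT : inner ℝ u (x - xf) ≤ T) :
    ‖u‖ ≤ T / Metric.infDist xf (frontier X) := by
  rcases Nat.eq_zero_or_pos n with rfl | hn
  · have h0 : u = 0 := Subsingleton.elim _ _
    rw [h0, inner_zero_left] at hT
    rw [h0, norm_zero]
    exact div_nonneg hT Metric.infDist_nonneg
  have : Nonempty (Fin n) := ⟨⟨0, hn⟩⟩
  have hfr : (frontier X).Nonempty := by
    refine nonempty_frontier_iff.2 ⟨⟨xf, interior_subset hxf⟩, fun h => ?_⟩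
    rw [h] at hb
    exact NormedSpace.unbounded_univ ℝ (E n) hb
  have hδ : 0 < Metric.infDist xf (frontier X) :=
    (isClosed_frontier.notMem_iff_infDist_pos hfr).1 fun h => h.2 hxf
  rw [le_div_iff₀ hδ]
  set δ := Metric.infDist xf (frontier X)
  by_contra! hlt
  have hT0 : ∀ r, 0 < r → r < δ → r * ‖u‖ ≤ T := by
    intro r hr hrδ
    by_cases hu0 : u = 0
    · have : 0 ≤ T := by simpa [hu0] using hT
      simpa [hu0] using this
    have hnu : 0 < ‖u‖ := norm_pos_iff.2 hu0
    have hmem : xf + (r / ‖u‖) • u ∈ X := by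
      apply ball_infDist_frontier_subset hxf
      rw [Metric.mem_ball, dist_eq_norm, add_sub_cancel_left, norm_smul, Real.norm_of_nonneg
        (by positivity), div_mul_cancel₀ _ hnu.ne']
      exact hrδ
    have h1 := hu _ hmem
    have h2 : xf + (r / ‖u‖) • u - x = (r / ‖u‖) • u - (x - xf) := by abel
    rw [h2, inner_sub_right, inner_smul_right, real_inner_self_eq_norm_sq] at h1
    have h3 : r / ‖u‖ * ‖u‖ ^ 2 = r * ‖u‖ := by field_simp
    linarith
  have hnu : 0 < ‖u‖ := by
    by_contra! h
    have h1 : ‖u‖ = 0 := le_antisymm h (norm_nonneg _)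
    have h2 := hT0 (δ / 2) (by positivity) (by linarith)
    rw [h1] at h2 hlt
    linarith
  have hmx := hT0 (max (δ / 2) ((T / ‖u‖ + δ) / 2)) (by positivity) (by
    refine max_lt (by linarith) ?_
    have : T / ‖u‖ < δ := by rw [div_lt_iff₀ hnu]; linarith
    linarith)
  have h4 : (T / ‖u‖ + δ) / 2 * ‖u‖ ≤ T := (mul_le_mul_of_nonneg_right (le_max_right _ _)
    hnu.le).trans hmx
  have h5 : T / ‖u‖ * ‖u‖ = T := div_mul_cancel₀ _ hnu.ne'
  nlinarith

/-- At an interior point `xf`, the function `h` is Lipschitz with the constant `M` that bounds its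
subgradients modulo normal vectors: the proximal points of `xf` for large parameters are interior
and approach `xf`, and their subgradients have norm at most `M`. -/
theorem le_add_of_subdiff_bound {X : Set (E n)} {h : E n → ℝ} (hX : ClosedConvexBounded X h)
    {M : ℝ} (hM : ∀ x ∈ X, ∀ v ∈ subdiff X h x,
      ∃ u ∈ normalCone X x, ∃ w : E n, ‖w‖ ≤ M ∧ v = u + w)
    {xf x : E n} (hxf : xf ∈ interior X) (hx : x ∈ X) : h xf ≤ h x + M * ‖x - xf‖ := by
  obtain ⟨H, hH⟩ := hX.range_bounded
  have hxfX := interior_subset hxf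
  have hH0 : 0 ≤ H := (abs_nonneg _).trans (hH x hx)
  have hex : ∀ k : ℕ, ∃ u ∈ X, ‖u - xf‖ ^ 2 ≤ 2 * H / (k + 1) ∧
      -(((k : ℝ) + 1) • (u - xf)) ∈ subdiff X h u := by
    intro k
    obtain ⟨u, -, huX, hu⟩ := hX.exists_mem_proxGrad (fun _ => 0) ((k : ℝ) + 1) xf
    rw [gradient_fun_const, zero_add] at hu
    refine ⟨u, huX, ?_, hu⟩
    have h1 := hu.2 xf hxfX
    have h2 : xf - u = -(u - xf) := by abel
    rw [h2, inner_neg_neg, inner_smul_left, real_inner_self_eq_norm_sq] at h1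
    simp only [conj_trivial] at h1
    rw [le_div_iff₀ (by positivity)]
    linarith [(abs_le.1 (hH xf hxfX)).2, (abs_le.1 (hH u huX)).1]
  choose u huX hun hus using hex
  have hlim : Filter.Tendsto (fun k => ‖u k - xf‖) Filter.atTop (nhds 0) := by
    have h1 : Filter.Tendsto (fun k : ℕ => √(2 * H / ((k : ℝ) + 1))) Filter.atTop (nhds 0) := by
      have h2 : Filter.Tendsto (fun k : ℕ => 2 * H / ((k : ℝ) + 1)) Filter.atTop (nhds 0) := by
        have := (tendsto_one_div_add_atTop_nhds_zero_nat (𝕜 := ℝ)).const_mul (2 * H)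
        simpa [div_eq_mul_inv] using this
      simpa using h2.sqrt
    exact squeeze_zero (fun _ => norm_nonneg _) (fun k => Real.le_sqrt_of_sq_le (hun k)) h1
  have hlim' : Filter.Tendsto u Filter.atTop (nhds xf) := tendsto_iff_norm_sub_tendsto_zero.2 hlim
  have hlimq : Filter.Tendsto (fun k => (u k, h x + M * ‖x - u k‖)) Filter.atTop
      (nhds (xf, h x + M * ‖x - xf‖)) :=
    hlim'.prodMk_nhds (((tendsto_const_nhds.sub hlim').norm.const_mul M).const_add (h x))
  refine (hX.closed.mem_of_tendsto hlimq ?_).2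
  filter_upwards [hlim'.eventually (isOpen_interior.mem_nhds hxf)] with k hk
  refine ⟨huX k, ?_⟩
  obtain ⟨a, ha, w, hw, haw⟩ := hM _ (huX k) _ (hus k)
  have ha0 : a = 0 := by
    obtain ⟨r, hr, hball⟩ := Metric.isOpen_iff.1 isOpen_interior _ hk
    by_contra hne
    have hna : 0 < ‖a‖ := norm_pos_iff.2 hne
    have hmem : u k + (r / 2 / ‖a‖) • a ∈ X := by
      apply interior_subset
      apply hball
      rw [Metric.mem_ball, dist_eq_norm, add_sub_cancel_left, norm_smul, Real.norm_of_nonneg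
        (by positivity), div_mul_cancel₀ _ hna.ne']
      linarith
    have h1 := ha _ hmem
    rw [add_sub_cancel_left, inner_smul_right, real_inner_self_eq_norm_sq] at h1
    have : 0 < r / 2 / ‖a‖ * ‖a‖ ^ 2 := by positivity
    linarith
  rw [ha0, zero_add] at haw
  have h1 := (hus k).2 x hx
  rw [haw] at h1
  have h2 := neg_le_of_abs_le (abs_real_inner_le_norm w (x - u k))
  have h3 := mul_le_mul_of_nonneg_right hw (norm_nonneg (x - u k))
  change h (u k) ≤ h x + M * ‖x - u k‖
  linarith

namespace Problem

variable {P : Problem n l m} {ρ M B₀ G₀ : ℝ}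

theorem lamMin_mul_norm_sq_le (y : E l) : P.lamMin * ‖y‖ ^ 2 ≤ ‖P.adj y‖ ^ 2 := by
  set hS := Matrix.isHermitian_mul_conjTranspose_self P.A
  set e := hS.eigenvectorBasis
  have h1 : ‖P.adj y‖ ^ 2
      = inner ℝ y (WithLp.toLp 2 ((P.A * P.A.conjTranspose).mulVec y.ofLp)) := by
    rw [← real_inner_self_eq_norm_sq, EuclideanSpace.inner_eq_star_dotProduct,
      EuclideanSpace.inner_eq_star_dotProduct]
    simp only [adj, star_trivial, Matrix.conjTranspose_eq_transpose_of_trivial]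
    rw [← Matrix.mulVec_mulVec, Matrix.mulVec_transpose, ← Matrix.dotProduct_mulVec,
      dotProduct_comm]
  have h2 : ∀ i, inner ℝ (e i) (WithLp.toLp 2 ((P.A * P.A.conjTranspose).mulVec y.ofLp))
      = hS.eigenvalues i * inner ℝ (e i) y := by
    intro i
    rw [EuclideanSpace.inner_eq_star_dotProduct, EuclideanSpace.inner_eq_star_dotProduct]
    simp only [star_trivial]
    have h3 := hS.mulVec_eigenvectorBasis i
    have h4 : (P.A * P.A.conjTranspose).transpose = P.A * P.A.conjTranspose := by
      simp
    rw [dotProduct_comm, Matrix.dotProduct_mulVec, ← Matrix.mulVec_transpose, h4, h3,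
      smul_dotProduct, dotProduct_comm]
    rfl
  rw [h1, ← e.sum_inner_mul_inner y, ← real_inner_self_eq_norm_sq, ← e.sum_inner_mul_inner y,
    Finset.mul_sum]
  refine Finset.sum_le_sum fun i _ => ?_
  rw [h2, real_inner_comm]
  have h5 : P.lamMin ≤ hS.eigenvalues i := ciInf_le (finite_range _).bddBelow i
  nlinarith [sq_nonneg (inner ℝ y (e i))]

theorem lamMin_pos (hl : 0 < l) (hr : P.A.rank = l) : 0 < P.lamMin := by
  have : Nonempty (Fin l) := ⟨⟨0, hl⟩⟩
  set hS := Matrix.isHermitian_mul_conjTranspose_self P.A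
  have h1 := hS.rank_eq_card_non_zero_eigs
  rw [Matrix.rank_self_mul_conjTranspose, hr] at h1
  have h2 : ∀ i, hS.eigenvalues i ≠ 0 := by
    intro i hi
    have := Fintype.card_subtype_lt (p := fun i => hS.eigenvalues i ≠ 0) (x := i)
      (by simpa using hi)
    rw [Fintype.card_fin] at this
    omega
  obtain ⟨i, hi⟩ := exists_eq_ciInf_of_finite (f := hS.eigenvalues)
  change 0 < ⨅ i, hS.eigenvalues i
  rw [← hi]
  exact lt_of_le_of_ne (Matrix.eigenvalues_self_mul_conjTranspose_nonneg P.A i) (h2 i).symm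

theorem norm_le_of_norm_adj_le (hr : P.A.rank = l) {y : E l} {T : ℝ} (hT : ‖P.adj y‖ ≤ T) :
    ‖y‖ ≤ √P.lamMax / P.lamMin * T := by
  have hT0 : 0 ≤ T := (norm_nonneg _).trans hT
  rcases Nat.eq_zero_or_pos l with rfl | hl
  · have : y = 0 := Subsingleton.elim _ _
    rw [this, norm_zero, lamMin, Real.iInf_of_isEmpty]
    simp
  have : Nonempty (Fin l) := ⟨⟨0, hl⟩⟩
  have h0 := lamMin_pos hl hr
  have h1 : P.lamMin ≤ P.lamMax :=
    ciInf_le_ciSup (finite_range _).bddBelow (finite_range _).bddAbove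
  have h2 := lamMin_mul_norm_sq_le (P := P) y
  have h3 : √P.lamMin * ‖y‖ ≤ T := by
    refine le_trans (le_of_sq_le_sq ?_ (norm_nonneg _)) hT
    rw [mul_pow, Real.sq_sqrt h0.le]
    exact h2
  have h4 : 0 < √P.lamMin := Real.sqrt_pos.2 h0
  calc ‖y‖ = √P.lamMin * (√P.lamMin * ‖y‖) / P.lamMin := by
        rw [← mul_assoc, Real.mul_self_sqrt h0.le]; field_simp
    _ ≤ √P.lamMax * T / P.lamMin := by
        have := Real.sqrt_le_sqrt h1
        gcongr
    _ = _ := by ring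

end Problem

end

section

variable {n l m : ℕ}

namespace Problem

variable {P : Problem n l m} {ρ M B₀ G₀ : ℝ} {B : Fin m → ℝ} {xfeas c : E n}

theorem continuous_res : Continuous P.res := by
  unfold res; fun_prop

theorem continuous_pair_left (x : E n) : Continuous fun p : Dual l m => P.pair p x := by
  unfold pair; fun_prop

theorem continuous_feas (hf : ∀ i, Differentiable ℝ (P.f i)) : Continuous P.feas := by
  have h1 := continuous_res (P := P)
  have h2 : Continuous fun x => posVec (P.fvec x) := by
    have := fun i => (hf i).continuous
    unfold posVec fvec; fun_prop
  unfold feas; fun_prop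

/-- Over the domain, the Slater point is better than any other point up to the diameter. -/
theorem obj_prox_slater_le (hc : P.CompositeSmooth) (hs : P.IsSlater xfeas)
    (hw : P.WeaklyConvex ρ) (hb : P.UniformBound M B₀) (hM : 0 ≤ M)
    (hG : ∀ x ∈ P.dom, ‖∇ P.g x‖ ≤ G₀) (hcX : c ∈ P.dom) {x : E n} (hx : x ∈ P.dom) :
    (P.prox ρ c).obj xfeas - (P.prox ρ c).obj x ≤ P.diam * (G₀ + ρ * P.diam + M) := by
  have hxf := interior_subset hs.mem_interior
  have hX := closedConvexBounded hc hb ⟨x, hx⟩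
  have hdist : ∀ a ∈ P.dom, ∀ b ∈ P.dom, ‖a - b‖ ≤ P.diam := fun a ha b hb => by
    rw [← dist_eq_norm]; exact Metric.dist_le_diam_of_mem hc.dom_bounded ha hb
  have h1 := le_add_of_subdiff_bound hX hb.subdiff_bound hs.mem_interior hx
  obtain ⟨z, hz, h2⟩ := exists_segment_inner_gradient hc.g_diff x xfeas
  have hz' : z ∈ P.dom := hX.convex.1.segment_subset hx hxf hz
  have h3 : inner ℝ (∇ P.g z) (xfeas - x) ≤ G₀ * P.diam :=
    (real_inner_le_norm _ _).trans (mul_le_mul (hG z hz') (hdist _ hxf _ hx) (norm_nonneg _)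
      ((norm_nonneg _).trans (hG z hz')))
  have h4 : M * ‖x - xfeas‖ ≤ M * P.diam := mul_le_mul_of_nonneg_left (hdist _ hx _ hxf) hM
  have h5 : ρ * ‖xfeas - c‖ ^ 2 ≤ ρ * P.diam ^ 2 := by
    have := hdist _ hxf _ hcX
    have := hw.pos
    gcongr
  have h6 : 0 ≤ ρ * ‖x - c‖ ^ 2 := mul_nonneg hw.pos.le (by positivity)
  rw [obj_prox, obj_prox]
  unfold obj
  nlinarith

/-- The multipliers of exact quadratic penalty subproblems are bounded by `Mp`. Comparison with the
Slater point bounds `∑ zᵢ`. It also bounds the normal part of the subgradient of `h`, so that the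
optimality condition bounds `Aᵀ y`, and `A` has full row rank. -/
theorem dnorm_multUpdate_zero_le (hc : P.CompositeSmooth)
    (hB : ∀ i, ∀ x ∈ P.dom, |P.f i x| ≤ B i ∧ ‖∇ (P.f i) x‖ ≤ B i) (hs : P.IsSlater xfeas)
    (hw : P.WeaklyConvex ρ) (hb : P.UniformBound M B₀) (hM : 0 ≤ M)
    (hG : ∀ x ∈ P.dom, ‖∇ P.g x‖ ≤ G₀) (hcX : c ∈ P.dom) {β : ℝ} (hβ : 0 < β) {x : E n}
    (hx : IsStationary P.dom P.h ((P.prox ρ c).augLag β 0) 0 x) :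
    dnorm (P.multUpdate β 0 x) ≤ P.Mp ρ M G₀ B xfeas := by
  have hxf := interior_subset hs.mem_interior
  have hne : P.dom.Nonempty := ⟨_, hxf⟩
  have hQ := stronglyConvexProblem_prox hc hb hne hw c
  have hxX : x ∈ P.dom := hx.choose_spec.1.1
  have hρ := hw.pos
  have hdist : ∀ a ∈ P.dom, ∀ b ∈ P.dom, ‖a - b‖ ≤ P.diam := fun a ha b hb => by
    rw [← dist_eq_norm]; exact Metric.dist_le_diam_of_mem hc.dom_bounded ha hb
  have hD : 0 ≤ P.diam := Metric.diam_nonneg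
  have hG0 : 0 ≤ G₀ := (norm_nonneg _).trans (hG _ hxf)
  set p := P.multUpdate β 0 x with hp
  have hpn : ∀ i, 0 ≤ p.2 i := P.multUpdate_snd_nonneg β 0 x
  have hpx : 0 ≤ P.pair p x := by
    rw [hp, pair_multUpdate hβ]
    have : toL (0 : Dual l m) = 0 := rfl
    rw [this, sub_zero, real_inner_self_eq_norm_sq]
    positivity
  set μf := ⨅ i, |P.f i xfeas|
  set Z := ∑ i, p.2 i
  have hZ0 : 0 ≤ Z := Finset.sum_nonneg fun i _ => hpn i
  have hμ0 : 0 ≤ μf := Real.iInf_nonneg fun _ => abs_nonneg _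
  set K₁ := P.diam * (G₀ + ρ * P.diam + M)
  have hK₁ : 0 ≤ K₁ := by positivity
  have hpf : P.pair p xfeas ≤ -(Z * μf) := by
    rw [pair, hs.eq_feas, inner_zero_right, zero_add, inner_eq_sum, Finset.sum_mul,
      ← Finset.sum_neg_distrib]
    refine Finset.sum_le_sum fun i _ => ?_
    have h1 : μf ≤ |P.f i xfeas| := ciInf_le (finite_range _).bddBelow i
    rw [abs_of_neg (hs.ineq_feas i)] at h1
    change p.2 i * P.f i xfeas ≤ _
    nlinarith [hpn i]
  have hZ : Z ≤ K₁ / μf := by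
    rcases isEmpty_or_nonempty (Fin m) with h | h
    · -- for `m = 0` the infimum over the empty family is `0`, and both sides vanish
      have : Z = 0 := by simp [Z]
      rw [this]; positivity
    · have hμ : 0 < μf := by
        obtain ⟨i, hi⟩ := exists_eq_ciInf_of_finite (f := fun i => |P.f i xfeas|)
        change 0 < ⨅ i, |P.f i xfeas|
        rw [← hi]
        exact abs_pos.2 (hs.ineq_feas i).ne
      rw [le_div_iff₀ hμ]
      have h1 := obj_add_pair_le hQ hβ hx hxf
      have h2 := obj_prox_slater_le hc hs hw hb hM hG hcX hxX
      have h3 : (P.prox ρ c).pair ((P.prox ρ c).multUpdate β 0 x) x = P.pair p x := rfl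
      have h4 : (P.prox ρ c).pair ((P.prox ρ c).multUpdate β 0 x) xfeas = P.pair p xfeas := rfl
      rw [h3, h4, zero_mul] at h1
      have h5 : 0 ≤ ρ / 2 * ‖xfeas - x‖ ^ 2 := by positivity
      linarith
  have hzn : ‖p.2‖ ≤ P.Mz ρ M G₀ xfeas := by
    refine le_trans (le_of_sq_le_sq ?_ hZ0) hZ
    rw [norm_sq_eq_sum]
    exact Finset.sum_sq_le_sq_sum_of_nonneg fun i _ => hpn i
  set K₂ := G₀ + 2 * ρ * P.diam + M
  have hK₂ : 0 ≤ K₂ := by positivity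
  set b := ⨆ i, B i
  have hBb : ∀ i, B i ≤ b := fun i => le_ciSup (finite_range B).bddAbove i
  have hb0 : 0 ≤ b := Real.iSup_nonneg fun i => (abs_nonneg _).trans (hB i x hxX).1
  have hadj : ‖P.adj p.1‖ ≤ K₂ * (1 + P.diam / Metric.infDist xfeas (frontier P.dom)
      + P.diam * b / μf) := by
    obtain ⟨v, hv, hvδ⟩ := hx
    have hgr : ∇ ((P.prox ρ c).augLag β 0) x
        = ∇ P.g x + (2 * ρ) • (x - c) + P.dualGrad p x := by
      rw [gradient_augLag hQ hβ, gradient_prox hc.g_diff]; rfl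
    have hv0 : v = -(∇ P.g x + (2 * ρ) • (x - c) + P.dualGrad p x) := by
      have := norm_le_zero_iff.1 hvδ
      rw [hgr] at this
      exact (neg_eq_of_add_eq_zero_right this).symm
    obtain ⟨u, hu, w, hwM, hvuw⟩ := hb.subdiff_bound x hxX v hv
    set a := ∇ P.g x + (2 * ρ) • (x - c) + w with ha
    have han : ‖a‖ ≤ K₂ := by
      refine (norm_add₃_le).trans ?_
      rw [norm_smul, Real.norm_of_nonneg (by positivity)]
      have h1 : 2 * ρ * ‖x - c‖ ≤ 2 * ρ * P.diam := by
        have := hdist _ hxX _ hcX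
        gcongr
      linarith [hG x hxX]
    have hu_eq : u = -a - P.dualGrad p x := by
      have : u = v - w := by rw [hvuw]; abel
      rw [this, hv0, ha]; abel
    have hun : ‖u‖ ≤ K₂ * P.diam / Metric.infDist xfeas (frontier P.dom) := by
      refine norm_normalCone_le hc.dom_bounded hs.mem_interior hu ?_
      have h1 := inner_dualGrad_le_pair hQ hpn x xfeas
      have h2 : P.pair p x + inner ℝ (P.dualGrad p x) (xfeas - x) ≤ P.pair p xfeas := h1
      have h3 : P.pair p xfeas ≤ 0 := hpf.trans (by nlinarith [mul_nonneg hZ0 hμ0])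
      have h4 : x - xfeas = -(xfeas - x) := by abel
      have h5 : -inner ℝ a (x - xfeas) ≤ K₂ * P.diam :=
        (neg_le_abs _).trans ((abs_real_inner_le_norm _ _).trans
          (mul_le_mul han (hdist _ hxX _ hxf) (norm_nonneg _) hK₂))
      rw [hu_eq, inner_sub_left, inner_neg_left]
      rw [h4, inner_neg_right (P.dualGrad p x)]
      rw [h4] at h5
      linarith
    have hfn : ‖∑ i, p.2 i • ∇ (P.f i) x‖ ≤ Z * b := by
      rw [Finset.sum_mul]
      refine (norm_sum_le _ _).trans (Finset.sum_le_sum fun i _ => ?_)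
      rw [norm_smul, Real.norm_of_nonneg (hpn i)]
      exact mul_le_mul_of_nonneg_left ((hB i x hxX).2.trans (hBb i)) (hpn i)
    have hadj_eq : P.adj p.1 = -a - u - ∑ i, p.2 i • ∇ (P.f i) x := by
      rw [hu_eq, dualGrad]; abel
    have hZb : Z * b ≤ K₂ * (P.diam * b / μf) := by
      have h1 : K₁ ≤ P.diam * K₂ := by
        have : ρ * P.diam ≤ 2 * ρ * P.diam := by nlinarith [mul_nonneg hρ.le hD]
        exact mul_le_mul_of_nonneg_left (by linarith) hD
      calc Z * b ≤ K₁ / μf * b := by gcongr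
        _ ≤ P.diam * K₂ / μf * b := by gcongr
        _ = _ := by ring
    rw [hadj_eq]
    refine (norm_sub_le _ _).trans ?_
    have h6 := norm_sub_le (-a) u
    rw [norm_neg] at h6
    have h7 : K₂ * (1 + P.diam / Metric.infDist xfeas (frontier P.dom) + P.diam * b / μf)
        = K₂ + K₂ * P.diam / Metric.infDist xfeas (frontier P.dom)
          + K₂ * (P.diam * b / μf) := by ring
    rw [h7]
    linarith
  have hyn : ‖p.1‖ ≤ P.My ρ M G₀ B xfeas := by
    have := norm_le_of_norm_adj_le hb.full_rank hadj
    rw [← mul_assoc] at this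
    exact this
  unfold dnorm Mp
  gcongr

/-- Exact penalty solutions are primal-dual pairs that violate the constraints by at most
`Mp / β`. -/
theorem exists_penalty_solution (hc : P.CompositeSmooth)
    (hB : ∀ i, ∀ x ∈ P.dom, |P.f i x| ≤ B i ∧ ‖∇ (P.f i) x‖ ≤ B i) (hs : P.IsSlater xfeas)
    (hw : P.WeaklyConvex ρ) (hb : P.UniformBound M B₀) (hM : 0 ≤ M)
    (hG : ∀ x ∈ P.dom, ‖∇ P.g x‖ ≤ G₀) (hcX : c ∈ P.dom) {β : ℝ} (hβ : 0 < β) :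
    ∃ x ∈ P.dom, ∃ p : Dual l m, (∀ i, 0 ≤ p.2 i) ∧ dnorm p ≤ P.Mp ρ M G₀ B xfeas ∧
      P.feas x ≤ P.Mp ρ M G₀ B xfeas * (1 / β) ∧
      ∀ w ∈ P.dom, (P.prox ρ c).obj x + ρ / 2 * ‖w - x‖ ^ 2
        ≤ (P.prox ρ c).obj w + P.pair p w := by
  have hne : P.dom.Nonempty := ⟨_, hcX⟩
  have hQ := stronglyConvexProblem_prox hc hb hne hw c
  have hX : ClosedConvexBounded P.dom P.h := closedConvexBounded hc hb hne
  have hsm := smoothStronglyConvex_augLag hQ hβ 0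
  obtain ⟨x, hx, hmin⟩ := hX.exists_isMinOn hsm.diff.continuous
  have hst : IsStationary P.dom P.h ((P.prox ρ c).augLag β 0) 0 x :=
    ⟨_, hX.neg_gradient_mem_subdiff hsm.diff hsm.lip hx hmin, by simp⟩
  have hK := dnorm_multUpdate_zero_le hc hB hs hw hb hM hG hcX hβ hst
  refine ⟨x, hx, P.multUpdate β 0 x, P.multUpdate_snd_nonneg β 0 x, hK, ?_, fun w hw' => ?_⟩
  · refine (feas_le (P := P) (p := 0) (x := x) hβ (fun i => le_rfl)).trans ?_
    rw [sub_zero, div_eq_mul_one_div]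
    exact mul_le_mul_of_nonneg_right hK (by positivity)
  have h1 := obj_add_pair_le hQ hβ hst hw'
  have h2 : 0 ≤ P.pair (P.multUpdate β 0 x) x := by
    rw [pair_multUpdate hβ]
    have : toL (0 : Dual l m) = 0 := rfl
    rw [this, sub_zero, real_inner_self_eq_norm_sq]
    positivity
  have h3 : (P.prox ρ c).pair ((P.prox ρ c).multUpdate β 0 x) x
      = P.pair (P.multUpdate β 0 x) x := rfl
  have h4 : (P.prox ρ c).pair ((P.prox ρ c).multUpdate β 0 x) w
      = P.pair (P.multUpdate β 0 x) w := rfl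
  rw [h3, h4] at h1
  linarith

/-- Strong duality with bounded multipliers: the subproblem has a saddle point, obtained as a limit
of the solutions of quadratic penalty problems. -/
theorem exists_isSaddle (hc : P.CompositeSmooth)
    (hB : ∀ i, ∀ x ∈ P.dom, |P.f i x| ≤ B i ∧ ‖∇ (P.f i) x‖ ≤ B i) (hs : P.IsSlater xfeas)
    (hw : P.WeaklyConvex ρ) (hb : P.UniformBound M B₀) (hM : 0 ≤ M)
    (hG : ∀ x ∈ P.dom, ‖∇ P.g x‖ ≤ G₀) (hcX : c ∈ P.dom) :
    ∃ xs ps, (P.prox ρ c).IsSaddle ρ xs ps ∧ dnorm ps ≤ P.Mp ρ M G₀ B xfeas := by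
  have hne : P.dom.Nonempty := ⟨_, hcX⟩
  have hgc : Continuous (P.prox ρ c).g :=
    (stronglyConvexProblem_prox hc hb hne hw c).smooth.diff.continuous
  have hX : ClosedConvexBounded P.dom P.h := closedConvexBounded hc hb hne
  obtain ⟨K, hKdef⟩ : ∃ K, K = P.Mp ρ M G₀ B xfeas := ⟨_, rfl⟩
  have hex := fun k : ℕ => exists_penalty_solution hc hB hs hw hb hM hG hcX
    (β := (k : ℝ) + 1) (by positivity)
  rw [← hKdef] at hex ⊢
  choose x hxX p hpn hxK hxf hxle using hex
  have hp1 : ∀ k, ‖(p k).1‖ ≤ K := fun k => (Real.le_sqrt_of_sq_le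
    (by nlinarith [sq_nonneg ‖(p k).2‖])).trans (hxK k)
  have hp2 : ∀ k, ‖(p k).2‖ ≤ K := fun k => (Real.le_sqrt_of_sq_le
    (by nlinarith [sq_nonneg ‖(p k).1‖])).trans (hxK k)
  obtain ⟨H, hH, hcomp⟩ := hX.exists_compact_epi
  have hcomp' := hcomp.prod ((isCompact_closedBall (0 : E l) K).prod
    (isCompact_closedBall (0 : E m) K))
  obtain ⟨⟨⟨xs, ts⟩, ps⟩, hmem, φ, hφ, hlim⟩ := hcomp'.tendsto_subseq
    (x := fun k => ((x k, P.h (x k)), p k)) (fun k => ⟨⟨hxX k, le_rfl,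
      (abs_le.1 (hH _ (hxX k))).2⟩, by simpa using hp1 k, by simpa using hp2 k⟩)
  have hq := (Prod.tendsto_iff _ _).1 hlim
  have hq1 := (Prod.tendsto_iff _ _).1 hq.1
  have hlx : Filter.Tendsto (fun k => x (φ k)) Filter.atTop (nhds xs) := hq1.1
  have hlt : Filter.Tendsto (fun k => P.h (x (φ k))) Filter.atTop (nhds ts) := hq1.2
  have hlp : Filter.Tendsto (fun k => p (φ k)) Filter.atTop (nhds ps) := hq.2
  have hnn : ∀ i, 0 ≤ ps.2 i := by
    intro i
    have hcont : Continuous fun q : Dual l m => q.2 i := by fun_prop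
    exact ge_of_tendsto' ((hcont.tendsto ps).comp hlp)
      fun k => hpn (φ k) i
  have hfeas : P.feas xs ≤ 0 := by
    have h1 := ((continuous_feas hc.f_diff).tendsto xs).comp hlx
    have h2 : Filter.Tendsto (fun k => K * (1 / ((φ k : ℝ) + 1))) Filter.atTop (nhds 0) := by
      have := ((tendsto_one_div_add_atTop_nhds_zero_nat (𝕜 := ℝ)).comp
        hφ.tendsto_atTop).const_mul K
      simpa using this
    exact le_of_tendsto_of_tendsto' h1 h2 fun k => hxf (φ k)
  have hfz : P.feas xs ^ 2 = 0 := by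
    have : P.feas xs = 0 := le_antisymm hfeas (P.feas_nonneg xs)
    rw [this]; norm_num
  rw [feas_sq] at hfz
  have hr0 : ‖P.res xs‖ ^ 2 = 0 := by
    have h1 := sq_nonneg ‖P.res xs‖
    have h2 := sq_nonneg ‖posVec (P.fvec xs)‖
    linarith
  have hf0 : ‖posVec (P.fvec xs)‖ ^ 2 = 0 := by linarith
  refine ⟨xs, ps, ⟨hmem.1.1, ?_, ?_, hnn, ?_⟩, ?_⟩
  · exact norm_eq_zero.1 (pow_eq_zero_iff two_ne_zero |>.1 hr0)
  · intro i
    have h1 : posVec (P.fvec xs) = 0 := norm_eq_zero.1 (pow_eq_zero_iff two_ne_zero |>.1 hf0)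
    have h2 : max (P.f i xs) 0 = 0 := congrFun (congrArg WithLp.ofLp h1) i
    exact (le_max_left _ _).trans h2.le
  · intro w hw'
    have h1 : Filter.Tendsto (fun k => (P.prox ρ c).g (x (φ k)) + P.h (x (φ k))
        + ρ / 2 * ‖w - x (φ k)‖ ^ 2) Filter.atTop
        (nhds ((P.prox ρ c).g xs + ts + ρ / 2 * ‖w - xs‖ ^ 2)) :=
      (((hgc.tendsto xs).comp hlx).add hlt).add
        (((tendsto_const_nhds.sub hlx).norm.pow 2).const_mul _)
    have h2 : Filter.Tendsto (fun k => (P.prox ρ c).obj w + P.pair (p (φ k)) w) Filter.atTop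
        (nhds ((P.prox ρ c).obj w + P.pair ps w)) := by
      exact (((continuous_pair_left w).tendsto ps).comp hlp).const_add _
    have h3 := le_of_tendsto_of_tendsto' h1 h2 fun k => hxle (φ k) w hw'
    have h4 : P.h xs ≤ ts := hmem.1.2.1
    have h5 : (P.prox ρ c).obj xs = (P.prox ρ c).g xs + P.h xs := rfl
    have h6 : (P.prox ρ c).pair ps w = P.pair ps w := rfl
    rw [h5, h6]
    linarith
  · have hcont : Continuous fun q : Dual l m => dnorm q := by unfold dnorm; fun_prop
    exact le_of_tendsto' ((hcont.tendsto ps).comp hlp) fun k => hxK (φ k)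

end Problem

end

section

variable {n l m : ℕ}

/-! ### Termination of iALM and PenMM -/

/-- The admissible parameters of the methods. -/
structure Params.Valid (r : Params) : Prop where
  β₀_pos : 0 < r.β₀
  σ_gt : 1 < r.σ
  ρ_pos : 0 < r.ρ
  γ₁_gt : 1 < r.γ₁
  γ₂_ge : 1 ≤ r.γ₂
  Lmin_ge : r.ρ ≤ r.Lmin

/-- The tolerance passed by iALM with tolerance `e` to AdapAPG. -/
def Params.tolAL (r : Params) (e : ℝ) : ℝ :=
  √((r.σ - 1) / (r.σ + 1)) * (e / 2) * min 1 √r.ρ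

/-- The scale factor `min {1, 1/√ρ}`. -/
def scale (ρ : ℝ) : ℝ := min 1 (1 / √ρ)

theorem scale_pos {ρ : ℝ} (hρ : 0 < ρ) : 0 < scale ρ := by
  unfold scale
  have := Real.sqrt_pos.2 hρ
  positivity

theorem scale_le_one (ρ : ℝ) : scale ρ ≤ 1 := min_le_left _ _

theorem min_one_sqrt_sq_div {ρ : ℝ} (hρ : 0 < ρ) : (min 1 √ρ) ^ 2 / ρ = scale ρ ^ 2 := by
  have h0 := Real.sqrt_pos.2 hρ
  unfold scale
  rcases le_total 1 √ρ with h | h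
  · rw [min_eq_left h, min_eq_right ((div_le_one h0).2 h), div_pow, Real.sq_sqrt hρ.le, one_pow]
  · rw [min_eq_right h, min_eq_left ((one_le_div h0).2 h), Real.sq_sqrt hρ.le, div_self hρ.ne',
      one_pow]

theorem Params.Valid.tolAL_pos {r : Params} (hr : r.Valid) {e : ℝ} (he : 0 < e) :
    0 < r.tolAL e := by
  have h1 := hr.σ_gt
  have h2 : 0 < √((r.σ - 1) / (r.σ + 1)) :=
    Real.sqrt_pos.2 (div_pos (by linarith) (by linarith))
  have h3 := Real.sqrt_pos.2 hr.ρ_pos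
  unfold tolAL
  positivity

theorem Params.Valid.tolAL_le {r : Params} (hr : r.Valid) {e : ℝ} (he : 0 < e) :
    r.tolAL e ≤ e / 2 := by
  have h1 := hr.σ_gt
  have h2 : √((r.σ - 1) / (r.σ + 1)) ≤ 1 := by
    rw [Real.sqrt_le_iff]
    exact ⟨zero_le_one, by rw [one_pow, div_le_one (by linarith)]; linarith⟩
  have h3 : min 1 √r.ρ ≤ 1 := min_le_left _ _
  have h4 : 0 ≤ min 1 √r.ρ := le_min zero_le_one (Real.sqrt_nonneg _)
  calc r.tolAL e ≤ 1 * (e / 2) * 1 := by unfold tolAL; gcongr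
    _ = e / 2 := by ring

/-- The error of one iALM step in the dual distance, written such that its sum over the geometric
sequence of penalty parameters telescopes. -/
theorem Params.Valid.tolAL_sq {r : Params} (hr : r.Valid) (e : ℝ) :
    r.tolAL e ^ 2 / (2 * r.ρ)
      = (r.σ - 1) * ((e ^ 2 * scale r.ρ ^ 2 / 8) / (r.σ + 1)) := by
  have h1 := hr.σ_gt
  have h2 : √((r.σ - 1) / (r.σ + 1)) ^ 2 = (r.σ - 1) / (r.σ + 1) :=
    Real.sq_sqrt (div_nonneg (by linarith) (by linarith))
  rw [← min_one_sqrt_sq_div hr.ρ_pos, tolAL, mul_pow, mul_pow, h2]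
  have h3 := hr.ρ_pos.ne'
  have h4 : r.σ + 1 ≠ 0 := by linarith
  field_simp
  ring

theorem norm_mul_le_of_sq_add_sq_le {K R a b d : ℝ} (hb : 0 ≤ b) (hd : d ≤ K + a)
    (h : a ^ 2 + b ^ 2 ≤ R) : d * b ≤ K ^ 2 / 2 + R := by
  nlinarith [mul_le_mul_of_nonneg_right hd hb, sq_nonneg (K - b), sq_nonneg (a - b),
    sq_nonneg a, sq_nonneg b]

variable {P : Problem n l m} {r : Params} {c : E n}

theorem dnorm_le_add (p q : Dual l m) : dnorm p ≤ dnorm q + ‖toL p - toL q‖ := by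
  rw [← norm_toL, ← norm_toL]
  have := norm_add_le (toL q) (toL p - toL q)
  rwa [add_sub_cancel] at this

open Classical in
/-- iALM terminates as soon as the penalty parameter exceeds a threshold `T`. The dual distances
stay bounded because the errors allowed in the primal steps are summable against the penalty
parameters. -/
theorem exists_mem_iALM (hr : r.Valid) (hQ : (P.prox r.ρ c).StronglyConvexProblem r.ρ)
    {xs : E n} {ps : Dual l m} (hs : (P.prox r.ρ c).IsSaddle r.ρ xs ps) {K e T τ : ℝ}
    (hK : dnorm ps ≤ K) (he : 0 < e) (hτ : τ = e ^ 2 * scale r.ρ ^ 2 / 8)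
    (hT : ∀ β, 0 < β → T ≤ β → 4 * K + 2 * √(β * τ) ≤ e * β ∧ 3 / 2 * K ^ 2 + β * τ ≤ e * β)
    {x₀ : E n} (hx₀ : x₀ ∈ P.dom) :
    ∃ o ∈ iALM P r e c x₀, (P.prox r.ρ c).IsKKT e o.x o.p ∧ r.β₀ ≤ o.β ∧
      ∃ q : Dual l m, (∀ i, 0 ≤ q.2 i) ∧ o.p = P.multUpdate o.β q o.x ∧
        dnorm q + dnorm o.p ≤ e * o.β ∧
        IsStationary P.dom P.h ((P.prox r.ρ c).augLag o.β q) (r.tolAL e) o.x ∧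
        ((o.β = r.β₀ ∧ q = 0) ∨ r.β₀ < T ∧ o.β ≤ r.σ * T) ∧
        ‖toL q - toL ps‖ ^ 2 ≤ K ^ 2 + o.β * τ ∧
        ‖toL o.p - toL ps‖ ^ 2 + ‖toL o.p - toL q‖ ^ 2 ≤ K ^ 2 + o.β * τ := by
  have hσ := hr.σ_gt
  have hσ0 : 0 < r.σ := by linarith
  have hK0 : 0 ≤ K := (dnorm_nonneg _).trans hK
  have hτ0 : 0 ≤ τ := by rw [hτ]; positivity
  set κ := τ / (r.σ + 1) with hκ
  have hκ0 : 0 ≤ κ := by positivity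
  have hκτ : r.σ * κ ≤ τ := by
    rw [hκ, mul_div_assoc', div_le_iff₀ (by linarith)]
    nlinarith
  obtain ⟨N, hN⟩ := pow_unbounded_of_one_lt (T / r.β₀) hσ
  refine exists_mem_fix _ (fun k (s : ALState n l m) => s.x ∈ P.dom ∧ (∀ i, 0 ≤ s.p.2 i) ∧
    r.β₀ ≤ s.β ∧ ((s.β = r.β₀ ∧ s.p = 0) ∨ r.β₀ < T ∧ s.β ≤ r.σ * T) ∧
    ‖toL s.p - toL ps‖ ^ 2 ≤ K ^ 2 + (s.β - r.β₀) * κ ∧ T ≤ r.σ ^ k * s.β) _ ?_ N ⟨r.β₀, x₀, 0⟩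
    ⟨hx₀, fun _ => le_rfl, le_rfl, Or.inl ⟨rfl, rfl⟩, ?_, ?_⟩
  · rintro k s ⟨hx, hp, hβ₀, hor, hdist, hfuel⟩
    have hβ : 0 < s.β := hr.β₀_pos.trans_le hβ₀
    obtain ⟨x', hx'mem, hx'X, hst⟩ := exists_mem_adapAPG hQ.dom
      (Problem.smoothStronglyConvex_augLag hQ hβ s.p) hr.ρ_pos (hr.tolAL_pos he) hr.Lmin_ge
      hr.γ₁_gt hr.γ₂_ge hx
    set p' := P.multUpdate s.β s.p x' with hp'
    have hstar : ‖toL p' - toL ps‖ ^ 2 + ‖toL p' - toL s.p‖ ^ 2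
        ≤ K ^ 2 + (r.σ * s.β - r.β₀) * κ := by
      have h1 := Problem.multUpdate_dist_le hQ hr.ρ_pos hβ hst hs
      rw [hr.tolAL_sq, ← hτ, ← hκ] at h1
      have h2 : s.β * ((r.σ - 1) * κ) + (s.β - r.β₀) * κ = (r.σ * s.β - r.β₀) * κ := by ring
      have h3 : ‖toL p' - toL ps‖ ^ 2 + ‖toL p' - toL s.p‖ ^ 2
        ≤ ‖toL s.p - toL ps‖ ^ 2 + s.β * ((r.σ - 1) * κ) := h1
      linarith
    have hb1 : ‖toL p' - toL ps‖ ^ 2 + ‖toL p' - toL s.p‖ ^ 2 ≤ K ^ 2 + s.β * τ := by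
      refine hstar.trans ?_
      have : 0 ≤ r.β₀ * κ := mul_nonneg hr.β₀_pos.le hκ0
      nlinarith [mul_le_mul_of_nonneg_left hκτ hβ.le]
    have hb2 : ‖toL s.p - toL ps‖ ^ 2 ≤ K ^ 2 + s.β * τ := by
      refine hdist.trans ?_
      have h1 : 0 ≤ r.β₀ * κ := mul_nonneg hr.β₀_pos.le hκ0
      have h2 : κ ≤ τ := le_trans (by nlinarith) hκτ
      nlinarith [mul_le_mul_of_nonneg_left h2 hβ.le]
    have hcompl : ∑ i, |p'.2 i * P.f i x'| ≤ (3 / 2 * K ^ 2 + s.β * τ) / s.β := by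
      refine (Problem.compl_le hβ).trans ?_
      rw [dnorm_sub]
      gcongr
      have := norm_mul_le_of_sq_add_sq_le (norm_nonneg _)
        ((dnorm_le_add p' ps).trans (add_le_add_left hK _)) hb1
      linarith
    have hnorm : ∀ q : Dual l m, ‖toL q - toL ps‖ ^ 2 ≤ K ^ 2 + s.β * τ →
        dnorm q ≤ 2 * K + √(s.β * τ) := by
      intro q hq
      have h1 : ‖toL q - toL ps‖ ≤ K + √(s.β * τ) := by
        refine le_of_sq_le_sq (hq.trans ?_) (by positivity)
        have := Real.sq_sqrt (mul_nonneg hβ.le hτ0)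
        nlinarith [Real.sqrt_nonneg (s.β * τ)]
      linarith [dnorm_le_add q ps]
    have hdone : T ≤ s.β →
        max ((dnorm s.p + dnorm p') / s.β) (∑ i, |p'.2 i * P.f i x'|) ≤ e := by
      intro hTs
      obtain ⟨h1, h2⟩ := hT s.β hβ hTs
      refine max_le ?_ (hcompl.trans ?_)
      · rw [div_le_iff₀ hβ]
        have h3 := hnorm s.p hb2
        have h4 := hnorm p' (by nlinarith [sq_nonneg ‖toL p' - toL s.p‖])
        linarith
      · rw [div_le_iff₀ hβ]
        linarith
    by_cases hcond : max ((dnorm s.p + dnorm p') / s.β) (∑ i, |p'.2 i * P.f i x'|) ≤ e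
    · refine Or.inl ⟨⟨s.β, x', p'⟩, ?_, ?_, hβ₀, s.p, hp, rfl, ?_, hst, hor, hb2, hb1⟩
      · simp only [Part.bind_eq_bind, Part.mem_bind_iff]
        exact ⟨x', hx'mem, by rw [if_pos hcond]; simp [hp']⟩
      · obtain ⟨h1, h2⟩ := max_le_iff.1 hcond
        refine Problem.isKKT_of_stationary hQ hβ hp hst ((hr.tolAL_le he).trans (by linarith))
          (le_trans ?_ h1) h2
        gcongr
        have h3 : dnorm (p' - s.p) ≤ dnorm p' + dnorm s.p := by
          rw [dnorm_sub, ← norm_toL, ← norm_toL]; exact norm_sub_le _ _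
        have h4 : dnorm ((P.prox r.ρ c).multUpdate s.β s.p x' - s.p) = dnorm (p' - s.p) := rfl
        linarith
      · have h1 := (max_le_iff.1 hcond).1
        rw [div_le_iff₀ hβ] at h1
        exact h1
    · refine Or.inr ⟨⟨r.σ * s.β, x', p'⟩, ?_, ?_⟩
      · simp only [Part.bind_eq_bind, Part.mem_bind_iff]
        exact ⟨x', hx'mem, by rw [if_neg hcond]; simp [hp']⟩
      · have hlt : s.β < T := not_le.1 fun h => hcond (hdone h)
        rcases k with _ | k
        · exact absurd hfuel (by simpa using hlt)
        · refine ⟨k, Nat.lt_succ_self k, hx'X, P.multUpdate_snd_nonneg _ _ _, ?_,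
            Or.inr ⟨by linarith, ?_⟩, ?_, ?_⟩
          · change r.β₀ ≤ r.σ * s.β
            nlinarith
          · exact mul_le_mul_of_nonneg_left hlt.le hσ0.le
          · change ‖toL p' - toL ps‖ ^ 2 ≤ K ^ 2 + (r.σ * s.β - r.β₀) * κ
            nlinarith [sq_nonneg ‖toL p' - toL s.p‖]
          · calc T ≤ r.σ ^ (k + 1) * s.β := hfuel
              _ = r.σ ^ k * (r.σ * s.β) := by ring
  · have : toL (0 : Dual l m) = 0 := rfl
    rw [this, zero_sub, norm_neg, norm_toL, sub_self, zero_mul, add_zero]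
    have := dnorm_nonneg ps
    gcongr
  · rw [div_lt_iff₀ hr.β₀_pos] at hN
    exact hN.le

open Classical in
/-- PenMM terminates as soon as the penalty parameter exceeds a threshold `T`. -/
theorem exists_mem_penMM (hr : r.Valid) (hQ : (P.prox r.ρ c).StronglyConvexProblem r.ρ)
    {xs : E n} {ps : Dual l m} (hs : (P.prox r.ρ c).IsSaddle r.ρ xs ps) {K e T βb : ℝ}
    {pb : Dual l m} (hK : dnorm ps ≤ K) (he : 0 < e) (hβb : 0 < βb) (hpb : ∀ i, 0 ≤ pb.2 i)
    (hT : ∀ β, βb ≤ β → T ≤ β →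
      K ^ 2 / 2 + ((K + dnorm pb) ^ 2 + β * (e ^ 2 * scale r.ρ ^ 2 / 2)) ≤ e * β ∧
      (K + dnorm pb) ^ 2 + β * (e ^ 2 * scale r.ρ ^ 2 / 2) ≤ (e * β) ^ 2)
    (hc : c ∈ P.dom) :
    ∃ o ∈ penMM P r e βb c pb, (P.prox r.ρ c).IsKKT e o.x o.p ∧ βb ≤ o.β ∧
      (o.β = βb ∨ βb < T ∧ o.β ≤ r.σ * T) ∧
      (o.x = c ∨ IsStationary P.dom P.h ((P.prox r.ρ c).augLag o.β pb) (e * min 1 √r.ρ) o.x ∧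
        P.feas o.x ^ 2 * o.β ^ 2
          ≤ (K + dnorm pb) ^ 2 + o.β * (e ^ 2 * scale r.ρ ^ 2 / 2)) := by
  have hσ := hr.σ_gt
  have hσ0 : 0 < r.σ := by linarith
  have hm0 : 0 < min 1 √r.ρ := lt_min one_pos (Real.sqrt_pos.2 hr.ρ_pos)
  have hδ0 : 0 < e * min 1 √r.ρ := mul_pos he hm0
  have hδe : e * min 1 √r.ρ ≤ e := mul_le_of_le_one_right he.le (min_le_left _ _)
  have hδ : (e * min 1 √r.ρ) ^ 2 / (2 * r.ρ) = e ^ 2 * scale r.ρ ^ 2 / 2 := by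
    rw [← min_one_sqrt_sq_div hr.ρ_pos]
    have := hr.ρ_pos.ne'
    field_simp
  have hstar : ∀ {β : ℝ} {x : E n}, 0 < β →
      IsStationary P.dom P.h ((P.prox r.ρ c).augLag β pb) (e * min 1 √r.ρ) x →
      ‖toL (P.multUpdate β pb x) - toL ps‖ ^ 2 + ‖toL (P.multUpdate β pb x) - toL pb‖ ^ 2
        ≤ (K + dnorm pb) ^ 2 + β * (e ^ 2 * scale r.ρ ^ 2 / 2) := by
    intro β x hβ hx
    have h1 := Problem.multUpdate_dist_le hQ hr.ρ_pos hβ hx hs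
    rw [hδ] at h1
    have h2 : ‖toL pb - toL ps‖ ^ 2 ≤ (K + dnorm pb) ^ 2 := by
      have h3 := norm_sub_le (toL pb) (toL ps)
      rw [norm_toL, norm_toL] at h3
      have : ‖toL pb - toL ps‖ ≤ K + dnorm pb := by linarith
      gcongr
    exact le_trans h1 (by linarith)
  have hkkt : ∀ {β : ℝ} {x : E n}, βb ≤ β → T ≤ β →
      IsStationary P.dom P.h ((P.prox r.ρ c).augLag β pb) (e * min 1 √r.ρ) x →
      (P.prox r.ρ c).IsKKT e x (P.multUpdate β pb x) := by
    intro β x hβ hTβ hx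
    have hβ0 := hβb.trans_le hβ
    obtain ⟨h1, h2⟩ := hT β hβ hTβ
    have h3 := hstar hβ0 hx
    refine Problem.isKKT_of_stationary hQ hβ0 hpb hx hδe ?_ ?_
    · rw [div_le_iff₀ hβ0, dnorm_sub]
      refine le_of_sq_le_sq (le_trans ?_ h2) (by positivity)
      exact le_trans (le_add_of_nonneg_left (sq_nonneg _)) h3
    · refine (Problem.compl_le hβ0).trans ?_
      rw [div_le_iff₀ hβ0, dnorm_sub]
      exact (norm_mul_le_of_sq_add_sq_le (norm_nonneg _)
        ((dnorm_le_add _ ps).trans (add_le_add_left hK _)) h3).trans h1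
  obtain ⟨N, hN⟩ := pow_unbounded_of_one_lt (T / βb) hσ
  refine exists_mem_fix _ (fun k (s : ALState n l m × ℝ) =>
    (s.1.x = c ∧ s.1.β = βb ∧ s.2 = βb ∧ ∃ k', k = k' + 1 ∧ T ≤ r.σ ^ k' * βb) ∨
    (s.1.x ∈ P.dom ∧ s.1.β = r.σ * s.2 ∧ βb ≤ s.2 ∧ (s.2 = βb ∨ βb < T ∧ s.2 ≤ r.σ * T) ∧
      IsStationary P.dom P.h ((P.prox r.ρ c).augLag s.2 pb) (e * min 1 √r.ρ) s.1.x ∧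
      s.1.p = P.multUpdate s.2 pb s.1.x ∧ T ≤ r.σ ^ k * s.2)) _ ?_ (N + 1) (⟨βb, c, pb⟩, βb)
    (Or.inl ⟨rfl, rfl, rfl, N, rfl, ?_⟩)
  · rintro k s hJ
    by_cases hcond : (P.prox r.ρ c).IsKKT e s.1.x s.1.p
    · refine Or.inl ⟨⟨s.2, s.1.x, s.1.p⟩, ?_, hcond, ?_⟩
      · simp only [if_pos hcond]; simp
      · rcases hJ with ⟨h1, h2, h3, -⟩ | ⟨h1, h2, h3, h4, h5, h6, -⟩
        · exact ⟨h3.ge, Or.inl h3, Or.inl h1⟩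
        · refine ⟨h3, h4, Or.inr ⟨h5, ?_⟩⟩
          have hβ0 := hβb.trans_le h3
          have h7 := Problem.feas_le (P := P) (x := s.1.x) hβ0 hpb
          rw [le_div_iff₀ hβ0, dnorm_sub] at h7
          calc P.feas s.1.x ^ 2 * s.2 ^ 2 = (P.feas s.1.x * s.2) ^ 2 := by ring
            _ ≤ ‖toL (P.multUpdate s.2 pb s.1.x) - toL pb‖ ^ 2 := by
              have := mul_nonneg (P.feas_nonneg s.1.x) hβ0.le
              gcongr
            _ ≤ _ := le_trans (le_add_of_nonneg_left (sq_nonneg _)) (hstar hβ0 h5)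
    · have hxX : s.1.x ∈ P.dom := by
        rcases hJ with h | h
        · rw [h.1]; exact hc
        · exact h.1
      have hβ : 0 < s.1.β := by
        rcases hJ with h | h
        · rw [h.2.1]; exact hβb
        · rw [h.2.1]; exact mul_pos hσ0 (hβb.trans_le h.2.2.1)
      obtain ⟨x', hx'mem, hx'X, hst⟩ := exists_mem_adapAPG hQ.dom
        (Problem.smoothStronglyConvex_augLag hQ hβ pb) hr.ρ_pos hδ0 hr.Lmin_ge
        hr.γ₁_gt hr.γ₂_ge hxX
      refine Or.inr ⟨(⟨r.σ * s.1.β, x', P.multUpdate s.1.β pb x'⟩, s.1.β), ?_, ?_⟩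
      · simp only [if_neg hcond, Part.bind_eq_bind, Part.mem_bind_iff]
        exact ⟨x', hx'mem, by simp⟩
      · rcases hJ with ⟨h1, h2, h3, k', hk, hfuel⟩ | ⟨h1, h2, h3, h4, h5, h6, hfuel⟩
        · refine ⟨k', by omega, Or.inr ⟨hx'X, rfl, h2.ge, Or.inl h2, hst, rfl, ?_⟩⟩
          rw [h2]; exact hfuel
        · have hlt : s.2 < T := by
            by_contra! hge
            apply hcond
            rw [h6]
            exact hkkt h3 hge h5
          rcases k with _ | k
          · exact absurd hfuel (by simpa using hlt)
          · refine ⟨k, Nat.lt_succ_self k, Or.inr ⟨hx'X, rfl, ?_, Or.inr ⟨by linarith, ?_⟩, hst,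
              rfl, ?_⟩⟩
            · change βb ≤ s.1.β
              rw [h2]
              nlinarith
            · change s.1.β ≤ r.σ * T
              rw [h2]
              exact mul_le_mul_of_nonneg_left hlt.le hσ0.le
            · change T ≤ r.σ ^ k * s.1.β
              calc T ≤ r.σ ^ (k + 1) * s.2 := hfuel
                _ = r.σ ^ k * s.1.β := by rw [h2]; ring
  · rw [div_lt_iff₀ hβb] at hN
    exact hN.le

end

section

variable {n l m : ℕ}

/-! ### Numerical estimates for the constants -/

/-- The maximum `W` in the definition of `M̂`, and the lower bounds for it. -/
theorem Mhat_ge {σ K : ℝ} (hσ : 1 < σ) (hK : 0 ≤ K) :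
    ∃ W, Mhat σ K = 2 * K + √σ * W ∧ 5 / 4 * K ^ 2 ≤ W ^ 2 ∧ K ≤ W ^ 2 ∧ √2 / 4 ≤ W ∧
      2 * K + W ≤ Mhat σ K := by
  have h2 : √2 ^ 2 = 2 := Real.sq_sqrt (by norm_num)
  have h2' : 0 < √2 := Real.sqrt_pos.2 (by norm_num)
  obtain ⟨W, hW⟩ : ∃ W, W = max (√5 / 2 * K) (max (√K) (1 / (2 * √2))) := ⟨_, rfl⟩
  have hW3 : √2 / 4 ≤ W := by
    have : √2 / 4 = 1 / (2 * √2) := by field_simp; linarith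
    rw [this, hW]
    exact (le_max_right _ _).trans (le_max_right _ _)
  have hW0 : 0 < W := by linarith
  have hσ1 : 1 ≤ √σ := Real.one_le_sqrt.2 hσ.le
  refine ⟨W, by rw [Mhat, hW], ?_, ?_, hW3, ?_⟩
  · have h : √5 / 2 * K ≤ W := hW ▸ le_max_left _ _
    have h5 : √5 ^ 2 = 5 := Real.sq_sqrt (by norm_num)
    calc 5 / 4 * K ^ 2 = (√5 / 2 * K) ^ 2 := by rw [mul_pow, div_pow, h5]; ring
      _ ≤ W ^ 2 := by gcongr
  · have h : √K ≤ W := hW ▸ (le_max_left _ _).trans (le_max_right _ _)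
    exact (Real.sqrt_le_left hW0.le).1 h
  · rw [Mhat, ← hW]
    nlinarith

/-- The relations between `K = M_p`, `M̂` and `Ĉ` that the complexity analysis uses; `s` is the
scale factor `min {1, 1/√ρ}`. The number `√2/4` is the last entry `1/(2√2)` of the maximum in `M̂`. -/
structure ConstRel (K Mh C s : ℝ) : Prop where
  K_nonneg : 0 ≤ K
  s_pos : 0 < s
  s_le : s ≤ 1
  Mh_ge : 2 * K + √2 / 4 ≤ Mh
  C_ge : 4 ≤ C
  C_ge_sq : 16 * √2 * (3 * K ^ 2 + 2 * Mh ^ 2) ≤ C * s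
  C_ge_lin : 16 * √2 * (K + Mh) ≤ C * s
  C_le : C * s ≤ 64 * Mh ^ 2

theorem constRel {σ ρ K : ℝ} (hσ : 1 < σ) (hρ : 0 < ρ) (hK : 0 ≤ K) :
    ConstRel K (Mhat σ K) (Chat ρ σ K) (scale ρ) := by
  have h2 : √2 ^ 2 = 2 := Real.sq_sqrt (by norm_num)
  have h2' : 0 < √2 := Real.sqrt_pos.2 (by norm_num)
  obtain ⟨W, -, -, -, hW, hMh⟩ := Mhat_ge hσ hK
  have hs := scale_pos hρ
  have hs1 := scale_le_one ρ
  have hMh' : 2 * K + √2 / 4 ≤ Mhat σ K := by linarith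
  have hC : Chat ρ σ K = max (16 * √2 * (3 * K ^ 2 + 2 * Mhat σ K ^ 2) / scale ρ)
    (max (16 * √2 * (K + Mhat σ K) / scale ρ) 4) := rfl
  refine ⟨hK, hs, hs1, hMh', ?_, ?_, ?_, ?_⟩
  · rw [hC]; exact (le_max_right _ _).trans (le_max_right _ _)
  · rw [← div_le_iff₀ hs, hC]; exact le_max_left _ _
  · rw [← div_le_iff₀ hs, hC]; exact (le_max_left _ _).trans (le_max_right _ _)
  · generalize Mhat σ K = Mh at *
    have hsq : √2 ≤ 1.4143 := by
      rw [Real.sqrt_le_left (by norm_num)]; norm_num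
    have hKsq : K ^ 2 ≤ Mh ^ 2 / 4 := by nlinarith
    rw [← le_div_iff₀ hs, hC]
    refine max_le (div_le_div_of_nonneg_right ?_ hs.le)
      (max_le (div_le_div_of_nonneg_right ?_ hs.le) ?_)
    · calc 16 * √2 * (3 * K ^ 2 + 2 * Mh ^ 2)
          ≤ 16 * 1.4143 * (3 * (Mh ^ 2 / 4) + 2 * Mh ^ 2) := by gcongr
        _ ≤ 64 * Mh ^ 2 := by nlinarith [sq_nonneg Mh]
    · nlinarith
    rw [le_div_iff₀ hs]
    nlinarith

namespace ConstRel

variable {K Mh C s ε β : ℝ}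

theorem Mh_pos (h : ConstRel K Mh C s) : 0 < Mh := by
  have h2' : 0 < √2 := Real.sqrt_pos.2 (by norm_num)
  linarith [h.Mh_ge, h.K_nonneg]

/-- The bounds on `t = ε β s`, for penalty parameters `β ≥ Ĉ/ε`, that enter the stopping tests of
PenMM. -/
theorem ge_of_ge (h : ConstRel K Mh C s) (hβ : C ≤ ε * β) :
    22 * (3 * K ^ 2 + 2 * Mh ^ 2) ≤ ε * β * s ∧ 16 * √2 * (K + Mh) ≤ ε * β * s ∧
      8 ≤ ε * β * s := by
  have hs := h.s_pos
  have h0 : C * s ≤ ε * β * s := by gcongr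
  have h2 : √2 ^ 2 = 2 := Real.sq_sqrt (by norm_num)
  have h2' : 0 < √2 := Real.sqrt_pos.2 (by norm_num)
  have hsq : 1.4 ≤ √2 := Real.le_sqrt_of_sq_le (by norm_num)
  have h3 := h.C_ge_lin.trans h0
  refine ⟨?_, h3, ?_⟩
  · refine le_trans ?_ (h.C_ge_sq.trans h0)
    gcongr
    linarith
  · have := h.Mh_ge
    have := h.K_nonneg
    nlinarith

/-- The stopping tests of PenMM hold for penalty parameters `β ≥ Ĉ/ε` if the estimated multiplier
is bounded by `M̂`. -/
theorem penMM_test (h : ConstRel K Mh C s) (hε : 0 < ε) (hε' : ε ≤ 1 / 2) (hβ : 0 < β)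
    (hC : C ≤ ε * β) {e P : ℝ} (he : e = ε / (2 * √2) * s / 2) (hP0 : 0 ≤ P) (hP : P ≤ Mh) :
    K ^ 2 / 2 + ((K + P) ^ 2 + β * (e ^ 2 * s ^ 2 / 2)) ≤ e * β ∧
      (K + P) ^ 2 + β * (e ^ 2 * s ^ 2 / 2) ≤ (e * β) ^ 2 := by
  have h2 : √2 ^ 2 = 2 := Real.sq_sqrt (by norm_num)
  have h2' : 0 < √2 := Real.sqrt_pos.2 (by norm_num)
  have hsq : √2 ≤ 1.5 := by
    rw [Real.sqrt_le_left (by norm_num)]; norm_num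
  obtain ⟨h3, h4, h5⟩ := h.ge_of_ge hC
  have hs := h.s_pos
  have hs1 := h.s_le
  have hK := h.K_nonneg
  obtain ⟨t, ht⟩ : ∃ t, t = ε * β * s := ⟨_, rfl⟩
  rw [← ht] at h3 h4 h5
  have e1 : e * β = t * √2 / 8 := by
    rw [he, ht]; field_simp; rw [h2]; ring
  have e2 : β * (e ^ 2 * s ^ 2 / 2) ≤ t / 128 := by
    have : β * (e ^ 2 * s ^ 2 / 2) = t * (ε * s ^ 3) / 64 := by
      rw [he, ht]; field_simp; rw [h2]; ring
    rw [this]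
    have : ε * s ^ 3 ≤ 1 / 2 * 1 := by
      gcongr
      exact pow_le_one₀ hs.le hs1
    nlinarith
  have e3 : (K + P) ^ 2 ≤ (K + Mh) ^ 2 := by gcongr
  have e4 : (t * √2 / 8) ^ 2 = t ^ 2 / 32 := by rw [div_pow, mul_pow, h2]; ring
  have hsq' : 1.4 ≤ √2 := Real.le_sqrt_of_sq_le (by norm_num)
  have e5 : t * 1.4 / 8 ≤ t * √2 / 8 := by gcongr
  rw [e1]
  constructor
  · nlinarith [sq_nonneg (K - Mh), h.Mh_pos, h.Mh_ge, sq_nonneg K]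
  · rw [e4]
    have h6 : (16 * √2 * (K + Mh)) ^ 2 ≤ t ^ 2 := by
      have := h.Mh_pos
      gcongr
    rw [mul_pow, mul_pow, h2] at h6
    nlinarith

theorem sq_le_C (h : ConstRel K Mh C s) {W : ℝ} (hW : 0 < W) (hWM : W ≤ Mh) :
    16 * W ^ 2 ≤ C := by
  have h1 : W ^ 2 ≤ Mh ^ 2 := by gcongr
  have h2 := h.C_ge_sq
  have hsq : 1 ≤ √2 := Real.one_le_sqrt.2 (by norm_num)
  have h3 : C * s ≤ C := mul_le_of_le_one_right (by linarith [h.C_ge]) h.s_le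
  have h4 : 16 * 1 * (2 * W ^ 2) ≤ 16 * √2 * (3 * K ^ 2 + 2 * Mh ^ 2) := by
    gcongr
    nlinarith [sq_nonneg K]
  nlinarith [sq_nonneg W]

theorem Mh_le_C (h : ConstRel K Mh C s) : Mh ≤ C := by
  have h1 := h.C_ge_lin
  have h2 : C * s ≤ C := mul_le_of_le_one_right (by linarith [h.C_ge]) h.s_le
  have hsq : 1 ≤ √2 := Real.one_le_sqrt.2 (by norm_num)
  have h3 : 16 * 1 * (0 + Mh) ≤ 16 * √2 * (K + Mh) := by
    have := h.Mh_pos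
    have := h.K_nonneg
    gcongr
  linarith [h.Mh_pos]

/-- The bound for the product of `β` and the augmented penalty terms when `β ≥ Ĉ/ε`. -/
theorem residual_le (h : ConstRel K Mh C s) (hε : 0 < ε) (hε' : ε ≤ 1 / 2) (hβ : 0 < β)
    (hC : C ≤ ε * β) :
    4 * K ^ 2 + 5 * β * ε ^ 2 * s ^ 2 / 64 ≤ β * (ε * Mh / 4) := by
  have hs := h.s_pos
  have hsq : 1.4 ≤ √2 := Real.le_sqrt_of_sq_le (by norm_num)
  have hK := h.K_nonneg
  have hεb : ε * β * s ≤ ε * β := mul_le_of_le_one_right (by positivity) h.s_le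
  obtain ⟨-, h2, -⟩ := h.ge_of_ge hC
  have e1 : β * ε ^ 2 * s ^ 2 ≤ β * ε * (1 / 2) := by
    calc β * ε ^ 2 * s ^ 2 = β * ε * (ε * s ^ 2) := by ring
      _ ≤ β * ε * (1 / 2 * 1) := by
        gcongr
        exact pow_le_one₀ hs.le h.s_le
      _ = _ := by ring
  have e2 : 7 / 20 ≤ Mh := by linarith [h.Mh_ge]
  have e5 : 2 * K ≤ Mh := by linarith [h.Mh_ge]
  have e3 : 22 * K ≤ ε * β := by
    have : 16 * 1.4 * (K + 0) ≤ 16 * √2 * (K + Mh) := by gcongr; linarith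
    linarith
  have e4 : 4 * K ^ 2 ≤ ε * β * (2 * K / 11) := by
    calc 4 * K ^ 2 = 22 * K * (2 * K / 11) := by ring
      _ ≤ _ := by gcongr
  have e6 : ε * β * (2 * K / 11) ≤ ε * β * (Mh / 11) := by gcongr
  have e7 : ε * β * (7 / 20) ≤ ε * β * Mh := by gcongr
  linarith

/-- The stopping tests of PenMM hold for `β ≥ Ĉ/ε` if the estimated multiplier comes from a first
step of iALM with penalty parameter `β`. -/
theorem penMM_test_of_first_step (h : ConstRel K Mh C s) (hε : 0 < ε) (hε' : ε ≤ 1 / 2)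
    (hβ : 0 < β) (hC : C ≤ ε * β) {e P : ℝ} (he : e = ε / (2 * √2) * s / 2)
    (hP : (K + P) ^ 2 + β * (e ^ 2 * s ^ 2 / 2) ≤ 4 * K ^ 2 + 5 * β * ε ^ 2 * s ^ 2 / 64) :
    K ^ 2 / 2 + ((K + P) ^ 2 + β * (e ^ 2 * s ^ 2 / 2)) ≤ e * β ∧
      (K + P) ^ 2 + β * (e ^ 2 * s ^ 2 / 2) ≤ (e * β) ^ 2 := by
  have h2 : √2 ^ 2 = 2 := Real.sq_sqrt (by norm_num)
  have h2' : 0 < √2 := Real.sqrt_pos.2 (by norm_num)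
  have hsq : 1.4 ≤ √2 := Real.le_sqrt_of_sq_le (by norm_num)
  obtain ⟨h3, -, h5⟩ := h.ge_of_ge hC
  have hs := h.s_pos
  have hK := h.K_nonneg
  have hM2 : 4 * K ^ 2 ≤ Mh ^ 2 := by
    calc 4 * K ^ 2 = (2 * K) ^ 2 := by ring
      _ ≤ Mh ^ 2 := by gcongr; linarith [h.Mh_ge]
  obtain ⟨t, ht⟩ : ∃ t, t = ε * β * s := ⟨_, rfl⟩
  rw [← ht] at h3 h5
  have e1 : e * β = t * √2 / 8 := by
    rw [he, ht]; field_simp; rw [h2]; ring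
  have e2 : 5 * β * ε ^ 2 * s ^ 2 / 64 ≤ 5 * t / 128 := by
    have : 5 * β * ε ^ 2 * s ^ 2 / 64 = t * (ε * s) * (5 / 64) := by rw [ht]; ring
    rw [this]
    have h6 : t * (ε * s) ≤ t * (1 / 2 * 1) := by
      gcongr
      exact h.s_le
    linarith
  have e4 : (t * √2 / 8) ^ 2 = t ^ 2 / 32 := by rw [div_pow, mul_pow, h2]; ring
  have e5 : t * 1.4 / 8 ≤ t * √2 / 8 := by gcongr
  have e6 : 200 * K ^ 2 ≤ t := by linarith
  rw [e1]
  constructor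
  · linarith
  · rw [e4]
    nlinarith

end ConstRel

/-- The stopping tests of iALM hold for penalty parameters `β ≥ 8 W² / e`. -/
theorem iALM_test {K W s e β : ℝ} (h1 : 5 / 4 * K ^ 2 ≤ W ^ 2) (h2 : K ≤ W ^ 2)
    (h3 : √2 / 4 ≤ W) (hs : 0 < s) (hs1 : s ≤ 1) (he : 0 < e) (he' : e ≤ 1 / 4) (hβ : 0 < β)
    (h : 8 * W ^ 2 / e ≤ β) :
    4 * K + 2 * √(β * (e ^ 2 * s ^ 2 / 8)) ≤ e * β ∧
      3 / 2 * K ^ 2 + β * (e ^ 2 * s ^ 2 / 8) ≤ e * β := by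
  have hsq : √2 ^ 2 = 2 := Real.sq_sqrt (by norm_num)
  have hW : 1 / 8 ≤ W ^ 2 := by
    calc 1 / 8 = (√2 / 4) ^ 2 := by rw [div_pow, hsq]; norm_num
      _ ≤ W ^ 2 := by gcongr
  rw [div_le_iff₀ he, mul_comm β e] at h
  have h4 : β * (e ^ 2 * s ^ 2 / 8) ≤ e * β / 32 := by
    calc β * (e ^ 2 * s ^ 2 / 8) = e * β * (e * s ^ 2) / 8 := by ring
      _ ≤ e * β * (1 / 4 * 1) / 8 := by
        gcongr
        exact pow_le_one₀ hs.le hs1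
      _ = e * β / 32 := by ring
  have h5 : √(β * (e ^ 2 * s ^ 2 / 8)) ≤ e * β / 4 := by
    rw [Real.sqrt_le_left (by positivity)]
    nlinarith
  constructor <;> nlinarith

end

section

variable {n l m : ℕ}

/-! ### Guarantees for the calls of iALM and PenMM -/

variable {P : Problem n l m} {r : Params}

/-- The objective along an iALM step. The term `dnorm q ^ 2 / (4 β)` bounds the negative part of
the multiplier term at the new point. -/
theorem descent_of_iALM {c x : E n} {β δ ε : ℝ} {q : Dual l m}
    (hQ : (P.prox r.ρ c).StronglyConvexProblem r.ρ) (hβ : 0 < β) (hc : c ∈ P.dom)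
    (hst : IsStationary P.dom P.h ((P.prox r.ρ c).augLag β q) δ x) (hδ : δ ≤ ε / 4) :
    P.obj x + 3 / 2 * r.ρ * ‖x - c‖ ^ 2 ≤ P.obj c + ε / 4 * ‖x - c‖
      + dnorm (P.multUpdate β q x) * P.feas c + dnorm q ^ 2 / (4 * β) := by
  have h1 := Problem.obj_add_pair_le hQ hβ hst hc
  rw [Problem.obj_prox, Problem.obj_prox, sub_self, norm_zero] at h1
  have h2 : P.pair (P.multUpdate β q x) c ≤ _ :=
    Problem.pair_le_dnorm_mul_feas (P.multUpdate_snd_nonneg β q x) c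
  have h3 := Problem.neg_pair_multUpdate_le (P := P) (p := q) (x := x) hβ
  have h4 := mul_le_mul_of_nonneg_right hδ (norm_nonneg (c - x))
  have h5 : P.obj x + r.ρ * ‖x - c‖ ^ 2 + P.pair (P.multUpdate β q x) x
    + r.ρ / 2 * ‖c - x‖ ^ 2 - δ * ‖c - x‖
      ≤ P.obj c + r.ρ * 0 ^ 2 + P.pair (P.multUpdate β q x) c := h1
  rw [norm_sub_rev c x] at h4 h5
  linarith

theorem descent_of_penMM {c x : E n} {β δ ε : ℝ} {q : Dual l m}
    (hQ : (P.prox r.ρ c).StronglyConvexProblem r.ρ) (hβ : 0 < β) (hc : c ∈ P.dom)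
    (hst : IsStationary P.dom P.h ((P.prox r.ρ c).augLag β q) δ x) (hδ : δ ≤ ε / 5) :
    P.obj x + P.augPen β q x + 3 / 2 * r.ρ * ‖x - c‖ ^ 2
      ≤ P.obj c + P.augPen β q c + ε / 5 * ‖x - c‖ := by
  have h1 := Problem.obj_add_augPen_le hQ hβ hst hc
  rw [Problem.obj_prox, Problem.obj_prox, sub_self, norm_zero] at h1
  have h4 := mul_le_mul_of_nonneg_right hδ (norm_nonneg (c - x))
  have h5 : P.obj x + r.ρ * ‖x - c‖ ^ 2 + P.augPen β q x
    + r.ρ / 2 * ‖c - x‖ ^ 2 - δ * ‖c - x‖ ≤ P.obj c + r.ρ * 0 ^ 2 + P.augPen β q c := h1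
  rw [norm_sub_rev c x] at h4 h5
  linarith

/-- What the outer loop needs to know about the calls of iALM and PenMM: `φ` bounds the
infeasibility of the points, `Pm` the multipliers and `βm` the penalty parameters they return, and
`Λ` bounds the penalty terms at points of infeasibility `φ`. The first alternative for PenMM is the
one in which the center already passes its test. -/
structure OracleSpec (P : Problem n l m) (r : Params) (ε ε₂ Mh Λ φ Pm βm : ℝ) : Prop where
  φ_nonneg : 0 ≤ φ
  Pm_nonneg : 0 ≤ Pm
  mul_le : Pm * φ ≤ ε * Mh / 2
  sq_le : βm / 2 * φ ^ 2 ≤ Λ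
  iALM : ∀ c ∈ P.dom, ∀ x₀ ∈ P.dom, ∃ o ∈ iALM P r (ε / 2) c x₀,
    (P.prox r.ρ c).IsKKT (ε / 2) o.x o.p ∧ r.β₀ ≤ o.β ∧ o.β ≤ βm ∧ dnorm o.p ≤ Pm ∧
    P.feas o.x ≤ φ ∧ dnorm o.p ^ 2 / (2 * o.β) ≤ ε * Mh / 2 ∧
    P.obj o.x + 3 / 2 * r.ρ * ‖o.x - c‖ ^ 2
      ≤ P.obj c + ε / 4 * ‖o.x - c‖ + Pm * P.feas c + ε * Mh / 8
  penMM : ∀ c ∈ P.dom, ∀ βb, ∀ pb : Dual l m, r.β₀ ≤ βb → βb ≤ βm → (∀ i, 0 ≤ pb.2 i) →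
    dnorm pb ≤ Pm → ∃ o ∈ penMM P r (ε₂ / 2) βb c pb,
    (P.prox r.ρ c).IsKKT (ε₂ / 2) o.x o.p ∧ βb ≤ o.β ∧ o.β ≤ βm ∧
    (o.x = c ∨ P.feas o.x ≤ φ ∧ P.obj o.x + P.augPen o.β pb o.x + 3 / 2 * r.ρ * ‖o.x - c‖ ^ 2
      ≤ P.obj c + P.augPen o.β pb c + ε / 5 * ‖o.x - c‖)

/-- The estimate of the dual distance after a first step from the multiplier `0`, for a new
multiplier of norm `p ≥ K`. -/
theorem sq_le_of_first_step {K d p R : ℝ} (hd : p - K ≤ d) (hR : d ^ 2 + p ^ 2 ≤ K ^ 2 + R)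
    (hKp : K ≤ p) : 2 * p * (p - K) ≤ R := by
  nlinarith [mul_self_le_mul_self (sub_nonneg.2 hKp) hd]

theorem tol_penMM {ρ ε e : ℝ} (hρ : 0 < ρ) (hε : 0 < ε) (he : e = ε / (2 * √2) * scale ρ / 2) :
    0 < e ∧ e ≤ ε / 5 ∧ e * min 1 √ρ ≤ ε / 5 := by
  have hs := scale_pos hρ
  have hs1 := scale_le_one ρ
  have hsq : 1.4 ≤ √2 := Real.le_sqrt_of_sq_le (by norm_num)
  have h0 : 0 < e := by rw [he]; positivity
  have h1 : e ≤ ε / 5 := by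
    rw [he]
    calc ε / (2 * √2) * scale ρ / 2 ≤ ε / (2 * 1.4) * 1 / 2 := by gcongr
      _ ≤ ε / 5 := by ring_nf; linarith
  exact ⟨h0, h1, (mul_le_of_le_one_right h0.le (min_le_left _ _)).trans h1⟩

section

variable {K ε C Mh W : ℝ} {c x₀ : E n}

/-- The guarantee for iALM if the initial penalty parameter is at most `Ĉ/ε`. Either iALM leaves
its loop in the first step, or its penalty parameter is at most `16 σ W²/ε ≤ σ Ĉ/ε`; in both cases
the last two multipliers are bounded by `M̂`. -/
theorem exists_iALM_of_le (hr : r.Valid) (hQ : (P.prox r.ρ c).StronglyConvexProblem r.ρ)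
    {xs : E n} {ps : Dual l m} (hsad : (P.prox r.ρ c).IsSaddle r.ρ xs ps) (hps : dnorm ps ≤ K)
    (hrel : ConstRel K Mh C (scale r.ρ)) (hW1 : 5 / 4 * K ^ 2 ≤ W ^ 2) (hW2 : K ≤ W ^ 2)
    (hW3 : √2 / 4 ≤ W) (hW4 : 2 * K + √r.σ * W = Mh) (hWC : 16 * W ^ 2 ≤ C)
    (hε : 0 < ε) (hε' : ε ≤ 1 / 2) (hβ₀ : ε * r.β₀ ≤ C) (hc : c ∈ P.dom) (hx₀ : x₀ ∈ P.dom) :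
    ∃ o ∈ iALM P r (ε / 2) c x₀,
      (P.prox r.ρ c).IsKKT (ε / 2) o.x o.p ∧ r.β₀ ≤ o.β ∧ o.β ≤ r.σ * (C / ε) ∧
      dnorm o.p ≤ Mh ∧ P.feas o.x ≤ ε / 2 ∧ dnorm o.p ^ 2 / (2 * o.β) ≤ ε * Mh / 2 ∧
      P.obj o.x + 3 / 2 * r.ρ * ‖o.x - c‖ ^ 2
        ≤ P.obj c + ε / 4 * ‖o.x - c‖ + Mh * P.feas c + ε * Mh / 8 := by
  have hMh := hrel.Mh_pos
  have hs := hrel.s_pos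
  have hs1 := hrel.s_le
  have hC4 := hrel.C_ge
  have hK := hrel.K_nonneg
  have hMK := hrel.Mh_ge
  have h2' : 0 < √2 := Real.sqrt_pos.2 (by norm_num)
  have hW0 : 0 < W := by linarith
  have hσ := hr.σ_gt
  have hσ0 : 0 < r.σ := by linarith
  have hβ₀' : r.β₀ ≤ C / ε := by rw [le_div_iff₀ hε]; linarith
  have hCσ : C / ε ≤ r.σ * (C / ε) := le_mul_of_one_le_left (by positivity) hσ.le
  obtain ⟨o, ho, hkkt, hβ, q, hq, hp, hsum, hst, hor, hd1, hd2⟩ :=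
    exists_mem_iALM (T := 8 * W ^ 2 / (ε / 2)) hr hQ hsad hps (half_pos hε) rfl
      (fun β hβ hT => iALM_test hW1 hW2 hW3 hs hs1 (half_pos hε) (by linarith) hβ hT) hx₀
  have hβ0 : 0 < o.β := hr.β₀_pos.trans_le hβ
  obtain ⟨τ, hτ⟩ : ∃ τ, τ = (ε / 2) ^ 2 * scale r.ρ ^ 2 / 8 := ⟨_, rfl⟩
  rw [← hτ] at hd1 hd2
  have hτ0 : 0 ≤ τ := by rw [hτ]; positivity
  have hboth : dnorm q ≤ Mh ∧ dnorm o.p ≤ Mh ∧ o.β ≤ r.σ * (C / ε) := by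
    rcases hor with ⟨h1, h2⟩ | ⟨-, h1⟩
    · refine ⟨?_, ?_, by linarith⟩
      · rw [h2, ← norm_toL, show toL (0 : Dual l m) = 0 from rfl, norm_zero]; exact hMh.le
      · -- a first step from `p = 0` to a multiplier of norm above `M̂ ≥ 2 K` would violate the
        -- estimate of the dual distance
        by_contra! hlt
        have hKMh : 2 * K ≤ dnorm o.p := by linarith
        have h3 : dnorm o.p - K ≤ ‖toL o.p - toL ps‖ := by
          linarith [dnorm_le_add o.p ps]
        rw [h2, show toL (0 : Dual l m) = 0 from rfl, sub_zero, norm_toL] at hd2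
        have h4 := sq_le_of_first_step h3 hd2 (by linarith)
        have h5 : o.β * τ ≤ C * scale r.ρ / 64 := by
          calc o.β * τ ≤ C / ε * τ := by rw [h1]; gcongr
            _ = C * scale r.ρ * (ε * scale r.ρ) / 32 := by rw [hτ]; field_simp; ring
            _ ≤ C * scale r.ρ * (1 / 2 * 1) / 32 := by gcongr
            _ = _ := by ring
        have h6 := hrel.C_le
        have h7 : Mh * Mh < dnorm o.p * dnorm o.p := mul_self_lt_mul_self hMh.le hlt
        have h8 := mul_le_mul_of_nonneg_left hKMh (hMh.trans hlt).le
        linarith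
    · have h3 : o.β * τ ≤ r.σ * W ^ 2 := by
        calc o.β * τ ≤ r.σ * (8 * W ^ 2 / (ε / 2)) * τ := by gcongr
          _ = r.σ * W ^ 2 * ((ε / 2) * scale r.ρ ^ 2) := by rw [hτ]; field_simp
          _ ≤ r.σ * W ^ 2 * (1 * 1) := by
            gcongr
            · linarith
            · exact pow_le_one₀ hs.le hs1
          _ = _ := by ring
      have h4 : ∀ p : Dual l m, ‖toL p - toL ps‖ ^ 2 ≤ K ^ 2 + o.β * τ → dnorm p ≤ Mh := by
        intro p hp
        have h5 : ‖toL p - toL ps‖ ≤ K + √r.σ * W := by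
          refine le_of_sq_le_sq (hp.trans ?_) (by positivity)
          have h6 : (√r.σ * W) ^ 2 = r.σ * W ^ 2 := by rw [mul_pow, Real.sq_sqrt hσ0.le]
          have h7 : 0 ≤ K * (√r.σ * W) := by positivity
          rw [add_sq]
          linarith
        linarith [dnorm_le_add p ps]
      refine ⟨h4 q hd1, h4 o.p (by linarith [sq_nonneg ‖toL o.p - toL q‖]), h1.trans ?_⟩
      gcongr r.σ * ?_
      rw [div_le_div_iff₀ (by positivity) hε]
      have := mul_le_mul_of_nonneg_right hWC hε.le
      linarith
  obtain ⟨hqM, hpM, hβm⟩ := hboth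
  have hp0 := dnorm_nonneg o.p
  have hq0 := dnorm_nonneg q
  have hεβM := mul_pos hε (mul_pos hβ0 hMh)
  refine ⟨o, ho, hkkt, hβ, hβm, hpM, hkkt.2.2.1, ?_, ?_⟩
  · rw [div_le_iff₀ (by positivity)]
    have : dnorm o.p * dnorm o.p ≤ (ε / 2 * o.β) * Mh :=
      mul_le_mul (by linarith) hpM hp0 (by positivity)
    linarith
  · have h1 := descent_of_iALM (ε := ε) hQ hβ0 hc hst
      ((hr.tolAL_le (half_pos hε)).trans (by linarith))
    rw [← hp] at h1
    have h2 : dnorm q ^ 2 / (4 * o.β) ≤ ε * Mh / 8 := by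
      rw [div_le_iff₀ (by positivity)]
      have : dnorm q * dnorm q ≤ (ε / 2 * o.β) * Mh :=
        mul_le_mul (by linarith) hqM hq0 (by positivity)
      linarith
    have h3 := mul_le_mul_of_nonneg_right hpM (P.feas_nonneg c)
    linarith

/-- If the initial penalty parameter is at most `Ĉ/ε`, then iALM returns multipliers bounded by
`M̂`, and neither method increases the penalty parameter beyond `σ Ĉ/ε`. -/
theorem oracleSpec_of_le (hr : r.Valid)
    (hQ : ∀ c ∈ P.dom, (P.prox r.ρ c).StronglyConvexProblem r.ρ)
    (hS : ∀ c ∈ P.dom, ∃ xs ps, (P.prox r.ρ c).IsSaddle r.ρ xs ps ∧ dnorm ps ≤ K) (hK : 0 ≤ K)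
    (hε : 0 < ε) (hε' : ε ≤ 1 / 2) (hβ₀ : ε * r.β₀ ≤ Chat r.ρ r.σ K) :
    OracleSpec P r ε (ε / (2 * √2) * min 1 (1 / √r.ρ)) (Mhat r.σ K)
      (r.σ * Chat r.ρ r.σ K * ε / 8) (ε / 2) (Mhat r.σ K) (r.σ * (Chat r.ρ r.σ K / ε)) := by
  have hrel := constRel hr.σ_gt hr.ρ_pos hK
  obtain ⟨W, hMW, hW1, hW2, hW3, hW4⟩ := Mhat_ge hr.σ_gt hK
  have h2' : 0 < √2 := Real.sqrt_pos.2 (by norm_num)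
  have hWC := hrel.sq_le_C (W := W) (by linarith) (by linarith)
  have hMh := hrel.Mh_pos
  refine ⟨by positivity, hMh.le, by linarith, ?_, ?_, ?_⟩
  · apply le_of_eq; field_simp; norm_num
  · intro c hc x₀ hx₀
    obtain ⟨xs, ps, hsad, hps⟩ := hS c hc
    exact exists_iALM_of_le hr (hQ c hc) hsad hps hrel hW1 hW2 hW3 hMW.symm hWC hε hε' hβ₀ hc hx₀
  · intro c hc βb pb hβb hβbm hpb hpbM
    obtain ⟨xs, ps, hsad, hps⟩ := hS c hc
    obtain ⟨h0, he5, he5'⟩ := tol_penMM (ε := ε) hr.ρ_pos hε rfl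
    have hβb0 := hr.β₀_pos.trans_le hβb
    obtain ⟨o, ho, hkkt, hβ, hor, hx⟩ :=
      exists_mem_penMM (T := Chat r.ρ r.σ K / ε) hr (hQ c hc) hsad hps h0 hβb0 hpb
        (fun β hβ hT => hrel.penMM_test hε hε' (hβb0.trans_le hβ)
          (by rw [div_le_iff₀ hε] at hT; linarith) rfl (dnorm_nonneg _) hpbM) hc
    refine ⟨o, ho, hkkt, hβ, ?_, ?_⟩
    · rcases hor with h | ⟨-, h⟩
      · rw [h]; exact hβbm
      · exact h
    · have hfeas : P.feas o.x ≤ _ := hkkt.2.2.1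
      exact hx.imp_right fun h => ⟨hfeas.trans (he5.trans (by linarith)),
        descent_of_penMM (hQ c hc) (hβb0.trans_le hβ) hc h.1 he5'⟩

/-- If the initial penalty parameter exceeds `Ĉ/ε`, then the first step of each method meets its
stopping test, so that the penalty parameter never changes. The multipliers are then of the order
of `√β₀`, but the infeasibility is of the order of `1/√β₀`. -/
theorem oracleSpec_of_lt (hr : r.Valid)
    (hQ : ∀ c ∈ P.dom, (P.prox r.ρ c).StronglyConvexProblem r.ρ)
    (hS : ∀ c ∈ P.dom, ∃ xs ps, (P.prox r.ρ c).IsSaddle r.ρ xs ps ∧ dnorm ps ≤ K) (hK : 0 ≤ K)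
    (hε : 0 < ε) (hε' : ε ≤ 1 / 2) (hβ₀ : Chat r.ρ r.σ K < ε * r.β₀) :
    ∃ φ Pm, OracleSpec P r ε (ε / (2 * √2) * min 1 (1 / √r.ρ)) (Mhat r.σ K)
      (r.σ * Chat r.ρ r.σ K * ε / 8) φ Pm r.β₀ := by
  have hrel := constRel hr.σ_gt hr.ρ_pos hK
  obtain ⟨W, hMW, hW1, hW2, hW3, hW4⟩ := Mhat_ge hr.σ_gt hK
  have h2' : 0 < √2 := Real.sqrt_pos.2 (by norm_num)
  have hWC := hrel.sq_le_C (W := W) (by linarith) (by linarith)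
  have hMC := hrel.Mh_le_C
  have hC4 := hrel.C_ge
  have hσ := hr.σ_gt
  have hs := hrel.s_pos
  have hRM := hrel.residual_le hε hε' hr.β₀_pos hβ₀.le
  have hdone := fun e P β hβ hC he h => hrel.penMM_test_of_first_step hε hε' hβ hC
    (β := β) (e := e) (P := P) he h
  have hMh := hrel.Mh_pos
  clear hMW hW4 hrel
  generalize Chat r.ρ r.σ K = C at *
  generalize Mhat r.σ K = Mh at *
  have hb0 := hr.β₀_pos
  have hTb : 8 * W ^ 2 / (ε / 2) ≤ r.β₀ := by
    rw [div_le_iff₀ (by positivity)]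
    linarith
  -- the square of the bound for the infeasibility times `β₀`
  obtain ⟨R, hR⟩ : ∃ R, R = 4 * K ^ 2 + 5 * r.β₀ * ε ^ 2 * scale r.ρ ^ 2 / 64 := ⟨_, rfl⟩
  rw [← hR] at hRM
  have hR0 : 0 ≤ R := by rw [hR]; positivity
  have hεM := mul_pos hε hMh
  obtain ⟨τ, hτ⟩ : ∃ τ, τ = r.β₀ * (ε ^ 2 * scale r.ρ ^ 2 / 32) := ⟨_, rfl⟩
  have hτ0 : 0 ≤ τ := by rw [hτ]; positivity
  have hQ0 : 0 ≤ K ^ 2 + τ := by positivity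
  have hRτ : R = 4 * K ^ 2 + 5 / 2 * τ := by rw [hR, hτ]; ring
  have hQR : K ^ 2 + τ ≤ R := by linarith [sq_nonneg K]
  have hRb : R / r.β₀ ≤ ε * Mh / 4 := by rw [div_le_iff₀ hb0]; linarith
  have hφsq : (√R / r.β₀) ^ 2 = R / r.β₀ ^ 2 := by rw [div_pow, Real.sq_sqrt hR0]
  have hPR : √(K ^ 2 + τ) ≤ √R := Real.sqrt_le_sqrt hQR
  refine ⟨√R / r.β₀, √(K ^ 2 + τ), by positivity, by positivity, ?_, ?_, ?_, ?_⟩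
  · calc √(K ^ 2 + τ) * (√R / r.β₀) ≤ √R * (√R / r.β₀) := by gcongr
      _ = R / r.β₀ := by rw [← mul_div_assoc, Real.mul_self_sqrt hR0]
      _ ≤ ε * Mh / 4 := hRb
      _ ≤ ε * Mh / 2 := by linarith
  · have e4 : C ≤ r.σ * C := le_mul_of_one_le_left (by linarith) hσ.le
    rw [hφsq]
    calc r.β₀ / 2 * (R / r.β₀ ^ 2) = R / r.β₀ / 2 := by field_simp
      _ ≤ ε * Mh / 4 / 2 := by linarith
      _ = Mh * ε / 8 := by ring
      _ ≤ r.σ * C * ε / 8 := by gcongr; linarith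
  · intro c hc x₀ hx₀
    obtain ⟨xs, ps, hsad, hps⟩ := hS c hc
    obtain ⟨o, ho, hkkt, hβ, q, hq, hp, hsum, hst, hor, hd1, hd2⟩ :=
      exists_mem_iALM (T := 8 * W ^ 2 / (ε / 2)) hr (hQ c hc) hsad hps (half_pos hε) rfl
        (fun β hβ hT => iALM_test hW1 hW2 hW3 (scale_pos hr.ρ_pos) (scale_le_one _) (half_pos hε)
          (by linarith) hβ hT) hx₀
    obtain ⟨h1, h2⟩ := hor.resolve_right fun h => absurd h.1 (not_lt.2 hTb)
    have hq0 : toL q = 0 := by rw [h2]; rfl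
    have hqn : dnorm q = 0 := by rw [← norm_toL, hq0, norm_zero]
    rw [hq0, sub_zero, norm_toL, h1] at hd2
    have hpQ : dnorm o.p ^ 2 ≤ K ^ 2 + τ := by
      have := sq_nonneg ‖toL o.p - toL ps‖
      have e : r.β₀ * ((ε / 2) ^ 2 * scale r.ρ ^ 2 / 8) = τ := by rw [hτ]; ring
      linarith
    have hpP : dnorm o.p ≤ √(K ^ 2 + τ) := Real.le_sqrt_of_sq_le hpQ
    refine ⟨o, ho, hkkt, hβ, h1.le, hpP, ?_, ?_, ?_⟩
    · have h3 := Problem.feas_le (P := P) (x := o.x) (hb0.trans_le hβ) hq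
      rw [← hp, dnorm_sub, hq0, sub_zero, norm_toL, h1] at h3
      exact h3.trans (by gcongr; linarith)
    · rw [h1, div_le_iff₀ (by positivity)]
      have := mul_pos hb0 hεM
      linarith
    · have h3 := descent_of_iALM (ε := ε) (hQ c hc) (hb0.trans_le hβ) hc hst
        ((hr.tolAL_le (half_pos hε)).trans (by linarith))
      rw [← hp, hqn] at h3
      have h4 := mul_le_mul_of_nonneg_right hpP (P.feas_nonneg c)
      have h6 : (0 : ℝ) ^ 2 / (4 * o.β) = 0 := by simp
      linarith
  · intro c hc βb pb hβb hβbm hpb hpbM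
    obtain rfl : βb = r.β₀ := le_antisymm hβbm hβb
    obtain ⟨xs, ps, hsad, hps⟩ := hS c hc
    obtain ⟨e, he⟩ : ∃ e, e = ε / (2 * √2) * scale r.ρ / 2 := ⟨_, rfl⟩
    obtain ⟨h0, he5, he5'⟩ := tol_penMM (ε := ε) hr.ρ_pos hε he
    have hPsq : dnorm pb ^ 2 ≤ K ^ 2 + τ := by
      calc dnorm pb ^ 2 ≤ √(K ^ 2 + τ) ^ 2 := by have := dnorm_nonneg pb; gcongr
        _ = K ^ 2 + τ := Real.sq_sqrt hQ0
    have hes : e ^ 2 * scale r.ρ ^ 2 / 2 ≤ ε ^ 2 * scale r.ρ ^ 2 / 64 := by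
      have h22 : √2 ^ 2 = 2 := Real.sq_sqrt (by norm_num)
      have e1 : e ^ 2 = ε ^ 2 * scale r.ρ ^ 2 / 32 := by
        rw [he, div_pow, mul_pow, div_pow, mul_pow, h22]; ring
      calc e ^ 2 * scale r.ρ ^ 2 / 2 = ε ^ 2 * scale r.ρ ^ 2 / 64 * scale r.ρ ^ 2 := by
            rw [e1]; ring
        _ ≤ ε ^ 2 * scale r.ρ ^ 2 / 64 * 1 := by
          gcongr
          exact pow_le_one₀ hs.le (scale_le_one _)
        _ = _ := mul_one _
    have hKP : ∀ β, r.β₀ ≤ β → (K + dnorm pb) ^ 2 + β * (e ^ 2 * scale r.ρ ^ 2 / 2)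
        ≤ 4 * K ^ 2 + 5 * β * ε ^ 2 * scale r.ρ ^ 2 / 64 := by
      intro β hβ
      have h1 : β * (e ^ 2 * scale r.ρ ^ 2 / 2) ≤ β * (ε ^ 2 * scale r.ρ ^ 2 / 64) :=
        mul_le_mul_of_nonneg_left hes (hb0.trans_le hβ).le
      have h2 : τ ≤ β * (ε ^ 2 * scale r.ρ ^ 2 / 32) := by rw [hτ]; gcongr
      linarith [sq_nonneg (K - dnorm pb)]
    obtain ⟨o, ho, hkkt, hβ, hor, hx⟩ :=
      exists_mem_penMM (T := r.β₀) hr (hQ c hc) hsad hps h0 hb0 hpb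
        (fun β hβ _ => hdone e (dnorm pb) β (hb0.trans_le hβ)
          (hβ₀.le.trans (mul_le_mul_of_nonneg_left hβ hε.le)) he (hKP β hβ)) hc
    have hoβ : o.β = r.β₀ := hor.resolve_right fun h => lt_irrefl _ h.1
    refine ⟨o, by rw [← scale, ← he]; exact ho, by rw [← scale, ← he]; exact hkkt, hβ, hoβ.le, ?_⟩
    refine hx.imp_right fun h => ⟨?_, descent_of_penMM (hQ c hc) (hb0.trans_le hβ) hc h.1 he5'⟩
    have h3 := h.2
    rw [hoβ] at h3
    rw [le_div_iff₀ hb0]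
    refine Real.le_sqrt_of_sq_le ?_
    rw [mul_pow]
    exact h3.trans ((hKP _ le_rfl).trans_eq hR.symm)

end

end

section

variable {n l m : ℕ}

/-! ### The proximal-point iterations -/

variable {P : Problem n l m} {r : Params}

theorem stageEnd_succ (γ : ℝ) (N₀ N₁ S : ℕ) :
    stageEnd γ N₀ N₁ (S + 1) = stageEnd γ N₀ N₁ S + ⌈γ ^ S * (N₁ : ℝ)⌉₊ := by
  rw [stageEnd, Finset.sum_range_succ, stageEnd, add_assoc]

theorem strictMono_stageEnd {γ : ℝ} (hγ : 1 < γ) (N₀ : ℕ) {N₁ : ℕ} (hN₁ : 1 ≤ N₁) :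
    StrictMono (stageEnd γ N₀ N₁) := by
  refine strictMono_nat_of_lt_succ fun S => ?_
  rw [stageEnd_succ]
  have h1 : (0 : ℝ) < N₁ := by exact_mod_cast hN₁
  have : 0 < ⌈γ ^ S * (N₁ : ℝ)⌉₊ := Nat.ceil_pos.2 (by positivity)
  omega

/-- A step longer than `ε/(4ρ)` decreases the objective by at least `ε²/(24ρ)`, net of the errors
caused by the inexact solution of the subproblem. -/
theorem gain_le {ρ ε d : ℝ} (hρ : 0 < ρ) (hε : 0 < ε) (hd : ε / (4 * ρ) < d) :
    ε ^ 2 / (24 * ρ) ≤ 3 / 2 * ρ * d ^ 2 - ε / 5 * d := by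
  rw [div_lt_iff₀ (by positivity)] at hd
  rw [div_le_iff₀ (by positivity)]
  obtain ⟨v, hv⟩ : ∃ v, v = d * ρ - ε / 4 := ⟨_, rfl⟩
  have hv0 : 0 < v := by linarith
  have e : (3 / 2 * ρ * d ^ 2 - ε / 5 * d) * (24 * ρ)
      = 36 * (d * ρ) ^ 2 - 24 / 5 * ε * (d * ρ) := by ring
  rw [e, show d * ρ = v + ε / 4 by linarith]
  nlinarith [mul_pos hv0 hε, sq_nonneg v, mul_pos hε hε]

theorem gain_le' {ρ ε d : ℝ} (hρ : 0 < ρ) (hε : 0 < ε) (hd : ε / (4 * ρ) < d) :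
    ε ^ 2 / (24 * ρ) ≤ 3 / 2 * ρ * d ^ 2 := by
  have h0 : 0 < d := lt_trans (by positivity) hd
  linarith [gain_le hρ hε hd, mul_pos hε h0]

/-- The estimated multiplier and the penalty parameter with which PenMM may be called. -/
structure IsAnchor (r : Params) (ε Mh Pm βm β : ℝ) (p : Dual l m) : Prop where
  nonneg : ∀ i, 0 ≤ p.2 i
  norm_le : dnorm p ≤ Pm
  le : r.β₀ ≤ β
  le' : β ≤ βm
  sq_le : dnorm p ^ 2 / (2 * β) ≤ ε * Mh / 2

theorem IsAnchor.mono {ε Mh Pm βm β β' : ℝ} {p : Dual l m} (hr : r.Valid)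
    (h : IsAnchor r ε Mh Pm βm β p) (hβ : β ≤ β') (hβ' : β' ≤ βm) :
    IsAnchor r ε Mh Pm βm β' p := by
  have h0 : 0 < β := hr.β₀_pos.trans_le h.le
  refine ⟨h.nonneg, h.norm_le, h.le.trans hβ, hβ', le_trans ?_ h.sq_le⟩
  gcongr

/-- The merit function that decreases during consecutive PenMM iterations with a fixed estimated
multiplier `p` and nondecreasing penalty parameters `β`. -/
def merit (P : Problem n l m) (φ β : ℝ) (p : Dual l m) (x : E n) : ℝ :=
  P.obj x + P.augPen β p x + dnorm p ^ 2 / (2 * β) - β / 2 * φ ^ 2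

section

variable {ε ε₂ Mh Λ φ Pm βm : ℝ}

/-- At the start of a stage, the merit function exceeds the objective by at most `ε M̂`. -/
theorem merit_le (hr : r.Valid) (hs : OracleSpec P r ε ε₂ Mh Λ φ Pm βm) {β : ℝ} {p : Dual l m}
    (ha : IsAnchor r ε Mh Pm βm β p) {x : E n} (hx : P.feas x ≤ φ) :
    merit P φ β p x ≤ P.obj x + ε * Mh := by
  have h0 : 0 < β := hr.β₀_pos.trans_le ha.le
  have h1 := Problem.augPen_le (P := P) h0 ha.nonneg x
  have h2 : dnorm p * P.feas x ≤ Pm * φ :=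
    mul_le_mul ha.norm_le hx (P.feas_nonneg x) hs.Pm_nonneg
  have h3 : β / 2 * P.feas x ^ 2 ≤ β / 2 * φ ^ 2 := by
    have := P.feas_nonneg x
    gcongr
  unfold merit
  linarith [hs.mul_le, ha.sq_le]

theorem obj_le_merit (hr : r.Valid) (hs : OracleSpec P r ε ε₂ Mh Λ φ Pm βm) {β : ℝ}
    {p : Dual l m} (ha : IsAnchor r ε Mh Pm βm β p) (x : E n) :
    P.obj x ≤ merit P φ β p x + Λ := by
  have h1 := Problem.neg_dnorm_sq_le_augPen (P := P) (hr.β₀_pos.trans_le ha.le) p x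
  have h2 : β / 2 * φ ^ 2 ≤ βm / 2 * φ ^ 2 := by gcongr; exact ha.le'
  unfold merit
  linarith [hs.sq_le]

/-- Unless it stops the method, a PenMM iteration decreases the merit function. -/
theorem exists_penMM_step (hr : r.Valid) (hε : 0 < ε) (hs : OracleSpec P r ε ε₂ Mh Λ φ Pm βm)
    {β : ℝ} {p : Dual l m} (ha : IsAnchor r ε Mh Pm βm β p) {c : E n} (hc : c ∈ P.dom)
    (hcφ : P.feas c ≤ φ) :
    ∃ o ∈ penMM P r (ε₂ / 2) β c p, (P.prox r.ρ c).IsKKT (ε₂ / 2) o.x o.p ∧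
      IsAnchor r ε Mh Pm βm o.β p ∧ (ε / (4 * r.ρ) < ‖o.x - c‖ → P.feas o.x ≤ φ ∧
        merit P φ o.β p o.x ≤ merit P φ β p c - ε ^ 2 / (24 * r.ρ)) := by
  have h0 : 0 < β := hr.β₀_pos.trans_le ha.le
  obtain ⟨o, ho, hkkt, hβ, hβm, hx⟩ := hs.penMM c hc β p ha.le ha.le' ha.nonneg ha.norm_le
  refine ⟨o, ho, hkkt, ha.mono hr hβ hβm, fun hlt => ?_⟩
  have hρ := hr.ρ_pos
  rcases hx with hx | ⟨h1, h2⟩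
  · rw [hx, sub_self, norm_zero] at hlt
    exact absurd hlt (not_lt.2 (by positivity))
  · have h3 := Problem.augPen_anti h0 hβ ha.nonneg hcφ
    have h4 := gain_le hρ hε hlt
    refine ⟨h1, ?_⟩
    unfold merit
    linarith

/-- Unless it stops the method, an iALM iteration from a nearly feasible center decreases the
objective up to an error of order `ε`. -/
theorem exists_iALM_step (hr : r.Valid) (hε : 0 < ε) (hs : OracleSpec P r ε ε₂ Mh Λ φ Pm βm)
    (hbd : Bornology.IsBounded P.dom) {c x₀ : E n} (hc : c ∈ P.dom) (hx₀ : x₀ ∈ P.dom) :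
    ∃ o ∈ iALM P r (ε / 2) c x₀, (P.prox r.ρ c).IsKKT (ε / 2) o.x o.p ∧
      IsAnchor r ε Mh Pm βm o.β o.p ∧ P.feas o.x ≤ φ ∧ ‖o.x - c‖ ≤ P.diam ∧
      (ε / (4 * r.ρ) < ‖o.x - c‖ → P.feas c ≤ φ →
        P.obj o.x ≤ P.obj c + ε * (P.diam / 4 + 5 / 8 * Mh) - ε ^ 2 / (24 * r.ρ)) := by
  obtain ⟨o, ho, hkkt, hβ, hβm, hp, hfeas, hsq, hdec⟩ := hs.iALM c hc x₀ hx₀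
  have hD : ‖o.x - c‖ ≤ P.diam := by
    rw [← dist_eq_norm]; exact Metric.dist_le_diam_of_mem hbd hkkt.1 hc
  refine ⟨o, ho, hkkt, ⟨hkkt.2.1, hp, hβ, hβm, hsq⟩, hfeas, hD, fun hlt hcφ => ?_⟩
  have h1 := gain_le' hr.ρ_pos hε hlt
  have h2 : ε / 4 * ‖o.x - c‖ ≤ ε / 4 * P.diam := by gcongr
  have h3 : Pm * P.feas c ≤ Pm * φ := mul_le_mul_of_nonneg_left hcφ hs.Pm_nonneg
  linarith [hs.mul_le]

open Classical in
/-- The initial stage either stops with an `ε`-KKT point, or it returns a nearly feasible point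
whose objective value is controlled. The first iteration is not counted: it leaves a point that may be far
from feasible, and the objective after it is only known to be at most `B₀`. -/
theorem exists_mem_initialStage (hr : r.Valid) (hg : Differentiable ℝ P.g) (hε : 0 < ε)
    (hs : OracleSpec P r ε ε₂ Mh Λ φ Pm βm) (hMh : 0 ≤ Mh)
    (hbd : Bornology.IsBounded P.dom) {B₀ : ℝ} (hobj : ∀ x ∈ P.dom, |P.obj x| ≤ B₀)
    (hN₀ : 1 ≤ r.N₀) {start : ℕ → E n} (hstart : ∀ k, start k ∈ P.dom) {x₀ : E n}
    (hx₀ : x₀ ∈ P.dom) :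
    ∃ b ∈ initialStage P r ε ε start x₀,
      (∃ out, b = Sum.inl out ∧ out.iters ≤ r.N₀ ∧ P.IsKKT ε out.x out.p) ∨
      ∃ o, b = Sum.inr o ∧ o.x ∈ P.dom ∧ P.feas o.x ≤ φ ∧ IsAnchor r ε Mh Pm βm o.β o.p ∧
        ε ^ 2 / (24 * r.ρ) < ε * (P.diam / 2 + Mh) ∧
        P.obj o.x ≤ B₀ + (r.N₀ - 1) * (ε * (P.diam / 2 + Mh) - ε ^ 2 / (24 * r.ρ)) := by
  refine exists_mem_fix _ (fun j (s : ℕ × E n) => s.1 + j = r.N₀ ∧ 1 ≤ j ∧ s.2 ∈ P.dom ∧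
    (s.1 = 0 ∨ P.feas s.2 ≤ φ ∧
      P.obj s.2 ≤ B₀ + (s.1 - 1) * (ε * (P.diam / 2 + Mh) - ε ^ 2 / (24 * r.ρ)))) _ ?_
    r.N₀ (0, x₀) ⟨by simp, hN₀, hx₀, Or.inl rfl⟩
  rintro j ⟨k, c⟩ ⟨hj, hj1, hc, hor⟩
  obtain ⟨o, ho, hkkt, ha, hfeas, hD, hdec⟩ := exists_iALM_step hr hε hs hbd hc (hstart k)
  have hρ := hr.ρ_pos
  by_cases hdone : ‖o.x - c‖ ≤ ε / (4 * r.ρ)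
  · refine Or.inl ⟨Sum.inl ⟨k + 1, o.x, o.p⟩, ?_, Or.inl ⟨_, rfl, ?_, ?_⟩⟩
    · simp only [Part.bind_eq_bind, Part.mem_bind_iff]
      exact ⟨o, ho, by rw [if_pos hdone]; simp⟩
    · change k + 1 ≤ r.N₀
      change k + j = r.N₀ at hj
      omega
    · exact hkkt.of_prox hg hρ le_rfl hε.le hdone
  have hlt := not_le.1 hdone
  have hgain : ε ^ 2 / (24 * r.ρ) < ε * (P.diam / 2 + Mh) := by
    have h1 : ε / (4 * r.ρ) < P.diam := hlt.trans_le hD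
    have h2 : ε ^ 2 / (24 * r.ρ) = ε * (ε / (4 * r.ρ) / 6) := by field_simp; norm_num
    have h3 : 0 < ε / (4 * r.ρ) := by positivity
    rw [h2]
    gcongr
    linarith
  have hnew : P.obj o.x ≤ B₀
      + ((k + 1 : ℕ) - 1) * (ε * (P.diam / 2 + Mh) - ε ^ 2 / (24 * r.ρ)) := by
    push_cast
    rw [add_sub_cancel_right]
    rcases hor with h | ⟨h1, h2⟩
    · change k = 0 at h
      rw [h, Nat.cast_zero, zero_mul, add_zero]
      exact (le_abs_self _).trans (hobj _ hkkt.1)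
    · have h3 := hdec hlt h1
      change P.obj c ≤ B₀ + ((k : ℝ) - 1) * _ at h2
      have hD0 : 0 ≤ P.diam := Metric.diam_nonneg
      have h4 := mul_nonneg hε.le hD0
      have h5 := mul_nonneg hε.le hMh
      linarith
  by_cases hlast : k + 1 = r.N₀
  · refine Or.inl ⟨Sum.inr o, ?_, Or.inr ⟨o, rfl, hkkt.1, hfeas, ha, hgain, ?_⟩⟩
    · simp only [Part.bind_eq_bind, Part.mem_bind_iff]
      exact ⟨o, ho, by rw [if_neg hdone, if_pos hlast]; simp⟩
    · rw [← hlast]; exact hnew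
  · refine Or.inr ⟨(k + 1, o.x), ?_, j - 1, ?_, ?_, ?_, hkkt.1, Or.inr ⟨hfeas, hnew⟩⟩
    · simp only [Part.bind_eq_bind, Part.mem_bind_iff]
      exact ⟨o, ho, by rw [if_neg hdone, if_neg hlast]; simp⟩
    all_goals
      change k + j = r.N₀ at hj
      try change k + 1 + (j - 1) = r.N₀
      omega

open Classical in
/-- The main loop reaches an `ε`-KKT point before its iteration counter exceeds `K_S`: otherwise
the decrease `ε²/(24ρ)` of each iteration, net of the increase by at most `loss` in each stage,
would drive the objective below its lower bound `-B₀`. -/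
theorem exists_mem_fix_mainStep (hr : r.Valid) (hg : Differentiable ℝ P.g) (hε : 0 < ε)
    (hε₂ : ε₂ ≤ ε) (hs : OracleSpec P r ε ε₂ Mh Λ φ Pm βm) (hMh : 0 ≤ Mh)
    (hbd : Bornology.IsBounded P.dom) {B₀ A loss : ℝ} (hobj : ∀ x ∈ P.dom, |P.obj x| ≤ B₀)
    (hγ : 1 < r.γ) (hN₁ : 1 ≤ r.N₁) {start : ℕ → E n} (hstart : ∀ k, start k ∈ P.dom)
    (hloss : Λ + ε * (P.diam / 4 + 13 / 8 * Mh) ≤ loss) {S : ℕ}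
    (hfin : B₀ + A + S * loss
      < (stageEnd r.γ r.N₀ r.N₁ S - r.N₀) * (ε ^ 2 / (24 * r.ρ)))
    {o : ALState n l m} (hx : o.x ∈ P.dom) (hfeas : P.feas o.x ≤ φ)
    (ha : IsAnchor r ε Mh Pm βm o.β o.p) (hA : P.obj o.x ≤ A) :
    ∃ out ∈ PFun.fix (mainStep P r ε ε ε₂ start)
        ⟨1, r.N₀, r.N₀ + r.N₁, o.β, o.p, o.x, o.p⟩,
      out.iters ≤ stageEnd r.γ r.N₀ r.N₁ S ∧ P.IsKKT ε out.x out.p := by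
  obtain ⟨K, hKdef⟩ : ∃ K : ℕ → ℕ, K = stageEnd r.γ r.N₀ r.N₁ := ⟨_, rfl⟩
  have hK : StrictMono K := hKdef ▸ strictMono_stageEnd hγ r.N₀ hN₁
  have hKsucc : ∀ j, K (j + 1) = K j + ⌈r.γ ^ j * (r.N₁ : ℝ)⌉₊ := fun j => by
    rw [hKdef]; exact stageEnd_succ _ _ _ _
  have hK0 : K 0 = r.N₀ := by rw [hKdef]; simp [stageEnd]
  rw [← hKdef] at hfin ⊢
  obtain ⟨g, hgdef⟩ : ∃ g, g = ε ^ 2 / (24 * r.ρ) := ⟨_, rfl⟩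
  rw [← hgdef] at hfin
  have hρ := hr.ρ_pos
  have hg0 : 0 < g := by rw [hgdef]; positivity
  have hεM := mul_nonneg hε.le hMh
  have hεD : 0 ≤ ε * P.diam := mul_nonneg hε.le Metric.diam_nonneg
  have hβm : 0 < βm := hr.β₀_pos.trans_le (ha.le.trans ha.le')
  have hΛ : 0 ≤ Λ := le_trans (by positivity) hs.sq_le
  have hloss0 : 0 ≤ loss := le_trans (by linarith) hloss
  have hN₁' : (1 : ℝ) ≤ r.N₁ := by exact_mod_cast hN₁
  have hK1 : K 1 = r.N₀ + r.N₁ := by rw [hKsucc 0, hK0]; simp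
  -- Within a stage the merit function is controlled, at its start also the objective itself. For
  -- `N₁ = 1` the first stage is entered at `k = N₀ = K₁ - 1`, but the test `k = K_s - 1` is made only
  -- after an iteration, so that it fails throughout and the first stage never ends.
  refine exists_mem_fix _ (fun f (q : MainState n l m) => ∃ j, q.s = j + 1 ∧ q.k + f = K S ∧
    q.Ks = K (j + 1) ∧ K j ≤ q.k ∧ ((j = 0 ∧ r.N₁ = 1) ∨ q.k + 2 ≤ q.Ks) ∧
    q.x ∈ P.dom ∧ P.feas q.x ≤ φ ∧ IsAnchor r ε Mh Pm βm q.βbar q.pbar ∧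
    merit P φ q.βbar q.pbar q.x ≤ A + j * loss - (q.k - r.N₀) * g + ε * Mh ∧
    (K j < q.k ∨ P.obj q.x ≤ A + j * loss - (q.k - r.N₀) * g)) _ ?_ (K S - r.N₀) _
    ⟨0, rfl, ?_, hK1.symm, hK0.le, ?_, hx, hfeas, ha, ?_, Or.inr ?_⟩
  · rintro f ⟨s, k, Ks, βbar, pbar, x, p⟩ ⟨j, hsj, hkf, hKs, hjk, hk2, hxX, hxφ, ha, hmer, hor⟩
    dsimp only at hsj hkf hKs hjk hk2 hxX hxφ ha hmer hor
    subst hsj hKs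
    by_cases hkkt : P.IsKKT ε x p
    · refine Or.inl ⟨⟨k, x, p⟩, ?_, ?_, hkkt⟩
      · simp only [mainStep]; rw [if_pos hkkt]; simp
      · change k ≤ K S
        omega
    have hjS : j ≤ S := hK.le_iff_le.1 (by omega)
    have hlow : -B₀ ≤ P.obj x := (abs_le.1 (hobj x hxX)).1
    -- at `k = K_S` the objective would lie below `-B₀`
    have hkS : k < K S := by
      by_contra! hge
      have hkeq : k = K S := by omega
      have h1 : P.obj x ≤ A + S * loss - (k - r.N₀) * g := by
        rcases hor with h | h
        · have h2 : ((j + 1 : ℕ) : ℝ) ≤ S := by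
            exact_mod_cast (hK.lt_iff_lt.1 (by omega) : j < S)
          have h3 := mul_le_mul_of_nonneg_right h2 hloss0
          push_cast at h3
          have h4 := obj_le_merit hr hs ha x
          linarith
        · have h2 : (j : ℝ) ≤ S := by exact_mod_cast hjS
          have h3 := mul_le_mul_of_nonneg_right h2 hloss0
          linarith
      rw [hkeq] at h1
      linarith
    have hj1S : j + 1 ≤ S := hK.lt_iff_lt.1 (by omega : K j < K S)
    have hKs : K (j + 1) ≤ K S := hK.monotone hj1S
    obtain ⟨o, ho, hokkt, hoa, hodec⟩ := exists_penMM_step hr hε hs ha hxX hxφ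
    by_cases hdone : ‖o.x - x‖ ≤ ε / (4 * r.ρ)
    · refine Or.inl ⟨⟨k + 1, o.x, o.p⟩, ?_, hkS,
        hokkt.of_prox hg hρ (by linarith) hε.le hdone⟩
      simp only [mainStep]
      rw [if_neg hkkt]
      simp only [Part.bind_eq_bind, Part.mem_bind_iff]
      exact ⟨o, ho, by rw [if_pos hdone]; simp⟩
    obtain ⟨hoφ, homer⟩ := hodec (not_le.1 hdone)
    rw [← hgdef] at homer
    by_cases hlast : (k + 1) + 1 = K (j + 1)
    · obtain ⟨o', ho', hokkt', hoa', hoφ', -, hodec'⟩ :=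
        exists_iALM_step hr hε hs hbd hokkt.1 (hstart (k + 1))
      by_cases hdone' : ‖o'.x - o.x‖ ≤ ε / (4 * r.ρ)
      · refine Or.inl ⟨⟨(k + 1) + 1, o'.x, o'.p⟩, ?_, hlast.le.trans hKs,
          hokkt'.of_prox hg hρ le_rfl hε.le hdone'⟩
        simp only [mainStep]
        rw [if_neg hkkt]
        simp only [Part.bind_eq_bind, Part.mem_bind_iff]
        refine ⟨o, ho, ?_⟩
        rw [if_neg hdone, if_pos hlast]
        simp only [Part.mem_bind_iff]
        exact ⟨o', ho', by rw [if_pos hdone']; simp⟩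
      · have hobj' := hodec' (not_le.1 hdone') hoφ
        rw [← hgdef] at hobj'
        have h1 := obj_le_merit hr hs hoa o.x
        have hcast : ((K (j + 1) : ℕ) : ℝ) = k + 2 := by
          rw [← hlast]; push_cast; ring
        have hU : P.obj o'.x
            ≤ A + ((j + 1 : ℕ) : ℝ) * loss - (((K (j + 1) : ℕ) : ℝ) - r.N₀) * g := by
          rw [hcast]; push_cast; linarith
        refine Or.inr ⟨⟨j + 1 + 1, K (j + 1),
          K (j + 1) + ⌈r.γ ^ (j + 1) * (r.N₁ : ℝ)⌉₊, o'.β, o'.p, o'.x, o'.p⟩, ?_, f - 2, ?_,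
          j + 1, rfl, ?_, (hKsucc _).symm, le_rfl, Or.inr ?_, hokkt'.1, hoφ', hoa', ?_, Or.inr hU⟩
        · simp only [mainStep]
          rw [if_neg hkkt]
          simp only [Part.bind_eq_bind, Part.mem_bind_iff]
          refine ⟨o, ho, ?_⟩
          rw [if_neg hdone, if_pos hlast]
          simp only [Part.mem_bind_iff]
          exact ⟨o', ho', by rw [if_neg hdone']; simp⟩
        · omega
        · change K (j + 1) + (f - 2) = K S
          omega
        · change K (j + 1) + 2 ≤ K (j + 1) + ⌈r.γ ^ (j + 1) * (r.N₁ : ℝ)⌉₊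
          have h2 : 1 < ⌈r.γ ^ (j + 1) * (r.N₁ : ℝ)⌉₊ := by
            rw [Nat.lt_ceil, Nat.cast_one]
            have h3 : 1 < r.γ ^ (j + 1) := one_lt_pow₀ hγ (Nat.succ_ne_zero j)
            nlinarith
          omega
        · exact (merit_le hr hs hoa' hoφ').trans (by linarith)
    · refine Or.inr ⟨⟨j + 1, k + 1, K (j + 1), o.β, pbar, o.x, o.p⟩, ?_, f - 1, ?_,
          j, rfl, ?_, rfl, ?_, ?_, hokkt.1, hoφ, hoa, ?_, Or.inl ?_⟩
      · simp only [mainStep]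
        rw [if_neg hkkt]
        simp only [Part.bind_eq_bind, Part.mem_bind_iff]
        exact ⟨o, ho, by rw [if_neg hdone, if_neg hlast]; simp⟩
      · omega
      · change k + 1 + (f - 1) = K S
        omega
      · change K j ≤ k + 1
        omega
      · change (j = 0 ∧ r.N₁ = 1) ∨ k + 1 + 2 ≤ K (j + 1)
        omega
      · change merit P φ o.β pbar o.x ≤ A + j * loss - ((k + 1 : ℕ) - r.N₀) * g + ε * Mh
        push_cast
        linarith
      · change K j < k + 1
        omega
  · have : K 0 ≤ K S := hK.monotone (Nat.zero_le S)
    change r.N₀ + (K S - r.N₀) = K S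
    omega
  · change (0 = 0 ∧ r.N₁ = 1) ∨ r.N₀ + 2 ≤ r.N₀ + r.N₁
    omega
  · refine (merit_le hr hs ha hfeas).trans ?_
    simp only [Nat.cast_zero, zero_mul, add_zero, sub_self, sub_zero]
    linarith
  · simpa using hA

end

end

section

variable {n l m : ℕ}

/-! ### The number of stages -/

/-- The elementary fact behind the condition on `γ^S`: `t ≥ 2 a log a` implies `a log t ≤ t`, by
`log u ≤ u - 1` at `u = t/(2a)`. -/
theorem mul_log_le_of_ge {a t : ℝ} (ha : 0 < a) (ht : 0 < t) (h : 2 * a * log a ≤ t) :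
    a * log t ≤ t := by
  have h1 : log (t / (2 * a)) ≤ t / (2 * a) - 1 := Real.log_le_sub_one_of_pos (by positivity)
  have h2 : log t = log (t / (2 * a)) + (log 2 + log a) := by
    rw [Real.log_div ht.ne' (by positivity), Real.log_mul two_ne_zero ha.ne']; ring
  have h3 : log 2 ≤ 1 := by linarith [Real.log_two_lt_d9]
  calc a * log t ≤ a * (t / (2 * a) + log a) := by gcongr; linarith
    _ = t / 2 + a * log a := by field_simp
    _ ≤ t := by linarith

theorem mul_geom_le_stageEnd {γ : ℝ} (hγ : 1 < γ) (N₀ N₁ S : ℕ) :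
    N₀ + N₁ * ((γ ^ S - 1) / (γ - 1)) ≤ (stageEnd γ N₀ N₁ S : ℝ) := by
  rw [stageEnd, ← geom_sum_eq hγ.ne', Finset.mul_sum]
  push_cast
  gcongr with s
  rw [mul_comm]
  exact Nat.le_ceil _

theorem stageEnd_le {γ : ℝ} (hγ : 1 < γ) (N₀ : ℕ) {N₁ : ℕ} (hN₁ : 1 ≤ N₁) (S : ℕ) :
    (stageEnd γ N₀ N₁ S : ℝ) ≤ N₀ + 2 * N₁ * (γ ^ S / (γ - 1)) := by
  have hγ' : 0 < γ - 1 := by linarith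
  have h1 : (1 : ℝ) ≤ N₁ := by exact_mod_cast hN₁
  have h2 : (γ ^ S - 1) / (γ - 1) ≤ γ ^ S / (γ - 1) := by gcongr; linarith
  calc (stageEnd γ N₀ N₁ S : ℝ) ≤ N₀ + 2 * N₁ * ∑ s ∈ Finset.range S, γ ^ s := by
        rw [stageEnd, Finset.mul_sum]
        push_cast
        gcongr with s
        have h3 : 1 ≤ γ ^ s := one_le_pow₀ hγ.le
        have h4 := Nat.ceil_lt_add_one (a := γ ^ s * (N₁ : ℝ)) (by positivity)
        have h5 : 1 * 1 ≤ γ ^ s * (N₁ : ℝ) := mul_le_mul h3 h1 zero_le_one (by positivity)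
        linarith
    _ ≤ _ := by rw [geom_sum_eq hγ.ne']; gcongr

/-- The stage conditions make the total decrease over `K_S` iterations outweigh all increases. -/
theorem StageCond.budget_le {ρ σ γ D B₀ K ε : ℝ} {N₀ N₁ S : ℕ} (hρ : 0 < ρ) (hγ : 1 < γ)
    (hε : 0 < ε) (hN₁ : 1 ≤ N₁) (hN₀ : (N₁ : ℝ) / (γ - 1) ≤ N₀)
    (h : StageCond ρ σ γ D B₀ K N₀ N₁ ε S) :
    2 * B₀ + N₀ * (ε * (D / 2 + Mhat σ K))
        + S * (2 * ε * (1 / 2 + D / 2 + 9 * Mhat σ K / 4 + Chat ρ σ K * σ / 4))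
      ≤ stageEnd γ N₀ N₁ S * (ε ^ 2 / (24 * ρ)) := by
  obtain ⟨h1, h2, h3⟩ := h
  have hlog : 0 < log γ := Real.log_pos hγ
  have hγ' : 0 < γ - 1 := by linarith
  have hN₁' : (0 : ℝ) < N₁ := by exact_mod_cast hN₁
  have hγS : 0 < γ ^ S := by positivity
  obtain ⟨Ct, hCt⟩ : ∃ Ct, Ct = Ctilde ρ σ γ D K N₁ ε := ⟨_, rfl⟩
  rw [← hCt] at h3
  obtain ⟨Mh, hMh⟩ : ∃ Mh, Mh = Mhat σ K := ⟨_, rfl⟩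
  obtain ⟨W, hWdef⟩ : ∃ W, W = 1 / 2 + D / 2 + 9 * Mhat σ K / 4 + Chat ρ σ K * σ / 4 := ⟨_, rfl⟩
  have hCt1 : 96 * ρ * (γ - 1) / (N₁ * log γ) * W ≤ Ct := by
    rw [hCt, hWdef]; exact le_max_left _ _
  have hCt2 : 0 < Ct := by
    rw [hCt]; exact lt_of_lt_of_le (by positivity) (le_max_right _ _)
  rw [← hWdef]
  rw [← hMh] at h2 ⊢
  obtain ⟨Q, hQ⟩ : ∃ Q : ℝ, Q = N₀ + N₁ * ((γ ^ S - 1) / (γ - 1)) := ⟨_, rfl⟩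
  rw [← hQ] at h1 h2
  -- half of the decrease pays for the initial gap and the initial stage
  have e1 : 2 * B₀ + N₀ * (ε * (D / 2 + Mh)) ≤ Q * (ε ^ 2 / (48 * ρ)) := by
    calc 2 * B₀ + N₀ * (ε * (D / 2 + Mh))
        = (96 * ρ * B₀ / ε ^ 2 + 48 * ρ * N₀ * (D / 2 + Mh) / ε) * (ε ^ 2 / (48 * ρ)) := by
          field_simp; ring
      _ ≤ _ := by gcongr
  -- the other half pays for the stages
  have e2 : S * (2 * ε * W) ≤ Q * (ε ^ 2 / (48 * ρ)) := by
    have h4 := mul_log_le_of_ge (div_pos hCt2 hε) hγS h3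
    rw [Real.log_pow] at h4
    have h5 : N₁ / (γ - 1) * γ ^ S ≤ Q := by
      have : N₁ * ((γ ^ S - 1) / (γ - 1)) = N₁ / (γ - 1) * γ ^ S - N₁ / (γ - 1) := by
        field_simp
      rw [hQ, this]
      linarith
    calc S * (2 * ε * W)
        = N₁ / (γ - 1) * (96 * ρ * (γ - 1) / (N₁ * log γ) * W / ε * (S * log γ))
            * (ε ^ 2 / (48 * ρ)) := by field_simp; ring
      _ ≤ N₁ / (γ - 1) * (Ct / ε * (S * log γ)) * (ε ^ 2 / (48 * ρ)) := by gcongr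
      _ ≤ N₁ / (γ - 1) * γ ^ S * (ε ^ 2 / (48 * ρ)) := by gcongr
      _ ≤ _ := by gcongr
  calc _ ≤ Q * (ε ^ 2 / (48 * ρ)) + Q * (ε ^ 2 / (48 * ρ)) := add_le_add e1 e2
    _ = Q * (ε ^ 2 / (24 * ρ)) := by field_simp; ring
    _ ≤ _ := by gcongr

/-- The least stage number exists, and the number of iterations it allows is `O(ε⁻²)`, since
`γ^S` is at most of the order of `ε⁻²` before one of the conditions holds. -/
theorem exists_isLeast_stageCond {ρ σ γ D B₀ K : ℝ} {N₀ N₁ : ℕ} (hρ : 0 < ρ) (hγ : 1 < γ)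
    (hN₁ : 1 ≤ N₁) (hB₀ : 0 ≤ B₀) (hD : 0 ≤ D) (hM : 0 ≤ Mhat σ K) :
    ∃ C : ℝ, ∀ ε : ℝ, 0 < ε → ε ≤ 1 / 2 → ∃ S : ℕ,
      IsLeast {S : ℕ | StageCond ρ σ γ D B₀ K N₀ N₁ ε S} S ∧
      (stageEnd γ N₀ N₁ S : ℝ) ≤ C / ε ^ 2 := by
  classical
  have hγ' : 0 < γ - 1 := by linarith
  have hN₁' : (1 : ℝ) ≤ N₁ := by exact_mod_cast hN₁
  obtain ⟨X, hX⟩ : ∃ X, X = 96 * ρ * B₀ + 48 * ρ * N₀ * (D / 2 + Mhat σ K) := ⟨_, rfl⟩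
  have hX0 : 0 ≤ X := by rw [hX]; positivity
  obtain ⟨c₁, hc₁⟩ : ∃ c₁, c₁ = 96 * ρ * (γ - 1) / (N₁ * log γ) *
      (1 / 2 + D / 2 + 9 * Mhat σ K / 4 + Chat ρ σ K * σ / 4) := ⟨_, rfl⟩
  obtain ⟨G, hG⟩ : ∃ G, G = 1 + (γ - 1) * X + 2 * (max c₁ (exp 1)) ^ 2 := ⟨_, rfl⟩
  have hGX := mul_nonneg hγ'.le hX0
  have hG0 : 0 ≤ G := by rw [hG]; positivity
  refine ⟨N₀ + 2 * N₁ * (γ * G / (γ - 1)), fun ε hε hε' => ?_⟩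
  have hε1 : ε ≤ 1 := by linarith
  have hε2 : 1 ≤ 1 / ε ^ 2 := by
    rw [le_div_iff₀ (by positivity), one_mul]; exact pow_le_one₀ hε.le hε1
  have hXε : 96 * ρ * B₀ / ε ^ 2 + 48 * ρ * N₀ * (D / 2 + Mhat σ K) / ε ≤ X / ε ^ 2 := by
    rw [hX, add_div]
    gcongr
    exact pow_le_of_le_one hε.le hε1 two_ne_zero
  have hCt : Ctilde ρ σ γ D K N₁ ε = max c₁ (ε * exp 1) := by rw [Ctilde, hc₁]
  have hCt0 : 0 < Ctilde ρ σ γ D K N₁ ε := by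
    rw [hCt]; exact lt_of_lt_of_le (by positivity) (le_max_right _ _)
  have hCtG : Ctilde ρ σ γ D K N₁ ε ≤ max c₁ (exp 1) := by
    rw [hCt]
    exact max_le_max le_rfl (mul_le_of_le_one_left (exp_pos _).le hε1)
  obtain ⟨a, ha⟩ : ∃ a, a = Ctilde ρ σ γ D K N₁ ε / ε := ⟨_, rfl⟩
  have ha0 : 0 < a := by rw [ha]; positivity
  have haG : 2 * a * log a ≤ 2 * (max c₁ (exp 1)) ^ 2 / ε ^ 2 := by
    have h1 : log a ≤ a := (Real.log_le_sub_one_of_pos ha0).trans (by linarith)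
    calc 2 * a * log a ≤ 2 * a * a := by gcongr
      _ = 2 * Ctilde ρ σ γ D K N₁ ε ^ 2 / ε ^ 2 := by rw [ha]; field_simp
      _ ≤ _ := by gcongr
  -- the stage conditions hold as soon as `γ^S ≥ G/ε²`
  have hcond : ∀ S : ℕ, G / ε ^ 2 ≤ γ ^ S → StageCond ρ σ γ D B₀ K N₀ N₁ ε S := by
    intro S hS
    have hsplit : G / ε ^ 2
        = 1 / ε ^ 2 + (γ - 1) * (X / ε ^ 2) + 2 * (max c₁ (exp 1)) ^ 2 / ε ^ 2 := by
      rw [hG]; ring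
    have h1 : 0 ≤ (γ - 1) * (X / ε ^ 2) := by positivity
    have h2 : 0 ≤ 2 * (max c₁ (exp 1)) ^ 2 / ε ^ 2 := by positivity
    refine ⟨mul_geom_le_stageEnd hγ N₀ N₁ S, hXε.trans ?_, ?_⟩
    · have h3 : X / ε ^ 2 ≤ (γ ^ S - 1) / (γ - 1) := by
        rw [le_div_iff₀ hγ']; linarith
      have h4 : 0 ≤ X / ε ^ 2 := by positivity
      have h5 := le_mul_of_one_le_left (h4.trans h3) hN₁'
      have h6 : (0 : ℝ) ≤ N₀ := Nat.cast_nonneg _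
      linarith
    · rw [← ha]
      linarith
  have hex : ∃ S, StageCond ρ σ γ D B₀ K N₀ N₁ ε S := by
    obtain ⟨S, hS⟩ := pow_unbounded_of_one_lt (G / ε ^ 2) hγ
    exact ⟨S, hcond S hS.le⟩
  refine ⟨Nat.find hex, ⟨Nat.find_spec hex, fun S hS => Nat.find_min' hex hS⟩, ?_⟩
  have hN₀ : (N₀ : ℝ) ≤ N₀ / ε ^ 2 := by
    rw [div_eq_mul_one_div]
    exact le_mul_of_one_le_right (Nat.cast_nonneg _) hε2
  rcases hS : Nat.find hex with _ | S
  · have h1 : (stageEnd γ N₀ N₁ 0 : ℝ) = N₀ := by simp [stageEnd]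
    rw [h1, add_div]
    have h2 : 0 ≤ 2 * (N₁ : ℝ) * (γ * G / (γ - 1)) / ε ^ 2 := by positivity
    linarith
  · have h1 : γ ^ S ≤ G / ε ^ 2 := by
      by_contra! h
      exact Nat.find_min hex (by omega : S < Nat.find hex) (hcond S h.le)
    calc (stageEnd γ N₀ N₁ (S + 1) : ℝ) ≤ N₀ + 2 * N₁ * (γ ^ (S + 1) / (γ - 1)) :=
          stageEnd_le hγ N₀ hN₁ _
      _ = N₀ + 2 * N₁ * (γ * γ ^ S / (γ - 1)) := by rw [pow_succ']
      _ ≤ N₀ / ε ^ 2 + 2 * N₁ * (γ * (G / ε ^ 2) / (γ - 1)) := by gcongr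
      _ = _ := by ring

/-! ### Complexity of HiAPeM -/

/-- HiAPeM terminates within `K_S` iterations whenever iALM and PenMM meet their guarantees and the
total decrease of the objective over `K_S` iterations outweighs all increases. -/
theorem exists_mem_hiAPeM {P : Problem n l m} {r : Params} {ε ε₂ Mh Λ φ Pm βm B₀ : ℝ}
    (hr : r.Valid) (hg : Differentiable ℝ P.g) (hε : 0 < ε) (hε₂ : ε₂ ≤ ε)
    (hs : OracleSpec P r ε ε₂ Mh Λ φ Pm βm) (hMh : 0 ≤ Mh) (hbd : Bornology.IsBounded P.dom)
    (hobj : ∀ x ∈ P.dom, |P.obj x| ≤ B₀) (hγ : 1 < r.γ) (hN₀ : 1 ≤ r.N₀) (hN₁ : 1 ≤ r.N₁)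
    {start : ℕ → E n} (hstart : ∀ k, start k ∈ P.dom) {x₀ : E n} (hx₀ : x₀ ∈ P.dom) {S : ℕ}
    {loss : ℝ} (hloss : Λ + ε * (P.diam / 4 + 13 / 8 * Mh) ≤ loss)
    (hfin : 2 * B₀ + r.N₀ * (ε * (P.diam / 2 + Mh)) + S * loss
      ≤ stageEnd r.γ r.N₀ r.N₁ S * (ε ^ 2 / (24 * r.ρ))) :
    ∃ out ∈ hiAPeM P r ε ε ε₂ x₀ start,
      out.iters ≤ stageEnd r.γ r.N₀ r.N₁ S ∧ P.IsKKT ε out.x out.p := by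
  obtain ⟨b, hb, hor⟩ := exists_mem_initialStage hr hg hε hs hMh hbd hobj hN₀ hstart hx₀
  simp only [hiAPeM, Part.bind_eq_bind, Part.mem_bind_iff]
  rcases hor with ⟨out, rfl, h1, h2⟩ | ⟨o, rfl, hx, hfeas, ha, hgain, hA⟩
  · refine ⟨out, ⟨_, hb, by simp⟩, h1.trans ?_, h2⟩
    unfold stageEnd
    omega
  · obtain ⟨out, hout, h1, h2⟩ := exists_mem_fix_mainStep hr hg hε hε₂ hs hMh hbd hobj hγ hN₁
      hstart hloss (S := S) (by linarith) hx hfeas ha hA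
    exact ⟨out, ⟨_, hb, hout⟩, h1, h2⟩

end

end HiAPeM

end

theorem mainTheorem2 {n l m : ℕ} (P : HiAPeM.Problem n l m)
    (ρ M B₀ G₀ : ℝ) (B : Fin m → ℝ) (xfeas : HiAPeM.E n)
    (hcomp : P.CompositeSmooth)
    (hB : ∀ i, ∀ x ∈ P.dom, |P.f i x| ≤ B i ∧ ‖gradient (P.f i) x‖ ≤ B i)
    (hslater : P.IsSlater xfeas)
    (hweak : P.WeaklyConvex ρ)
    (hM : 0 ≤ M) (hbound : P.UniformBound M B₀)
    (hG : ∀ x ∈ P.dom, ‖gradient P.g x‖ ≤ G₀)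
    (σ γ : ℝ) (hσ : 1 < σ) (hγ : 1 < γ)
    (N₀ N₁ : ℕ) (hN₁ : 1 ≤ N₁) (hN₀ : (N₁ : ℝ) / (γ - 1) ≤ N₀) :
    ∃ C : ℝ, ∀ ε : ℝ, 0 < ε → ε ≤ 1 / 2 →
      ∃ S : ℕ,
        IsLeast {S : ℕ | HiAPeM.StageCond ρ σ γ P.diam B₀ (P.Mp ρ M G₀ B xfeas) N₀ N₁ ε S} S ∧
        (HiAPeM.stageEnd γ N₀ N₁ S : ℝ) ≤ C / ε ^ 2 ∧
        ∀ β₀ γ₁ γ₂ Lmin : ℝ, 0 < β₀ → 1 < γ₁ → 1 ≤ γ₂ → ρ ≤ Lmin →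
          ∀ x₀ ∈ P.dom, ∀ start : ℕ → HiAPeM.E n, (∀ k, start k ∈ P.dom) →
            ∃ out ∈ HiAPeM.hiAPeM P
                { β₀ := β₀, σ := σ, ρ := ρ, γ := γ, γ₁ := γ₁, γ₂ := γ₂, Lmin := Lmin,
                  N₀ := N₀, N₁ := N₁ }
                ε ε (ε / (2 * √2) * min 1 (1 / √ρ)) x₀ start,
              out.iters ≤ HiAPeM.stageEnd γ N₀ N₁ S ∧ P.IsKKT ε out.x out.p := by
  have hγ' : 0 < γ - 1 := by linarith
  have hρ := hweak.pos
  have hne : P.dom.Nonempty := ⟨xfeas, interior_subset hslater.mem_interior⟩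
  have hB₀ : 0 ≤ B₀ := (abs_nonneg _).trans (hbound.obj_bound _ hne.some_mem)
  have hD : 0 ≤ P.diam := Metric.diam_nonneg
  obtain ⟨K, hKdef⟩ : ∃ K, K = P.Mp ρ M G₀ B xfeas := ⟨_, rfl⟩
  have hK : 0 ≤ K := hKdef ▸ Real.sqrt_nonneg _
  have hrel := HiAPeM.constRel hσ hρ hK
  have hMh := hrel.Mh_pos
  have hC4 := hrel.C_ge
  have hCσ : 0 < HiAPeM.Chat ρ σ K * σ := mul_pos (by linarith) (by linarith)
  rw [← hKdef]
  obtain ⟨C, hC⟩ := HiAPeM.exists_isLeast_stageCond (N₀ := N₀) hρ hγ hN₁ hB₀ hD hMh.le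
  refine ⟨C, fun ε hε hε' => ?_⟩
  obtain ⟨S, hS, hSC⟩ := hC ε hε hε'
  refine ⟨S, hS, hSC, fun β₀ γ₁ γ₂ Lmin hβ₀ hγ₁ hγ₂ hL x₀ hx₀ start hstart => ?_⟩
  obtain ⟨r, hrdef⟩ : ∃ r : HiAPeM.Params, r = ⟨β₀, σ, ρ, γ, γ₁, γ₂, Lmin, N₀, N₁⟩ := ⟨_, rfl⟩
  rw [← hrdef]
  have e1 : r.σ = σ := by rw [hrdef]
  have e2 : r.ρ = ρ := by rw [hrdef]
  have e3 : r.γ = γ := by rw [hrdef]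
  have e4 : r.N₀ = N₀ := by rw [hrdef]
  have e5 : r.N₁ = N₁ := by rw [hrdef]
  have hr : r.Valid := by
    rw [hrdef]
    exact ⟨hβ₀, hσ, hρ, hγ₁, hγ₂, hL⟩
  have hN₀' : 1 ≤ N₀ := by
    have h1 : (0 : ℝ) < N₁ := by exact_mod_cast hN₁
    have h2 : (0 : ℝ) < N₀ := (div_pos h1 hγ').trans_le hN₀
    exact_mod_cast h2
  have hQ : ∀ c ∈ P.dom, (P.prox r.ρ c).StronglyConvexProblem r.ρ := fun c _ => by
    rw [e2]
    exact HiAPeM.Problem.stronglyConvexProblem_prox hcomp hbound hne hweak c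
  have hsad : ∀ c ∈ P.dom, ∃ xs ps, (P.prox r.ρ c).IsSaddle r.ρ xs ps ∧ HiAPeM.dnorm ps ≤ K :=
    fun c hc => by
      rw [e2, hKdef]
      exact HiAPeM.Problem.exists_isSaddle hcomp hB hslater hweak hbound hM hG hc
  have hspec : ∃ φ Pm βm, HiAPeM.OracleSpec P r ε (ε / (2 * √2) * min 1 (1 / √r.ρ))
      (HiAPeM.Mhat r.σ K) (r.σ * HiAPeM.Chat r.ρ r.σ K * ε / 8) φ Pm βm := by
    rcases le_or_gt (ε * r.β₀) (HiAPeM.Chat r.ρ r.σ K) with h | h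
    · exact ⟨_, _, _, HiAPeM.oracleSpec_of_le hr hQ hsad hK hε hε' h⟩
    · obtain ⟨φ, Pm, hs⟩ := HiAPeM.oracleSpec_of_lt hr hQ hsad hK hε hε' h
      exact ⟨φ, Pm, _, hs⟩
  rw [e1, e2] at hspec
  obtain ⟨φ, Pm, βm, hspec⟩ := hspec
  have hε₂ : ε / (2 * √2) * min 1 (1 / √ρ) ≤ ε := by
    have h1 : 1 ≤ √2 := Real.one_le_sqrt.2 (by norm_num)
    calc ε / (2 * √2) * min 1 (1 / √ρ) ≤ ε / 1 * 1 := by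
          gcongr
          · linarith
          · exact min_le_left _ _
      _ = ε := by ring
  have hεD := mul_nonneg hε.le hD
  have hεM := mul_pos hε hMh
  have hεC := mul_pos hε hCσ
  rw [← e3, ← e4, ← e5]
  refine HiAPeM.exists_mem_hiAPeM (B₀ := B₀) hr hcomp.g_diff hε hε₂ hspec hMh.le
    hcomp.dom_bounded hbound.obj_bound (e3 ▸ hγ) (e4 ▸ hN₀') (e5 ▸ hN₁) hstart hx₀
    (loss := 2 * ε *
      (1 / 2 + P.diam / 2 + 9 * HiAPeM.Mhat σ K / 4 + HiAPeM.Chat ρ σ K * σ / 4)) ?_ ?_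
  · linarith
  · rw [e2, e3, e4, e5]
    exact hS.1.budget_le hρ hγ hε hN₁ hN₀
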